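/- Let $T=[v_1,v_2,v_3]\subset\mathbb R^2$ be a nondegenerate triangle, and let $v_4,v_5,v_6$ be the midpoints of $[v_1,v_2]$, $[v_2,v_3]$, $[v_1,v_3]$. Let $T_{12}$ be the Powell-Sabin 12-split of $T$ (all lines joining two of the points $v_1,\dots,v_6$ are drawn inside $T$; twelve triangular faces), and let $\mathcal S^3_5$ be the space of $C^3$ functions on $T$ that are polynomials of total degree at most $5$ on each face. For a multiset $K$ of vertices of $T_{12}$ let $[K]$ be its convex hull and $Q[K]:\mathbb R^2\to\mathbb R$ the area normalized simplex spline: $Q[K]=0$ if $\operatorname{area}[K]=0$; $Q[K]=\mathbf 1_{[K)}\operatorname{area}(T)/\operatorname{area}([K])$ if $\operatorname{area}[K]\ne 0$ and $|K|=3$; and $Q[K](x)=\sum_j\beta_jQ[K\setminus v_j](x)$ if $\operatorname{area}[K]\neq0$ and $|K|>3$, where $x=\sum_j\beta_jv_j$, $\sum_j\beta_j=1$, and $\beta_j=0$ whenever $v_j\notin K$. Here every point of $T$ is assigned to one of the closed faces that contain it (in an arbitrary fixed way), and $[K)$ is the set of the points of $T$ whose assigned face lies in $[K]$. Write $Q_{ijklmn}=Q[v_1^iv_2^jv_3^kv_4^lv_5^mv_6^n]$.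 Functions on $T$ are identified with their extensions by zero to $\mathbb R^2$. Let $\Lambda$ consist of the following 39 functionals, where $\varepsilon_p$ is evaluation at $p$ and $D_w$ the derivative in direction $w$: for each corner $v$ with opposite edge $[v_i,v_j]$, all $\varepsilon_vD_x^aD_y^b$ with $a+b\le3$, $x=v_i-v$, $y=v_j-v$; and for each edge $e=[v_i,v_j]$ with midpoint $m_e$, quarterpoints $q_{1,e}=(3v_i+v_j)/4$ and $q_{2,e}=(v_i+3v_j)/4$, opposite corner $v_k$ and $u=v_k-m_e$, the functionals $\varepsilon_{q_{1,e}}D_u^2$, $\varepsilon_{m_e}D_u$, $\varepsilon_{q_{2,e}}D_u^2$. Then $\mathcal S^3_5$ has a basis $\{\lambda^*\}_{\lambda\in\Lambda}$ dual to $\Lambda$, that is, $\mu(\lambda^*)=1$ if $\mu=\lambda$ and $\mu(\lambda^*)=0$ otherwise. With $v=v_1$, $x=v_2-v_1$, $y=v_3-v_1$, $e=[v_1,v_2]$, $q_{1,e}=(3v_1+v_2)/4$ and $u=v_3-v_4$, \begin{align*} \varepsilon_v^*={}&\tfrac14Q_{600101}+\tfrac14(Q_{500201}+Q_{500102})+\tfrac12(Q_{410201}+Q_{401102})+Q_{411101}+\tfrac12(Q_{311201}+Q_{311102})\\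 &+\tfrac12(Q_{320201}+Q_{302102})+\tfrac9{16}(Q_{211211}+Q_{211112})+\tfrac38(Q_{220211}+Q_{202112})+\tfrac3{16}(Q_{112112}+Q_{121211}),\\ (\varepsilon_vD_x)^*={}&\tfrac1{40}Q_{500201}+\tfrac1{10}Q_{410201}+\tfrac15Q_{320201}+\tfrac1{10}Q_{411101}+\tfrac3{20}Q_{311201}+\tfrac{13}{80}Q_{220211}\\ &+\tfrac1{20}Q_{311102}+\tfrac{19}{80}Q_{211211}+\tfrac1{10}Q_{121211}-\tfrac1{40}Q_{211112}-\tfrac1{40}Q_{202112}-\tfrac1{20}Q_{112112},\\ (\varepsilon_vD_x^2)^*={}&\tfrac1{160}Q_{410201}+\tfrac1{32}Q_{320201}+\tfrac1{80}Q_{311201}+\tfrac{17}{640}Q_{220211}+\tfrac{121}{3840}Q_{211211}+\tfrac{71}{3840}Q_{121211}-\tfrac1{48}Q_{211112}+\tfrac1{480}Q_{112112},\\ (\varepsilon_vD_xD_y)^*={}&\tfrac1{80}Q_{411101}+\tfrac3{160}(Q_{311201}+Q_{311102})-\tfrac1{160}(Q_{220211}+Q_{202112})+\tfrac{17}{960}(Q_{211112}+Q_{211211})-\tfrac7{480}(Q_{112112}+Q_{121211}),\\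 (\varepsilon_vD_x^3)^*={}&\tfrac1{480}Q_{320201}+\tfrac7{3840}Q_{220211}+\tfrac5{3072}Q_{211211}+\tfrac7{5120}Q_{121211},\\ (\varepsilon_vD_x^2D_y)^*={}&\tfrac1{480}Q_{311201}-\tfrac1{1920}Q_{220211}-\tfrac1{768}Q_{121211}+\tfrac{11}{3840}Q_{211211}-\tfrac{11}{3840}Q_{211112}+\tfrac1{3840}Q_{112112},\\ (\varepsilon_{q_{1,e}}D_u^2)^*={}&\tfrac7{240}Q_{211211}-\tfrac1{240}Q_{121211},\\ (\varepsilon_{m_e}D_u)^*={}&\tfrac1{10}Q_{220211}+\tfrac15(Q_{211211}+Q_{121211}). \end{align*} The same eight formulas hold for every relabelling $v_{\sigma(1)},v_{\sigma(2)},v_{\sigma(3)}$ of the corners, $\sigma\in S_3$ (with $v_4,v_5,v_6$, the directions and the simplex splines relabelled accordingly); this gives all 39 nodal functions. In particular the coefficients are rational and do not depend on the triangle. -/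

import Mathlib

namespace PowellSabin

/-- The Euclidean plane. -/
abbrev Plane := EuclideanSpace ℝ (Fin 2)

/-- The area of a planar set (Lebesgue measure). -/
noncomputable def area (s : Set Plane) : ℝ := (MeasureTheory.volume s).toReal

/-- Barycentric coordinates, with respect to the macrotriangle, of the ten vertices
`v₁, …, v₁₀` of the 12-split (indices shifted by one): the three corners, the midpoints `v₄`, `v₅`,
`v₆` of `[v₁, v₂]`, `[v₂, v₃]`, `[v₁, v₃]`, the points `v₇`, `v₈`, `v₉` in which the medians from
`v₁`, `v₂`, `v₃` meet the sides of the triangle `[v₄, v₅, v₆]`, and the centroid `v₁₀`. -/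
def splitCoord : Fin 10 → Fin 3 → ℚ :=
  ![![1, 0, 0], ![0, 1, 0], ![0, 0, 1],
    ![1 / 2, 1 / 2, 0], ![0, 1 / 2, 1 / 2], ![1 / 2, 0, 1 / 2],
    ![1 / 2, 1 / 4, 1 / 4], ![1 / 4, 1 / 2, 1 / 4], ![1 / 4, 1 / 4, 1 / 2],
    ![1 / 3, 1 / 3, 1 / 3]]

/-- The vertices `v₁, …, v₁₀` of the 12-split of the triangle with corners `v 0`, `v 1`, `v 2`. -/
noncomputable def splitPoint (v : Fin 3 → Plane) (j : Fin 10) : Plane :=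
  ∑ k, (splitCoord j k : ℝ) • v k

/-- The closed macrotriangle. -/
def macroTriangle (v : Fin 3 → Plane) : Set Plane := convexHull ℝ (Set.range v)

/-- The vertices of the twelve faces of the 12-split. -/
def faceVertex : Fin 12 → Fin 3 → Fin 10 :=
  ![![0, 3, 6], ![0, 5, 6], ![1, 3, 7], ![1, 4, 7], ![2, 4, 8], ![2, 5, 8],
    ![3, 6, 9], ![3, 7, 9], ![4, 7, 9], ![4, 8, 9], ![5, 8, 9], ![5, 6, 9]]

/-- The twelve closed faces of the 12-split. -/
def face (v : Fin 3 → Plane) (f : Fin 12) : Set Plane :=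
  convexHull ℝ (Set.range fun k => splitPoint v (faceVertex f k))

/-- `cell` assigns every point of the macrotriangle to one of the closed faces of the 12-split
that contain it; the points assigned to a face make up the corresponding half-open face. -/
def IsFaceAssignment (v : Fin 3 → Plane) (cell : Plane → Set Plane) : Prop :=
  ∀ x ∈ macroTriangle v, x ∈ cell x ∧ ∃ f, cell x = face v f

/-- A point with nonnegative coordinates with respect to the vertices of a face lies in it. -/
theorem mem_face_of_coord (v : Fin 3 → Plane) (f : Fin 12) (w c : Fin 3 → ℝ) (hc : ∀ k, 0 ≤ c k)
    (h1 : ∑ k, c k = 1) (h : ∀ i, ∑ k, c k * (splitCoord (faceVertex f k) i : ℝ) = w i) :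
    ∑ i, w i • v i ∈ face v f := by
  have e : ∑ i, w i • v i = ∑ k, c k • splitPoint v (faceVertex f k) := by
    simp only [splitPoint, Finset.smul_sum, smul_smul]
    rw [Finset.sum_comm]
    refine Finset.sum_congr rfl fun i _ => ?_
    rw [← Finset.sum_smul, h i]
  rw [e]
  exact (convex_convexHull ℝ _).sum_mem (fun k _ => hc k) h1
    fun k _ => subset_convexHull ℝ _ ⟨k, rfl⟩

/-- The twelve faces cover the macrotriangle, so face assignments exist. -/
theorem exists_isFaceAssignment (v : Fin 3 → Plane) : ∃ cell, IsFaceAssignment v cell := by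
  have cover : ∀ x ∈ macroTriangle v, ∃ f, x ∈ face v f := by
    intro x hx
    obtain ⟨w, hw, hw1, rfl⟩ : ∃ w : Fin 3 → ℝ, (∀ i, 0 ≤ w i) ∧ ∑ i, w i = 1 ∧
        ∑ i, w i • v i = x := by
      rw [macroTriangle, convexHull_range_eq_exists_affineCombination] at hx
      obtain ⟨s, w, h0, h1, rfl⟩ := hx
      refine ⟨fun i => if i ∈ s then w i else 0, fun i => ?_, ?_, ?_⟩
      · dsimp only
        split_ifs with h
        exacts [h0 i h, le_rfl]
      · simpa using h1
      · rw [Finset.affineCombination_eq_linear_combination _ _ _ h1]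
        simp
    have h0 := hw 0
    have h1 := hw 1
    have h2 := hw 2
    rw [Fin.sum_univ_three] at hw1
    have go : ∀ (f : Fin 12) (a b c : ℝ), 0 ≤ a → 0 ≤ b → 0 ≤ c → a + b + c = 1 →
        (∀ i, a * (splitCoord (faceVertex f 0) i : ℝ) + b * (splitCoord (faceVertex f 1) i : ℝ) +
          c * (splitCoord (faceVertex f 2) i : ℝ) = w i) → ∃ f, ∑ i, w i • v i ∈ face v f := by
      intro f a b c ha hb hc hs h
      refine ⟨f, mem_face_of_coord v f w ![a, b, c] ?_ ?_ fun i => ?_⟩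
      · intro k
        fin_cases k <;> assumption
      · simpa [Fin.sum_univ_three] using hs
      · simpa [Fin.sum_univ_three] using h i
    have outer : ∀ (f : Fin 12) (i j k : Fin 3), w k ≤ w j → w j + w k ≤ w i →
        w i + w j + w k = 1 →
        (∀ l, (w i - w j - w k) * (splitCoord (faceVertex f 0) l : ℝ) +
          2 * (w j - w k) * (splitCoord (faceVertex f 1) l : ℝ) +
          4 * w k * (splitCoord (faceVertex f 2) l : ℝ) = w l) →
        ∃ f, ∑ i, w i • v i ∈ face v f := fun f i j k h h' hs =>
      go f _ _ _ (by linarith) (by linarith) (by linarith [hw k]) (by linarith)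
    have inner : ∀ (f : Fin 12) (i j k : Fin 3), w k ≤ w j → w j ≤ w i → w i ≤ w j + w k →
        w i + w j + w k = 1 →
        (∀ l, 2 * (w j - w k) * (splitCoord (faceVertex f 0) l : ℝ) +
          4 * (w i - w j) * (splitCoord (faceVertex f 1) l : ℝ) +
          3 * (w j + w k - w i) * (splitCoord (faceVertex f 2) l : ℝ) = w l) →
        ∃ f, ∑ i, w i • v i ∈ face v f := fun f i j k h h' h'' hs =>
      go f _ _ _ (by linarith) (by linarith) (by linarith) (by linarith)
    have split : ∀ (f g : Fin 12) (i j k : Fin 3), w k ≤ w j → w j ≤ w i → w i + w j + w k = 1 →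
        (∀ l, (w i - w j - w k) * (splitCoord (faceVertex f 0) l : ℝ) +
          2 * (w j - w k) * (splitCoord (faceVertex f 1) l : ℝ) +
          4 * w k * (splitCoord (faceVertex f 2) l : ℝ) = w l) →
        (∀ l, 2 * (w j - w k) * (splitCoord (faceVertex g 0) l : ℝ) +
          4 * (w i - w j) * (splitCoord (faceVertex g 1) l : ℝ) +
          3 * (w j + w k - w i) * (splitCoord (faceVertex g 2) l : ℝ) = w l) →
        ∃ f, ∑ i, w i • v i ∈ face v f := by
      intro f g i j k h h' hs hf hg
      rcases le_total (w j + w k) (w i) with h'' | h''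
      · exact outer f i j k h h'' hs hf
      · exact inner g i j k h h' h'' hs hg
    rcases le_total (w 0) (w 1) with h01 | h01 <;> rcases le_total (w 1) (w 2) with h12 | h12 <;>
      rcases le_total (w 0) (w 2) with h02 | h02
    · refine split 4 9 2 1 0 (by linarith) (by linarith) (by linarith) ?_ ?_ <;>
        simp [Fin.forall_fin_succ, faceVertex, splitCoord] <;> ring_nf <;> simp
    · refine split 4 9 2 1 0 (by linarith) (by linarith) (by linarith) ?_ ?_ <;>
        simp [Fin.forall_fin_succ, faceVertex, splitCoord] <;> ring_nf <;> simp
    · refine split 3 8 1 2 0 (by linarith) (by linarith) (by linarith) ?_ ?_ <;>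
        simp [Fin.forall_fin_succ, faceVertex, splitCoord] <;> ring_nf <;> simp
    · refine split 2 7 1 0 2 (by linarith) (by linarith) (by linarith) ?_ ?_ <;>
        simp [Fin.forall_fin_succ, faceVertex, splitCoord] <;> ring_nf <;> simp
    · refine split 5 10 2 0 1 (by linarith) (by linarith) (by linarith) ?_ ?_ <;>
        simp [Fin.forall_fin_succ, faceVertex, splitCoord] <;> ring_nf <;> simp
    · refine split 1 11 0 2 1 (by linarith) (by linarith) (by linarith) ?_ ?_ <;>
        simp [Fin.forall_fin_succ, faceVertex, splitCoord] <;> ring_nf <;> simp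
    · refine split 0 6 0 1 2 (by linarith) (by linarith) (by linarith) ?_ ?_ <;>
        simp [Fin.forall_fin_succ, faceVertex, splitCoord] <;> ring_nf <;> simp
    · refine split 0 6 0 1 2 (by linarith) (by linarith) (by linarith) ?_ ?_ <;>
        simp [Fin.forall_fin_succ, faceVertex, splitCoord] <;> ring_nf <;> simp
  choose! f hf using cover
  exact ⟨fun x => face v (f x), fun x hx => ⟨hf x hx, f x, rfl⟩⟩

/-! ### Knot multisets and simplex splines

A knot multiset `{v₁^{m₁} ⋯ v₁₀^{m₁₀}}` is given by its multiplicities `m : Fin 10 → ℕ`. -/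

/-- The convex hull of the knots. -/
def knotHull (v : Fin 3 → Plane) (m : Fin 10 → ℕ) : Set Plane :=
  convexHull ℝ (splitPoint v '' {j | m j ≠ 0})

/-- The half-open convex hull of the knots: the union of the half-open faces whose closed face
lies in the convex hull. -/
def halfOpenHull (v : Fin 3 → Plane) (cell : Plane → Set Plane) (m : Fin 10 → ℕ) : Set Plane :=
  {x | x ∈ macroTriangle v ∧ cell x ⊆ knotHull v m}

/-- Twice the signed area of the triangle `[a, b, c]`. -/
def orient (a b c : Plane) : ℝ :=
  (b 0 - a 0) * (c 1 - a 1) - (c 0 - a 0) * (b 1 - a 1)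

/-- All triples of indices of vertices of the 12-split, in lexicographic order. -/
def triples : List (Fin 10 × Fin 10 × Fin 10) :=
  List.product (List.finRange 10) (List.product (List.finRange 10) (List.finRange 10))

open Classical in
/-- The first triple of affinely independent knots, if there is one. -/
noncomputable def knotTriple (v : Fin 3 → Plane) (m : Fin 10 → ℕ) :
    Option (Fin 10 × Fin 10 × Fin 10) :=
  triples.find? fun t => decide ((m t.1 ≠ 0 ∧ m t.2.1 ≠ 0 ∧ m t.2.2 ≠ 0) ∧
    orient (splitPoint v t.1) (splitPoint v t.2.1) (splitPoint v t.2.2) ≠ 0)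

/-- Coefficients `β₁, …, β₁₀` with `x = ∑ βⱼ vⱼ`, `∑ βⱼ = 1`, and `βⱼ = 0` whenever `mⱼ = 0`: the
barycentric coordinates of `x` with respect to the first triple of affinely independent knots
(see `knotCoord_spec`). The simplex spline does not depend on which such coefficients are used. -/
noncomputable def knotCoord (v : Fin 3 → Plane) (m : Fin 10 → ℕ) (x : Plane) : Fin 10 → ℝ :=
  match knotTriple v m with
  | none => 0
  | some (a, b, c) =>
    let A := splitPoint v a
    let B := splitPoint v b
    let C := splitPoint v c
    Pi.single a (orient x B C / orient A B C) + Pi.single b (orient A x C / orient A B C) +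
      Pi.single c (orient A B x / orient A B C)

/-- The coefficients `knotCoord v m x` are admissible in the recursion for simplex splines. -/
theorem knotCoord_spec (v : Fin 3 → Plane) (m : Fin 10 → ℕ) (x : Plane)
    (h : area (knotHull v m) ≠ 0) :
    ∑ j, knotCoord v m x j = 1 ∧ ∑ j, knotCoord v m x j • splitPoint v j = x ∧
      ∀ j, m j = 0 → knotCoord v m x j = 0 := by
  classical
  have hex : ∃ t ∈ triples, (m t.1 ≠ 0 ∧ m t.2.1 ≠ 0 ∧ m t.2.2 ≠ 0) ∧
      orient (splitPoint v t.1) (splitPoint v t.2.1) (splitPoint v t.2.2) ≠ 0 := by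
    by_contra hno
    apply h
    have key : ∀ a b c, m a ≠ 0 → m b ≠ 0 → m c ≠ 0 →
        orient (splitPoint v a) (splitPoint v b) (splitPoint v c) = 0 := by
      intro a b c ha hb hc
      by_contra hne
      exact hno ⟨(a, b, c), by simp [triples], ⟨ha, hb, hc⟩, hne⟩
    have main : ∀ (p w : Plane), w ≠ 0 →
        (∀ c, m c ≠ 0 → w 0 * (splitPoint v c 1 - p 1) - (splitPoint v c 0 - p 0) * w 1 = 0) →
        area (knotHull v m) = 0 := by
      intro p w hw hc
      let φ : Plane →ₗ[ℝ] ℝ :=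
        w 0 • (EuclideanSpace.proj (1 : Fin 2) : Plane →L[ℝ] ℝ).toLinearMap -
          w 1 • (EuclideanSpace.proj (0 : Fin 2) : Plane →L[ℝ] ℝ).toLinearMap
      have hφ : ∀ z : Plane, φ z = w 0 * z 1 - w 1 * z 0 := fun z => by simp [φ]
      let L : AffineSubspace ℝ Plane := AffineSubspace.mk' p (LinearMap.ker φ)
      have hL : knotHull v m ⊆ (L : Set Plane) := by
        refine convexHull_min ?_ L.convex
        rintro _ ⟨c, hcm, rfl⟩
        simp only [L, SetLike.mem_coe, AffineSubspace.mem_mk', LinearMap.mem_ker, hφ, vsub_eq_sub,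
          PiLp.sub_apply]
        linarith [hc c hcm]
      have hLt : L ≠ ⊤ := by
        intro ht
        have hd : L.direction = ⊤ := by rw [ht, AffineSubspace.direction_top]
        rw [AffineSubspace.direction_mk'] at hd
        have hz : ∀ z, φ z = 0 := fun z => by
          have : z ∈ LinearMap.ker φ := hd ▸ Submodule.mem_top
          exact this
        apply hw
        have h0 := hz (EuclideanSpace.single 1 1)
        have h1 := hz (EuclideanSpace.single 0 1)
        rw [hφ] at h0 h1
        simp at h0 h1
        ext i
        fin_cases i
        · simpa using h0
        · simpa using h1
      have h0 := MeasureTheory.Measure.addHaar_affineSubspace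
        (MeasureTheory.volume : MeasureTheory.Measure Plane) L hLt
      simp [area, MeasureTheory.measure_mono_null hL h0]
    by_cases hab : ∃ a b, m a ≠ 0 ∧ m b ≠ 0 ∧ splitPoint v b - splitPoint v a ≠ 0
    · obtain ⟨a, b, ha, hb, hne⟩ := hab
      refine main (splitPoint v a) _ hne fun c hc => ?_
      have := key a b c ha hb hc
      simpa [orient] using this
    · push Not at hab
      have hw : (EuclideanSpace.single 0 1 : Plane) ≠ 0 := by simp
      by_cases ha : ∃ a, m a ≠ 0
      · obtain ⟨a, ha⟩ := ha
        refine main (splitPoint v a) _ hw fun c hc => ?_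
        have := sub_eq_zero.1 (hab a c ha hc)
        simp [this]
      · push Not at ha
        exact main 0 _ hw fun c hc => absurd (ha c) hc
  obtain ⟨⟨a, b, c⟩, ht⟩ : ∃ t, knotTriple v m = some t := by
    rw [← Option.isSome_iff_exists, knotTriple, List.find?_isSome]
    obtain ⟨t, ht, h'⟩ := hex
    exact ⟨t, ht, by simpa using h'⟩
  have hs := List.find?_some ht
  simp only [decide_eq_true_eq] at hs
  obtain ⟨⟨ha, hb, hc⟩, hne⟩ := hs
  have e : knotCoord v m x =
      Pi.single a (orient x (splitPoint v b) (splitPoint v c) /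
        orient (splitPoint v a) (splitPoint v b) (splitPoint v c)) +
      Pi.single b (orient (splitPoint v a) x (splitPoint v c) /
        orient (splitPoint v a) (splitPoint v b) (splitPoint v c)) +
      Pi.single c (orient (splitPoint v a) (splitPoint v b) x /
        orient (splitPoint v a) (splitPoint v b) (splitPoint v c)) := by
    simp only [knotCoord, ht]
  rw [e]
  refine ⟨?_, ?_, ?_⟩
  · simp only [Pi.add_apply, Finset.sum_add_distrib, Finset.sum_pi_single', Finset.mem_univ, if_true]
    field_simp
    simp only [orient]
    ring
  · simp only [Pi.add_apply, add_smul, Finset.sum_add_distrib, Pi.single_apply, ite_smul, zero_smul,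
      Finset.sum_ite_eq', Finset.mem_univ, if_true]
    ext i
    simp only [PiLp.add_apply, PiLp.smul_apply, smul_eq_mul]
    field_simp
    fin_cases i <;> simp only [orient, Fin.mk_one, Fin.zero_eta] <;> ring
  · intro j hj
    have h1 : j ≠ a := fun h => ha (h ▸ hj)
    have h2 : j ≠ b := fun h => hb (h ▸ hj)
    have h3 : j ≠ c := fun h => hc (h ▸ hj)
    simp [h1, h2, h3]

/-- Removing one copy of the knot `vⱼ`. -/
def removeKnot (m : Fin 10 → ℕ) (j : Fin 10) : Fin 10 → ℕ := Function.update m j (m j - 1)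

open Classical in
/-- The recursion for simplex splines; the first argument is the number of knots minus three. -/
noncomputable def simplexSplineAux (v : Fin 3 → Plane) (cell : Plane → Set Plane) :
    ℕ → (Fin 10 → ℕ) → Plane → ℝ
  | 0, m, x =>
    if area (knotHull v m) = 0 then 0
    else (halfOpenHull v cell m).indicator 1 x * (area (macroTriangle v) / area (knotHull v m))
  | n + 1, m, x =>
    if area (knotHull v m) = 0 then 0
    else ∑ j, knotCoord v m x j * simplexSplineAux v cell n (removeKnot m j) x

/-- The area normalized simplex spline `Q[v₁^{m₁} ⋯ v₁₀^{m₁₀}]`. -/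
noncomputable def simplexSpline (v : Fin 3 → Plane) (cell : Plane → Set Plane) (m : Fin 10 → ℕ) :
    Plane → ℝ :=
  simplexSplineAux v cell ((∑ j, m j) - 3) m

/-- Degenerate knot multisets have simplex spline zero. -/
theorem simplexSpline_of_area_eq_zero (v : Fin 3 → Plane) (cell : Plane → Set Plane)
    (m : Fin 10 → ℕ) (h : area (knotHull v m) = 0) (x : Plane) :
    simplexSpline v cell m x = 0 := by
  unfold simplexSpline
  cases (∑ j, m j) - 3 <;> simp [simplexSplineAux, h]

/-- The simplex spline of three affinely independent knots. -/
theorem simplexSpline_of_card_eq_three (v : Fin 3 → Plane) (cell : Plane → Set Plane)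
    (m : Fin 10 → ℕ) (h : area (knotHull v m) ≠ 0) (hm : ∑ j, m j = 3) (x : Plane) :
    simplexSpline v cell m x =
      (halfOpenHull v cell m).indicator 1 x * (area (macroTriangle v) / area (knotHull v m)) := by
  simp [simplexSpline, hm, simplexSplineAux, h]

/-- The recursion for simplex splines with more than three knots. -/
theorem simplexSpline_of_three_lt_card (v : Fin 3 → Plane) (cell : Plane → Set Plane)
    (m : Fin 10 → ℕ) (h : area (knotHull v m) ≠ 0) (hm : 3 < ∑ j, m j) (x : Plane) :
    simplexSpline v cell m x =
      ∑ j, knotCoord v m x j * simplexSpline v cell (removeKnot m j) x := by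
  obtain ⟨n, hn⟩ : ∃ n, ∑ j, m j = n + 4 := ⟨_, (Nat.sub_add_cancel hm).symm⟩
  have e : (∑ j, m j) - 3 = n + 1 := by omega
  rw [simplexSpline, e, simplexSplineAux, if_neg h]
  refine Finset.sum_congr rfl fun j _ => ?_
  by_cases hj : m j = 0
  · rw [(knotCoord_spec v m x h).2.2 j hj, zero_mul, zero_mul]
  · have e' : (∑ i, removeKnot m j i) - 3 = n := by
      have h1 := Finset.add_sum_erase Finset.univ m (Finset.mem_univ j)
      have h2 := Finset.add_sum_erase Finset.univ (removeKnot m j) (Finset.mem_univ j)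
      have h3 : ∑ i ∈ Finset.univ.erase j, removeKnot m j i = ∑ i ∈ Finset.univ.erase j, m i :=
        Finset.sum_congr rfl fun i hi => by
          simp [removeKnot, Function.update_of_ne (Finset.ne_of_mem_erase hi)]
      have h4 : removeKnot m j j = m j - 1 := by simp [removeKnot]
      omega
    rw [simplexSpline, e']

/-- The simplex spline `Q[v₁^i v₂^j v₃^k v₄^l v₅^m v₆^n]`. -/
noncomputable def simplexSpline₆ (v : Fin 3 → Plane) (cell : Plane → Set Plane)
    (i j k l m n : ℕ) : Plane → ℝ :=
  simplexSpline v cell ![i, j, k, l, m, n, 0, 0, 0, 0]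

/-! ### The spline space -/

/-- The space of `C^r` splines of degree `d` on the 12-split. A function on the macrotriangle is
identified with its extension by zero to the plane. -/
def splineSpace (v : Fin 3 → Plane) (r d : ℕ) : Submodule ℝ (Plane → ℝ) where
  carrier := {g | (∀ x, x ∉ macroTriangle v → g x = 0) ∧
    ContDiffOn ℝ r g (macroTriangle v) ∧
    ∀ f, ∃ p : MvPolynomial (Fin 2) ℝ, p.totalDegree ≤ d ∧
      ∀ x ∈ face v f, g x = MvPolynomial.eval (fun k => x k) p}
  zero_mem' := ⟨fun _ _ => rfl, contDiffOn_const, fun _ => ⟨0, by simp, fun _ _ => by simp⟩⟩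
  add_mem' := by
    rintro g g' ⟨h1, h2, h3⟩ ⟨h1', h2', h3'⟩
    refine ⟨fun x hx => by simp [h1 x hx, h1' x hx], h2.add h2', fun f => ?_⟩
    obtain ⟨p, hp, e⟩ := h3 f
    obtain ⟨p', hp', e'⟩ := h3' f
    exact ⟨p + p', (MvPolynomial.totalDegree_add _ _).trans (max_le hp hp'),
      fun x hx => by simp [e x hx, e' x hx]⟩
  smul_mem' := by
    rintro c g ⟨h1, h2, h3⟩
    refine ⟨fun x hx => by simp [h1 x hx], contDiffOn_const.smul h2, fun f => ?_⟩
    obtain ⟨p, hp, e⟩ := h3 f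
    exact ⟨c • p, (MvPolynomial.totalDegree_smul_le _ _).trans hp,
      fun x hx => by simp [e x hx, MvPolynomial.smul_eval]⟩

/-! ### The Hermite functionals

For `k : Fin 3` the corner `v k` has the opposing edge `[v (k + 1), v (k + 2)]`, and edge number `k`
is `[v k, v (k + 1)]`, with opposing corner `v (k + 2)` (indices modulo three). -/

/-- The directional derivative `D_u g` on the macrotriangle. -/
noncomputable def dirDeriv (v : Fin 3 → Plane) (u : Plane) (g : Plane → ℝ) : Plane → ℝ :=
  fun x => fderivWithin ℝ g (macroTriangle v) x u

/-- Labels of the 39 functionals. -/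
inductive NodalIndex
  | vertex (k : Fin 3) (i j : ℕ) (h : i + j ≤ 3)
  | quarter₁ (k : Fin 3)
  | mid (k : Fin 3)
  | quarter₂ (k : Fin 3)

/-- The direction `u_e` from the midpoint of edge number `k` to the opposing corner. -/
noncomputable def crossDir (v : Fin 3 → Plane) (k : Fin 3) : Plane :=
  v (k + 2) - (1 / 2 : ℝ) • (v k + v (k + 1))

/-- The functionals: at each corner all derivatives up to order three in the directions of the
two adjacent edges; on each edge the first cross-boundary derivative at the midpoint and the second
ones at the quarterpoints. -/
noncomputable def nodalFunctional (v : Fin 3 → Plane) : NodalIndex → (Plane → ℝ) → ℝ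
  | .vertex k i j _, g =>
    ((dirDeriv v (v (k + 1) - v k))^[i] ((dirDeriv v (v (k + 2) - v k))^[j] g)) (v k)
  | .quarter₁ k, g =>
    ((dirDeriv v (crossDir v k))^[2] g) ((1 / 4 : ℝ) • ((3 : ℝ) • v k + v (k + 1)))
  | .mid k, g =>
    dirDeriv v (crossDir v k) g ((1 / 2 : ℝ) • (v k + v (k + 1)))
  | .quarter₂ k, g =>
    ((dirDeriv v (crossDir v k))^[2] g) ((1 / 4 : ℝ) • (v k + (3 : ℝ) • v (k + 1)))

/-- The label of the value at `v (σ 0)` of the derivative of order `i` in direction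
`v (σ 1) - v (σ 0)` and order `j` in direction `v (σ 2) - v (σ 0)`. -/
def vertexIndex (σ : Equiv.Perm (Fin 3)) (i j : ℕ) (h : i + j ≤ 3 := by decide) : NodalIndex :=
  if σ 1 = σ 0 + 1 then .vertex (σ 0) i j h else .vertex (σ 0) j i (by omega)

/-- The label of the second cross-boundary derivative on the edge `[v (σ 0), v (σ 1)]` at the
quarterpoint `(3 v (σ 0) + v (σ 1)) / 4`. -/
def quarterIndex (σ : Equiv.Perm (Fin 3)) : NodalIndex :=
  if σ 1 = σ 0 + 1 then .quarter₁ (σ 0) else .quarter₂ (σ 1)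

/-- The label of the first cross-boundary derivative at the midpoint of the edge
`[v (σ 0), v (σ 1)]`. -/
def midIndex (σ : Equiv.Perm (Fin 3)) : NodalIndex :=
  if σ 1 = σ 0 + 1 then .mid (σ 0) else .mid (σ 1)

end PowellSabin

open PowellSabin

/-! The dimension of the spline space is bounded above by 39. The functions given by the formulas
lie in the space and are dual to the 39 functionals, so they are independent and form the dual
basis.

Upper bound. If two faces share an edge on the line `ℓ = 0`, the polynomials of a `C³` spline of
degree five on them agree to third order along the edge, so they differ by `q ℓ⁴` with `q` affine
(`exists_eval_sub_eq`). Where lines of the split cross in the interior, going from one face to the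
opposite face by either way gives the same difference. The products involved are independent
(`eq_of_two_lines`, `eq_of_three_lines`), so the cofactor `q` is the same on both sides of the
crossing. Hence each of the six interior lines carries a single cofactor, and a spline is a
polynomial plus six terms `q ℓ₊⁴` (`exists_eq_add_trunc`). This gives at most 21 + 6 · 3 = 39
dimensions.

Membership. On a face the recursion for simplex splines is a recursion between polynomials. Each of
the eight combinations of simplex splines equals an explicit sum of terms `q ℓ₊⁴`, where `ℓ` is the
constant 1 or one of the six lines with either orientation (`nodalSpline_of_mem`). Such a sum is
`C³` on the whole plane and has degree five on each face. The equality amounts to twelve polynomial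
identities for each formula. In integer barycentric coordinates they are verified by Kronecker
substitution: all coefficients on all faces are read as the digits of one integer (`formula_code`),
and a priori bounds on the coefficients make the decoding faithful (`faceDefect_eq_zero`).

Duality. Derivatives of `q ℓ₊⁴` up to order three stay in the span of `q ℓ₊ᵐ` and `ℓ₊ᵐ⁺¹`. By
homogeneity their values at corners, midpoints and quarterpoints reduce to integer arithmetic
(`derivValue_vertex`, `derivValue_quarter`, `derivValue_mid`). The split is symmetric in the
corners, so one computation in the standard frame serves all six relabellings, and each functional
occurs in some frame (`exists_eq_nodalIndex`). A spline is determined by its 39 nodal values, so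
different frames leading to the same functional yield the same function. -/

namespace PowellSabin

/-! ### Barycentric coordinates -/

/-- Barycentric coordinates with respect to the triangle `[v 0, v 1, v 2]`. -/
noncomputable def bary (v : Fin 3 → Plane) (x : Plane) : Fin 3 → ℝ :=
  ![orient x (v 1) (v 2) / orient (v 0) (v 1) (v 2), orient (v 0) x (v 2) / orient (v 0) (v 1) (v 2),
    orient (v 0) (v 1) x / orient (v 0) (v 1) (v 2)]

/-- The triangle with the given corners is nondegenerate. -/
def Nondeg (v : Fin 3 → Plane) : Prop := orient (v 0) (v 1) (v 2) ≠ 0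

theorem nondeg_of_affineIndependent {v : Fin 3 → Plane} (hv : AffineIndependent ℝ v) : Nondeg v := by
  intro h
  rw [affineIndependent_iff] at hv
  have key : ∀ a b c : ℝ, a + b + c = 0 → (∀ i : Fin 2, a * v 0 i + b * v 1 i + c * v 2 i = 0) →
      b = 0 ∧ c = 0 := by
    intro a b c h1 h2
    have := hv Finset.univ ![a, b, c] (by simpa [Fin.sum_univ_three] using h1) (by
      ext i
      simpa [Fin.sum_univ_three] using h2 i)
    exact ⟨by simpa using this 1 (Finset.mem_univ _), by simpa using this 2 (Finset.mem_univ _)⟩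
  simp only [orient] at h
  -- When the determinant vanishes, its first row supplies the coefficients of an affine dependence
  -- between the corners, so the first components of both edge vectors vanish. The second row treats
  -- the second components in the same way, and then `v 1 = v 0`.
  obtain ⟨e1, e2⟩ := key (-((v 2 0 - v 0 0) - (v 1 0 - v 0 0))) (v 2 0 - v 0 0) (-(v 1 0 - v 0 0))
    (by ring) (by
      intro i
      fin_cases i <;> simp only [Fin.zero_eta, Fin.mk_one] <;> linarith)
  obtain ⟨e3, e4⟩ := key (-((v 2 1 - v 0 1) - (v 1 1 - v 0 1))) (v 2 1 - v 0 1) (-(v 1 1 - v 0 1))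
    (by ring) (by
      intro i
      fin_cases i <;> simp only [Fin.zero_eta, Fin.mk_one] <;> linarith)
  have := (key (-1) 1 0 (by ring) (by
      intro i
      fin_cases i <;> simp only [Fin.zero_eta, Fin.mk_one] <;> linarith)).1
  exact one_ne_zero this

theorem sum_bary {v : Fin 3 → Plane} (hv : Nondeg v) (x : Plane) : ∑ i, bary v x i = 1 := by
  have h : orient (v 0) (v 1) (v 2) ≠ 0 := hv
  simp only [Fin.sum_univ_three, bary, Matrix.cons_val]
  field_simp
  simp only [orient]
  ring

theorem sum_bary_smul {v : Fin 3 → Plane} (hv : Nondeg v) (x : Plane) :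
    ∑ i, bary v x i • v i = x := by
  have h : orient (v 0) (v 1) (v 2) ≠ 0 := hv
  ext i
  simp only [Fin.sum_univ_three, bary, Matrix.cons_val, PiLp.add_apply, PiLp.smul_apply,
    smul_eq_mul]
  field_simp
  fin_cases i <;> simp only [orient, Fin.mk_one, Fin.zero_eta] <;> ring

theorem bary_sum_smul {v : Fin 3 → Plane} (hv : Nondeg v) (w : Fin 3 → ℝ) (hw : ∑ i, w i = 1) :
    bary v (∑ i, w i • v i) = w := by
  have h : orient (v 0) (v 1) (v 2) ≠ 0 := hv
  rw [Fin.sum_univ_three] at hw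
  have h0 : w 0 = 1 - w 1 - w 2 := by linarith
  ext i
  fin_cases i <;>
  · simp only [Fin.sum_univ_three, bary, Matrix.cons_val, Fin.mk_one, Fin.zero_eta, Fin.reduceFinMk]
    field_simp
    simp only [orient, PiLp.add_apply, PiLp.smul_apply, smul_eq_mul, h0]
    ring

/-- The determinant of three coordinate vectors. -/
def det3 {R : Type*} [CommRing R] (a b c : Fin 3 → R) : R :=
  a 0 * (b 1 * c 2 - b 2 * c 1) - a 1 * (b 0 * c 2 - b 2 * c 0) + a 2 * (b 0 * c 1 - b 1 * c 0)

theorem orient_sum_smul (v : Fin 3 → Plane) (a b c : Fin 3 → ℝ) (ha : ∑ i, a i = 1)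
    (hb : ∑ i, b i = 1) (hc : ∑ i, c i = 1) :
    orient (∑ i, a i • v i) (∑ i, b i • v i) (∑ i, c i • v i) =
      det3 a b c * orient (v 0) (v 1) (v 2) := by
  rw [Fin.sum_univ_three] at ha hb hc
  have h1 : a 0 = 1 - a 1 - a 2 := by linarith
  have h2 : b 0 = 1 - b 1 - b 2 := by linarith
  have h3 : c 0 = 1 - c 1 - c 2 := by linarith
  simp only [orient, det3, Fin.sum_univ_three, PiLp.add_apply, PiLp.smul_apply, smul_eq_mul,
    h1, h2, h3]
  ring

theorem mem_convexHull_range {p : Fin 3 → Plane} {x : Plane} :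
    x ∈ convexHull ℝ (Set.range p) ↔
      ∃ w : Fin 3 → ℝ, (∀ i, 0 ≤ w i) ∧ ∑ i, w i = 1 ∧ ∑ i, w i • p i = x := by
  constructor
  · intro hx
    rw [convexHull_range_eq_exists_affineCombination] at hx
    obtain ⟨s, w, h0, h1, rfl⟩ := hx
    refine ⟨fun i => if i ∈ s then w i else 0, fun i => ?_, ?_, ?_⟩
    · dsimp only
      split_ifs with h
      exacts [h0 i h, le_rfl]
    · simpa using h1
    · rw [Finset.affineCombination_eq_linear_combination _ _ _ h1]
      simp
  · rintro ⟨w, h0, h1, rfl⟩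
    exact (convex_convexHull ℝ _).sum_mem (fun k _ => h0 k) h1
      fun k _ => subset_convexHull ℝ _ ⟨k, rfl⟩

theorem mem_macroTriangle {v : Fin 3 → Plane} (hv : Nondeg v) {x : Plane} :
    x ∈ macroTriangle v ↔ ∀ i, 0 ≤ bary v x i := by
  rw [macroTriangle, mem_convexHull_range]
  constructor
  · rintro ⟨w, h0, h1, rfl⟩
    rwa [bary_sum_smul hv w h1]
  · exact fun h => ⟨_, h, sum_bary hv x, sum_bary_smul hv x⟩

/-- The vertices of a face of the 12-split. -/
noncomputable def facePoint (v : Fin 3 → Plane) (f : Fin 12) (k : Fin 3) : Plane :=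
  splitPoint v (faceVertex f k)

theorem sum_splitCoord (j : Fin 10) : ∑ i, (splitCoord j i : ℝ) = 1 := by
  have : ∀ j : Fin 10, ∑ i, splitCoord j i = 1 := by
    intro j
    fin_cases j <;> simp [splitCoord, Fin.sum_univ_three] <;> norm_num
  exact_mod_cast congrArg (Rat.cast : ℚ → ℝ) (this j)

theorem bary_splitPoint {v : Fin 3 → Plane} (hv : Nondeg v) (j : Fin 10) :
    bary v (splitPoint v j) = fun i => (splitCoord j i : ℝ) :=
  bary_sum_smul hv _ (sum_splitCoord j)

theorem orient_splitPoint (v : Fin 3 → Plane) (a b c : Fin 10) :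
    orient (splitPoint v a) (splitPoint v b) (splitPoint v c) =
      det3 (fun i => (splitCoord a i : ℝ)) (fun i => (splitCoord b i : ℝ))
        (fun i => (splitCoord c i : ℝ)) * orient (v 0) (v 1) (v 2) :=
  orient_sum_smul v _ _ _ (sum_splitCoord a) (sum_splitCoord b) (sum_splitCoord c)

theorem nondeg_facePoint {v : Fin 3 → Plane} (hv : Nondeg v) (f : Fin 12) :
    Nondeg (facePoint v f) := by
  have h : ∀ f : Fin 12, det3 (splitCoord (faceVertex f 0)) (splitCoord (faceVertex f 1))
      (splitCoord (faceVertex f 2)) ≠ 0 := by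
    intro f
    fin_cases f <;> simp [det3, splitCoord, faceVertex] <;> norm_num
  have e := orient_splitPoint v (faceVertex f 0) (faceVertex f 1) (faceVertex f 2)
  rw [Nondeg]
  change orient (splitPoint v (faceVertex f 0)) (splitPoint v (faceVertex f 1))
    (splitPoint v (faceVertex f 2)) ≠ 0
  rw [e]
  refine mul_ne_zero (fun h0 => h f ?_) hv
  have : ((det3 (splitCoord (faceVertex f 0)) (splitCoord (faceVertex f 1))
      (splitCoord (faceVertex f 2)) : ℚ) : ℝ) = 0 := by
    rw [← h0]
    simp [det3]
  exact_mod_cast this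

theorem splitPoint_mem_macroTriangle {v : Fin 3 → Plane} (hv : Nondeg v) (j : Fin 10) :
    splitPoint v j ∈ macroTriangle v := by
  rw [mem_macroTriangle hv, bary_splitPoint hv]
  have : ∀ j i, 0 ≤ splitCoord j i := by
    intro j i
    fin_cases j <;> fin_cases i <;> simp [splitCoord]
  intro i
  change (0 : ℝ) ≤ (splitCoord j i : ℝ)
  exact_mod_cast this j i

theorem face_subset {v : Fin 3 → Plane} (hv : Nondeg v) (f : Fin 12) :
    face v f ⊆ macroTriangle v := by
  refine convexHull_min ?_ (convex_convexHull ℝ _)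
  rintro _ ⟨k, rfl⟩
  exact splitPoint_mem_macroTriangle hv _

theorem mem_face_iff {v : Fin 3 → Plane} (hv : Nondeg v) {f : Fin 12} {x : Plane} :
    x ∈ face v f ↔ ∃ t : Fin 3 → ℝ, (∀ k, 0 ≤ t k) ∧ ∑ k, t k = 1 ∧
      ∀ i, bary v x i = ∑ k, t k * (splitCoord (faceVertex f k) i : ℝ) := by
  constructor
  · intro hx
    obtain ⟨t, h0, h1, rfl⟩ := mem_convexHull_range.1 hx
    refine ⟨t, h0, h1, fun i => ?_⟩
    have e : ∑ k, t k • splitPoint v (faceVertex f k) =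
        ∑ i, (∑ k, t k * (splitCoord (faceVertex f k) i : ℝ)) • v i := by
      simp only [splitPoint, Finset.smul_sum, smul_smul, Finset.sum_smul]
      rw [Finset.sum_comm]
    rw [e, bary_sum_smul hv]
    rw [Finset.sum_comm]
    simp only [← Finset.mul_sum, sum_splitCoord, mul_one, h1]
  · rintro ⟨t, h0, h1, h⟩
    rw [← sum_bary_smul hv x]
    exact mem_face_of_coord v f _ t h0 h1 fun i => (h i).symm

/-! ### Topology and area of triangles -/

theorem continuous_orient {f g h : Plane → Plane} (hf : Continuous f) (hg : Continuous g)
    (hh : Continuous h) : Continuous fun x => orient (f x) (g x) (h x) := by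
  unfold orient
  fun_prop

theorem continuous_bary (v : Fin 3 → Plane) (i : Fin 3) : Continuous fun x => bary v x i := by
  fin_cases i <;> simp only [bary, Matrix.cons_val, Fin.mk_one, Fin.zero_eta, Fin.reduceFinMk] <;>
    exact (continuous_orient (by fun_prop) (by fun_prop) (by fun_prop)).div_const _

theorem interior_macroTriangle_nonempty {v : Fin 3 → Plane} (hv : Nondeg v) :
    (interior (macroTriangle v)).Nonempty := by
  refine ⟨∑ i, (fun _ => 1 / 3 : Fin 3 → ℝ) i • v i, ?_⟩
  rw [mem_interior]
  refine ⟨{x | ∀ i, 0 < bary v x i}, fun x hx => (mem_macroTriangle hv).2 fun i => (hx i).le, ?_, ?_⟩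
  · simp only [Set.ofPred_forall]
    exact isOpen_iInter_of_finite fun i => isOpen_lt continuous_const (continuous_bary v i)
  · rw [Set.mem_ofPred_eq, bary_sum_smul hv _ (by simp)]
    intro i
    norm_num

theorem uniqueDiffOn_macroTriangle {v : Fin 3 → Plane} (hv : Nondeg v) :
    UniqueDiffOn ℝ (macroTriangle v) :=
  uniqueDiffOn_convex (convex_convexHull ℝ _) (interior_macroTriangle_nonempty hv)

theorem uniqueDiffOn_face {v : Fin 3 → Plane} (hv : Nondeg v) (f : Fin 12) :
    UniqueDiffOn ℝ (face v f) :=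
  uniqueDiffOn_macroTriangle (nondeg_facePoint hv f)

theorem area_macroTriangle_pos {v : Fin 3 → Plane} (hv : Nondeg v) : 0 < area (macroTriangle v) :=
  ENNReal.toReal_pos
    (MeasureTheory.Measure.measure_pos_of_nonempty_interior _ (interior_macroTriangle_nonempty hv)).ne'
    ((Set.finite_range v).isCompact_convexHull (𝕜 := ℝ)).measure_lt_top.ne

/-- The corners of the standard triangle. -/
noncomputable def stdCorner : Fin 3 → Plane := ![0, EuclideanSpace.single 0 1, EuclideanSpace.single 1 1]

/-- The triangle is the image of the standard one under an affine map whose linear part has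
determinant `orient`. The area of the standard triangle is left unevaluated, since only quotients of
areas are needed. -/
theorem area_macroTriangle (v : Fin 3 → Plane) :
    area (macroTriangle v) = |orient (v 0) (v 1) (v 2)| * area (macroTriangle stdCorner) := by
  let b := (EuclideanSpace.basisFun (Fin 2) ℝ).toBasis
  let L : Plane →ₗ[ℝ] Plane := Matrix.toLin b b
    !![v 1 0 - v 0 0, v 2 0 - v 0 0; v 1 1 - v 0 1, v 2 1 - v 0 1]
  have hL : ∀ x, L x = x 0 • (v 1 - v 0) + x 1 • (v 2 - v 0) := by
    intro x
    simp only [L, Matrix.toLin_apply, b]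
    ext i
    fin_cases i <;> simp [Matrix.mulVec, dotProduct, Fin.sum_univ_two] <;> ring
  have hdet : LinearMap.det L = orient (v 0) (v 1) (v 2) := by
    simp only [L, LinearMap.det_toLin, Matrix.det_fin_two_of, orient]
  have himg : macroTriangle v = (fun x => v 0 + x) '' (L '' macroTriangle stdCorner) := by
    have e : v = (AffineEquiv.constVAdd ℝ Plane (v 0)).toAffineMap.comp L.toAffineMap ∘ stdCorner := by
      funext i
      fin_cases i <;> simp [stdCorner, hL]
    conv_lhs => rw [e]
    rw [macroTriangle, Set.range_comp, ← AffineMap.image_convexHull, ← Set.image_comp]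
    rfl
  rw [area, himg, Set.image_add_left, MeasureTheory.measure_preimage_add,
    MeasureTheory.Measure.addHaar_image_linearMap, hdet, ENNReal.toReal_mul,
    ENNReal.toReal_ofReal (abs_nonneg _), area]

theorem area_div_area {v p : Fin 3 → Plane} (hp : Nondeg p) :
    area (macroTriangle v) / area (macroTriangle p) =
      |orient (v 0) (v 1) (v 2)| / |orient (p 0) (p 1) (p 2)| := by
  have h := area_macroTriangle_pos hp
  rw [area_macroTriangle p] at h ⊢
  rw [area_macroTriangle v]
  have h0 := abs_ne_zero.2 hp
  have h1 : area (macroTriangle stdCorner) ≠ 0 := fun h' => by simp [h'] at h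
  field_simp

/-! ### An integral form of the recursion for simplex splines

Knot multisets on `v₁, …, v₆` are represented by sorted lists of indices. -/

/-- Twice the barycentric coordinates of `v₁, …, v₆`. -/
def dblCoord : ℕ → ℤ × ℤ × ℤ
  | 0 => (2, 0, 0)
  | 1 => (0, 2, 0)
  | 2 => (0, 0, 2)
  | 3 => (1, 1, 0)
  | 4 => (0, 1, 1)
  | 5 => (1, 0, 1)
  | _ => (0, 0, 0)

/-- Twelve times the barycentric coordinates of the vertices of the 12-split. -/
def dozenCoord : ℕ → ℤ × ℤ × ℤ
  | 0 => (12, 0, 0)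
  | 1 => (0, 12, 0)
  | 2 => (0, 0, 12)
  | 3 => (6, 6, 0)
  | 4 => (0, 6, 6)
  | 5 => (6, 0, 6)
  | 6 => (6, 3, 3)
  | 7 => (3, 6, 3)
  | 8 => (3, 3, 6)
  | _ => (4, 4, 4)

/-- The value of a linear form with integer coefficients. -/
def linVal {R : Type} [Add R] [Mul R] (ι : ℤ → R) (c : ℤ × ℤ × ℤ) (w : R × R × R) : R :=
  ι c.1 * w.1 + ι c.2.1 * w.2.1 + ι c.2.2 * w.2.2

/-- The linear form `w ↦ det (w, 2 v_b, 2 v_c)`. -/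
def crossForm (b c : ℕ) : ℤ × ℤ × ℤ :=
  match dblCoord b, dblCoord c with
  | (b0, b1, b2), (c0, c1, c2) => (b1 * c2 - b2 * c1, b2 * c0 - b0 * c2, b0 * c1 - b1 * c0)

/-- The determinant of the doubled coordinates of three knots. -/
def dblDet (a b c : ℕ) : ℤ := linVal id (crossForm b c) (dblCoord a)

/-- The reciprocal of the determinant of the coordinates of three knots. -/
def invDet (a b c : ℕ) : ℤ := 8 / dblDet a b c

/-- The first triple of affinely independent knots in a sorted list. -/
def firstTriple : List ℕ → Option (ℕ × ℕ × ℕ)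
  | [] => none
  | a :: l =>
    match l.find? fun b => a != b with
    | none => none
    | some b =>
      match l.find? fun c => !(dblDet a b c == 0) with
      | none => none
      | some c => some (a, b, c)

/-- The recursion for simplex splines, scaled by a factor four for every degree. -/
def scaledSpline {R : Type} [Add R] [Mul R] [Zero R] (ι : ℤ → R) (leaf : ℕ → ℕ → ℕ → R)
    (w : R × R × R) : ℕ → List ℕ → R
  | 0, l =>
    match firstTriple l with
    | none => 0
    | some (a, b, c) => leaf a b c
  | n + 1, l =>
    match firstTriple l with
    | none => 0
    | some (a, b, c) =>
      ι (invDet a b c) * (linVal ι (crossForm b c) w * scaledSpline ι leaf w n (l.erase a) +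
        linVal ι (crossForm c a) w * scaledSpline ι leaf w n (l.erase b) +
        linVal ι (crossForm a b) w * scaledSpline ι leaf w n (l.erase c))

/-- The faces contained in the triangle of three knots. -/
def trianglePieces (a b c : ℕ) : List ℕ :=
  match 36 * a + 6 * b + c with
  | 8 => [0, 1, 2, 3, 4, 5, 6, 7, 8, 9, 10, 11]
  | 10 => [0, 2, 3, 6, 7, 8]
  | 11 => [0, 1, 2, 6, 7, 11]
  | 15 => [0, 1, 5, 6, 10, 11]
  | 16 => [1, 4, 5, 9, 10, 11]
  | 22 => [0, 6, 7, 8]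
  | 23 => [0, 1]
  | 29 => [1, 9, 10, 11]
  | 51 => [2, 3, 4, 7, 8, 9]
  | 53 => [3, 4, 5, 8, 9, 10]
  | 58 => [2, 3]
  | 59 => [2, 6, 7, 11]
  | 65 => [3, 8, 9, 10]
  | 94 => [4, 7, 8, 9]
  | 95 => [5, 6, 10, 11]
  | 101 => [4, 5]
  | 137 => [6, 7, 8, 9, 10, 11]
  | _ => []

/-- The multiplicities of a list of knots. -/
def knotCount (l : List ℕ) (j : Fin 10) : ℕ := l.count j.val

theorem cast_splitCoord {j : ℕ} (hj : j < 6) :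
    (splitCoord (Fin.ofNat 10 j) 0 : ℝ) = (dblCoord j).1 / 2 ∧
    (splitCoord (Fin.ofNat 10 j) 1 : ℝ) = (dblCoord j).2.1 / 2 ∧
    (splitCoord (Fin.ofNat 10 j) 2 : ℝ) = (dblCoord j).2.2 / 2 := by
  interval_cases j <;> simp [splitCoord, dblCoord, Fin.ofNat]

theorem cast_splitCoord' (j : Fin 10) :
    (splitCoord j 0 : ℝ) = (dozenCoord j).1 / 12 ∧
    (splitCoord j 1 : ℝ) = (dozenCoord j).2.1 / 12 ∧
    (splitCoord j 2 : ℝ) = (dozenCoord j).2.2 / 12 := by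
  fin_cases j <;> simp [splitCoord, dozenCoord] <;> norm_num

theorem linVal_crossForm {b c : ℕ} (hb : b < 6) (hc : c < 6) (w : Fin 3 → ℝ) :
    det3 w (fun i => (splitCoord (Fin.ofNat 10 b) i : ℝ))
      (fun i => (splitCoord (Fin.ofNat 10 c) i : ℝ)) =
      linVal Int.cast (crossForm b c) (w 0, w 1, w 2) / 4 := by
  obtain ⟨b0, b1, b2⟩ := cast_splitCoord hb
  obtain ⟨c0, c1, c2⟩ := cast_splitCoord hc
  simp only [det3, b0, b1, b2, c0, c1, c2, linVal, crossForm]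
  push_cast
  ring

theorem det3_splitCoord {a b c : ℕ} (ha : a < 6) (hb : b < 6) (hc : c < 6) :
    det3 (fun i => (splitCoord (Fin.ofNat 10 a) i : ℝ))
      (fun i => (splitCoord (Fin.ofNat 10 b) i : ℝ))
      (fun i => (splitCoord (Fin.ofNat 10 c) i : ℝ)) = dblDet a b c / 8 := by
  rw [linVal_crossForm hb hc]
  obtain ⟨a0, a1, a2⟩ := cast_splitCoord ha
  simp only [a0, a1, a2, linVal, dblDet, id]
  push_cast
  ring

/-- The nonzero determinants of `v₁, …, v₆` in doubled coordinates all divide 8, so the integer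
division in `invDet` is exact. -/
theorem invDet_mul {a b c : ℕ} (ha : a < 6) (hb : b < 6) (hc : c < 6) (h : dblDet a b c ≠ 0) :
    invDet a b c * dblDet a b c = 8 := by
  have : ∀ a < 6, ∀ b < 6, ∀ c < 6, dblDet a b c ≠ 0 → invDet a b c * dblDet a b c = 8 := by
    decide +kernel
  exact this a ha b hb c hc h

/-- This justifies the greedy search in `firstTriple`: once no knot lies off the line through the
first two distinct knots, no other choice of knots can be independent. -/
theorem dblDet_eq_zero_of_collinear {a b x y z : ℕ} (ha : a < 6) (hb : b < 6) (hab : a ≠ b)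
    (hx : x < 6) (hy : y < 6) (hz : z < 6) (h1 : dblDet a b x = 0) (h2 : dblDet a b y = 0)
    (h3 : dblDet a b z = 0) : dblDet x y z = 0 := by
  have : ∀ a b x y z : Fin 6, a.val = b.val ∨ dblDet a b x ≠ 0 ∨
      dblDet a b y ≠ 0 ∨ dblDet a b z ≠ 0 ∨ dblDet x y z = 0 := by
    decide +kernel
  rcases this ⟨a, ha⟩ ⟨b, hb⟩ ⟨x, hx⟩ ⟨y, hy⟩ ⟨z, hz⟩ with h | h | h | h | h
  exacts [absurd h hab, absurd h1 h, absurd h2 h, absurd h3 h, h]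

theorem dblDet_self_left (a c : ℕ) : dblDet a a c = 0 := by
  simp only [dblDet, linVal, crossForm, id]
  ring

theorem dblDet_self_right (a b : ℕ) : dblDet a b b = 0 := by
  simp only [dblDet, linVal, crossForm, id]
  ring

theorem dblDet_self_outer (a b : ℕ) : dblDet a b a = 0 := by
  simp only [dblDet, linVal, crossForm, id]
  ring

/-! ### The lexicographically first independent triple -/

theorem find?_le {l : List ℕ} (hl : l.Pairwise (· ≤ ·)) {p : ℕ → Bool} {b : ℕ}
    (h : l.find? p = some b) : ∀ x ∈ l, p x → b ≤ x := by
  induction l with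
  | nil => simp
  | cons a l ih =>
    rw [List.pairwise_cons] at hl
    rw [List.find?_cons] at h
    intro x hx hpx
    cases hpa : p a with
    | true =>
      simp only [hpa, Option.some.injEq] at h
      subst h
      rcases List.mem_cons.1 hx with rfl | hx
      exacts [le_rfl, hl.1 x hx]
    | false =>
      simp only [hpa] at h
      rcases List.mem_cons.1 hx with rfl | hx
      · simp [hpa] at hpx
      · exact ih hl.2 h x hx hpx

/-- In a sorted list the first hit of each search is the smallest one. The three minimality
statements are what identifies the greedy triple with the lexicographically first one. -/
theorem firstTriple_eq_some {l : List ℕ} (hl : l.Pairwise (· ≤ ·)) {a b c : ℕ}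
    (h : firstTriple l = some (a, b, c)) :
    (a ∈ l ∧ b ∈ l ∧ c ∈ l) ∧ dblDet a b c ≠ 0 ∧ (∀ x ∈ l, a ≤ x) ∧ (∀ x ∈ l, x ≠ a → b ≤ x) ∧
      ∀ x ∈ l, dblDet a b x ≠ 0 → c ≤ x := by
  cases l with
  | nil => simp [firstTriple] at h
  | cons a' l =>
    simp only [firstTriple] at h
    split at h
    · simp at h
    rename_i b' hb'
    split at h
    · simp at h
    rename_i c' hc'
    simp only [Option.some.injEq, Prod.mk.injEq] at h
    obtain ⟨rfl, rfl, rfl⟩ := h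
    have hs := List.pairwise_cons.1 hl
    refine ⟨⟨by simp, List.mem_cons_of_mem _ (List.mem_of_find?_eq_some hb'),
      List.mem_cons_of_mem _ (List.mem_of_find?_eq_some hc')⟩, ?_, ?_, ?_, ?_⟩
    · simpa using List.find?_some hc'
    · intro x hx
      rcases List.mem_cons.1 hx with rfl | hx
      exacts [le_rfl, hs.1 x hx]
    · intro x hx hne
      rcases List.mem_cons.1 hx with rfl | hx
      · exact absurd rfl hne
      · exact find?_le hs.2 hb' x hx (by simpa using hne.symm)
    · intro x hx hne
      rcases List.mem_cons.1 hx with rfl | hx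
      · exact absurd (dblDet_self_outer _ _) hne
      · exact find?_le hs.2 hc' x hx (by simpa using hne)

/-- The search fails either because all knots coincide, or because all knots are on the line through
the first two distinct ones. -/
theorem firstTriple_eq_none {l : List ℕ} (h6 : ∀ x ∈ l, x < 6) (h : firstTriple l = none) :
    ∀ x ∈ l, ∀ y ∈ l, ∀ z ∈ l, dblDet x y z = 0 := by
  cases l with
  | nil => simp
  | cons a l =>
    simp only [firstTriple] at h
    split at h
    · rename_i hb
      rw [List.find?_eq_none] at hb
      have : ∀ x ∈ a :: l, x = a := by
        intro x hx
        rcases List.mem_cons.1 hx with rfl | hx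
        · rfl
        · have := hb x hx
          simp only [bne_iff_ne, ne_eq, Decidable.not_not] at this
          exact this.symm
      intro x hx y hy z hz
      rw [this x hx, this y hy]
      exact dblDet_self_left _ _
    rename_i b hb
    split at h
    · rename_i hc
      rw [List.find?_eq_none] at hc
      have hbl := List.mem_of_find?_eq_some hb
      have hab : a ≠ b := by simpa using List.find?_some hb
      have h0 : ∀ x ∈ a :: l, dblDet a b x = 0 := by
        intro x hx
        rcases List.mem_cons.1 hx with rfl | hx
        · exact dblDet_self_outer _ _
        · simpa using hc x hx
      intro x hx y hy z hz
      exact dblDet_eq_zero_of_collinear (h6 a (by simp)) (h6 b (by simp [hbl])) hab (h6 x hx)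
        (h6 y hy) (h6 z hz) (h0 x hx) (h0 y hy) (h0 z hz)
    · simp at h

theorem orient_splitPoint_ofNat {v : Fin 3 → Plane} {a b c : ℕ} (ha : a < 6) (hb : b < 6)
    (hc : c < 6) :
    orient (splitPoint v (Fin.ofNat 10 a)) (splitPoint v (Fin.ofNat 10 b))
      (splitPoint v (Fin.ofNat 10 c)) = dblDet a b c / 8 * orient (v 0) (v 1) (v 2) := by
  rw [orient_splitPoint, det3_splitCoord ha hb hc]

/-- Read as three-digit decimal numbers, the triples run through `0, …, 999` in order. This turns
the lexicographic order into an inequality of naturals. -/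
theorem triples_pairwise :
    triples.Pairwise fun s t => 100 * s.1.val + 10 * s.2.1.val + s.2.2.val <
      100 * t.1.val + 10 * t.2.1.val + t.2.2.val := by
  have h : triples.map (fun s => 100 * s.1.val + 10 * s.2.1.val + s.2.2.val) = List.range 1000 := by
    decide +kernel
  have h' : (triples.map fun s => 100 * s.1.val + 10 * s.2.1.val + s.2.2.val).Pairwise (· < ·) := by
    rw [h]
    exact List.pairwise_lt_range
  exact List.pairwise_map.1 h'

theorem find?_not_lt {α : Type*} {r : α → α → Prop} (hr : ∀ x, ¬ r x x)
    (hr' : ∀ x y z, r x y → r y z → r x z) {l : List α} (hl : l.Pairwise r) {p : α → Bool} {b : α}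
    (h : l.find? p = some b) : ∀ x ∈ l, p x → ¬ r x b := by
  induction l with
  | nil => simp
  | cons a l ih =>
    rw [List.pairwise_cons] at hl
    rw [List.find?_cons] at h
    intro x hx hpx hxb
    cases hpa : p a with
    | true =>
      simp only [hpa, Option.some.injEq] at h
      subst h
      rcases List.mem_cons.1 hx with rfl | hx
      exacts [hr _ hxb, hr _ (hr' _ _ _ hxb (hl.1 x hx))]
    | false =>
      simp only [hpa] at h
      rcases List.mem_cons.1 hx with rfl | hx
      · simp [hpa] at hpx
      · exact ih hl.2 h x hx hpx hxb

/-- The triple found in `triples` is lexicographically at most the greedy one, because the greedy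
triple is itself a candidate. Minimality of the greedy choice gives the opposite inequality,
position by position. -/
theorem knotTriple_eq {v : Fin 3 → Plane} (hv : Nondeg v) {l : List ℕ} (hl : l.Pairwise (· ≤ ·))
    (h6 : ∀ x ∈ l, x < 6) :
    knotTriple v (knotCount l) =
      (firstTriple l).map fun t => (Fin.ofNat 10 t.1, Fin.ofNat 10 t.2.1, Fin.ofNat 10 t.2.2) := by
  classical
  have hmem : ∀ j : Fin 10, knotCount l j ≠ 0 ↔ j.val ∈ l := by
    intro j
    simp [knotCount, List.count_eq_zero]
  have hof : ∀ j : Fin 10, Fin.ofNat 10 j.val = j := fun j => by simp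
  have hor : ∀ a b c : Fin 10, a.val ∈ l → b.val ∈ l → c.val ∈ l →
      (orient (splitPoint v a) (splitPoint v b) (splitPoint v c) ≠ 0 ↔
        dblDet a.val b.val c.val ≠ 0) := by
    intro a b c ha hb hc
    have := orient_splitPoint_ofNat (v := v) (h6 _ ha) (h6 _ hb) (h6 _ hc)
    rw [hof, hof, hof] at this
    rw [this]
    have hv' : orient (v 0) (v 1) (v 2) ≠ 0 := hv
    simp [hv']
  have hval : ∀ a ∈ l, (Fin.ofNat 10 a).val = a := by
    intro a ha
    have := h6 a ha
    simp only [Fin.ofNat]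
    omega
  cases h : firstTriple l with
  | none =>
    rw [Option.map_none, knotTriple, List.find?_eq_none]
    rintro ⟨a, b, c⟩ _ h'
    simp only [decide_eq_true_eq, hmem] at h'
    obtain ⟨⟨ha, hb, hc⟩, h'⟩ := h'
    exact (hor a b c ha hb hc).1 h' (firstTriple_eq_none h6 h _ ha _ hb _ hc)
  | some t =>
    obtain ⟨a, b, c⟩ := t
    obtain ⟨⟨ha, hb, hc⟩, hd, hma, hmb, hmc⟩ := firstTriple_eq_some hl h
    rw [Option.map_some]
    dsimp only
    have hp : decide ((knotCount l (Fin.ofNat 10 a) ≠ 0 ∧ knotCount l (Fin.ofNat 10 b) ≠ 0 ∧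
        knotCount l (Fin.ofNat 10 c) ≠ 0) ∧ orient (splitPoint v (Fin.ofNat 10 a))
          (splitPoint v (Fin.ofNat 10 b)) (splitPoint v (Fin.ofNat 10 c)) ≠ 0) = true := by
      have ha' := hval a ha
      have hb' := hval b hb
      have hc' := hval c hc
      rw [decide_eq_true_eq, hmem, hmem, hmem, hor, ha', hb', hc']
      exacts [⟨⟨ha, hb, hc⟩, hd⟩, ha'.symm ▸ ha, hb'.symm ▸ hb, hc'.symm ▸ hc]
    have hin : ((Fin.ofNat 10 a, Fin.ofNat 10 b, Fin.ofNat 10 c) : Fin 10 × Fin 10 × Fin 10) ∈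
        triples := by
      simp [triples]
    obtain ⟨⟨a', b', c'⟩, ht⟩ : ∃ t, knotTriple v (knotCount l) = some t := by
      rw [← Option.isSome_iff_exists, knotTriple, List.find?_isSome]
      exact ⟨_, hin, hp⟩
    have hle := find?_not_lt (r := fun s t : Fin 10 × Fin 10 × Fin 10 => 100 * s.1.val + 10 * s.2.1.val +
      s.2.2.val < 100 * t.1.val + 10 * t.2.1.val + t.2.2.val) (fun x => lt_irrefl _)
      (fun x y z => lt_trans) triples_pairwise ht _
      hin hp
    have hs := List.find?_some ht
    simp only [decide_eq_true_eq, hmem] at hs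
    obtain ⟨⟨ha', hb', hc'⟩, hd'⟩ := hs
    rw [hor _ _ _ ha' hb' hc'] at hd'
    dsimp only at hle
    rw [hval a ha, hval b hb, hval c hc] at hle
    have ha6 := h6 a ha
    have hb6 := h6 b hb
    have hc6 := h6 c hc
    have h1 := hma _ ha'
    have e1 : a'.val = a := by omega
    rw [e1] at hd' hle
    have h2 := hmb _ hb' fun e => hd' (by rw [e]; exact dblDet_self_left _ _)
    have e2 : b'.val = b := by omega
    rw [e2] at hd' hle
    have h3 := hmc _ hc' hd'
    have e3 : c'.val = c := by omega
    rw [ht, ← e1, ← e2, ← e3, hof, hof, hof]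

theorem invDet_cast {a b c : ℕ} (ha : a < 6) (hb : b < 6) (hc : c < 6) (h : dblDet a b c ≠ 0) :
    (invDet a b c : ℝ) = 8 / dblDet a b c := by
  have h' : (dblDet a b c : ℝ) ≠ 0 := by exact_mod_cast h
  rw [eq_div_iff h']
  exact_mod_cast invDet_mul ha hb hc h

/-- Cramer's rule in doubled coordinates: the numerators carry a factor 1/4 and the denominator a
factor 1/8. The remaining quarter is what the factor four per degree in `scaledSpline` absorbs. -/
theorem knotCoord_knotCount {v : Fin 3 → Plane} (hv : Nondeg v) {l : List ℕ}
    (hl : l.Pairwise (· ≤ ·)) (h6 : ∀ x ∈ l, x < 6) {a b c : ℕ} (h : firstTriple l = some (a, b, c))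
    (x : Plane) :
    knotCoord v (knotCount l) x =
      Pi.single (Fin.ofNat 10 a) ((invDet a b c : ℝ) / 4 *
        linVal Int.cast (crossForm b c) (bary v x 0, bary v x 1, bary v x 2)) +
      Pi.single (Fin.ofNat 10 b) ((invDet a b c : ℝ) / 4 *
        linVal Int.cast (crossForm c a) (bary v x 0, bary v x 1, bary v x 2)) +
      Pi.single (Fin.ofNat 10 c) ((invDet a b c : ℝ) / 4 *
        linVal Int.cast (crossForm a b) (bary v x 0, bary v x 1, bary v x 2)) := by
  have e := knotTriple_eq hv hl h6
  rw [h, Option.map_some] at e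
  obtain ⟨⟨ha, hb, hc⟩, hd, -⟩ := firstTriple_eq_some hl h
  have ha := h6 a ha
  have hb := h6 b hb
  have hc := h6 c hc
  have hd' : (dblDet a b c : ℝ) ≠ 0 := by exact_mod_cast hd
  have hv' : orient (v 0) (v 1) (v 2) ≠ 0 := hv
  have rot : ∀ p q r : Fin 3 → ℝ, det3 p q r = det3 q r p := by
    intro p q r
    simp only [det3]
    ring
  have hx : orient x (splitPoint v (Fin.ofNat 10 b)) (splitPoint v (Fin.ofNat 10 c)) =
      linVal Int.cast (crossForm b c) (bary v x 0, bary v x 1, bary v x 2) / 4 *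
        orient (v 0) (v 1) (v 2) := by
    rw [← linVal_crossForm hb hc, ← orient_sum_smul v _ _ _ (sum_bary hv x) (sum_splitCoord _)
      (sum_splitCoord _), sum_bary_smul hv x]
    rfl
  have hy : orient (splitPoint v (Fin.ofNat 10 a)) x (splitPoint v (Fin.ofNat 10 c)) =
      linVal Int.cast (crossForm c a) (bary v x 0, bary v x 1, bary v x 2) / 4 *
        orient (v 0) (v 1) (v 2) := by
    rw [← linVal_crossForm hc ha, ← rot, ← orient_sum_smul v _ _ _ (sum_splitCoord _)
      (sum_bary hv x) (sum_splitCoord _), sum_bary_smul hv x]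
    rfl
  have hz : orient (splitPoint v (Fin.ofNat 10 a)) (splitPoint v (Fin.ofNat 10 b)) x =
      linVal Int.cast (crossForm a b) (bary v x 0, bary v x 1, bary v x 2) / 4 *
        orient (v 0) (v 1) (v 2) := by
    rw [← linVal_crossForm ha hb, rot, ← orient_sum_smul v _ _ _ (sum_splitCoord _)
      (sum_splitCoord _) (sum_bary hv x), sum_bary_smul hv x]
    rfl
  have red : ∀ t : ℝ, t / 4 * orient (v 0) (v 1) (v 2) /
      (dblDet a b c / 8 * orient (v 0) (v 1) (v 2)) = (invDet a b c : ℝ) / 4 * t := by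
    intro t
    rw [invDet_cast ha hb hc hd]
    field_simp
  simp only [knotCoord, e]
  rw [hx, hy, hz, orient_splitPoint_ofNat ha hb hc, red, red, red]

/-! ### Convex hulls of knots and the faces they contain -/

theorem knotHull_eq {v : Fin 3 → Plane} {l : List ℕ} {a b c : ℕ} (h6 : ∀ x ∈ l, x < 6)
    (ha : a ∈ l) (hb : b ∈ l) (hc : c ∈ l) (hd : dblDet a b c ≠ 0) (h3 : l.length = 3) :
    knotHull v (knotCount l) = macroTriangle ![splitPoint v (Fin.ofNat 10 a),
      splitPoint v (Fin.ofNat 10 b), splitPoint v (Fin.ofNat 10 c)] := by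
  have hab : a ≠ b := fun e => hd (e ▸ dblDet_self_left _ _)
  have hbc : b ≠ c := fun e => hd (e ▸ dblDet_self_right _ _)
  have hac : a ≠ c := fun e => hd (e ▸ dblDet_self_outer _ _)
  have hset : ({a, b, c} : Finset ℕ) = l.toFinset := by
    apply Finset.eq_of_subset_of_card_le
    · intro x hx
      simp only [Finset.mem_insert, Finset.mem_singleton] at hx
      rcases hx with rfl | rfl | rfl <;> simpa
    · rw [Finset.card_eq_three.2 ⟨a, b, c, hab, hac, hbc, rfl⟩, ← h3]
      exact List.toFinset_card_le l
  have hmem : ∀ x, x ∈ l ↔ x = a ∨ x = b ∨ x = c := by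
    intro x
    rw [← List.mem_toFinset, ← hset]
    simp
  have hval : ∀ a ∈ l, (Fin.ofNat 10 a).val = a := by
    intro a ha
    have := h6 a ha
    simp only [Fin.ofNat]
    omega
  have himg : {j | knotCount l j ≠ 0} = {Fin.ofNat 10 a, Fin.ofNat 10 b, Fin.ofNat 10 c} := by
    ext j
    have : knotCount l j ≠ 0 ↔ j.val ∈ l := by
      simp [knotCount, List.count_eq_zero]
    simp only [Set.mem_ofPred_eq, this, hmem, Set.mem_insert_iff, Set.mem_singleton_iff, Fin.ext_iff,
      hval a ha, hval b hb, hval c hc]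
  rw [knotHull, himg, macroTriangle, Set.image_insert_eq, Set.image_insert_eq, Set.image_singleton]
  congr 1
  ext x
  simp only [Set.mem_insert_iff, Set.mem_singleton_iff, Set.mem_range, Fin.exists_fin_succ,
    Matrix.cons_val_zero, Matrix.cons_val_succ, IsEmpty.exists_iff, or_false, eq_comm]

/-- The value of the scaled recursion for three knots on a face. -/
def leafVal (f : Fin 12) (a b c : ℕ) : ℤ :=
  if f.val ∈ trianglePieces a b c then |invDet a b c| else 0

/-- Verification of the table: a face lies in a triangle exactly when its three vertices have
nonnegative coordinates there, and up to a positive factor these coordinates are the integers on the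
right. Increasing triples suffice because the knots are sorted. -/
theorem mem_trianglePieces {a b c : ℕ} (ha : a < 6) (hb : b < 6) (hc : c < 6)
    (h : dblDet a b c ≠ 0) (hab : a < b) (hbc : b < c) (f : Fin 12) :
    f.val ∈ trianglePieces a b c ↔ ∀ k,
      0 ≤ invDet a b c * linVal id (crossForm b c) (dozenCoord (faceVertex f k)) ∧
      0 ≤ invDet a b c * linVal id (crossForm c a) (dozenCoord (faceVertex f k)) ∧
      0 ≤ invDet a b c * linVal id (crossForm a b) (dozenCoord (faceVertex f k)) := by
  have : ∀ a b c : Fin 6, a.val < b.val → b.val < c.val → dblDet a b c ≠ 0 → ∀ f : Fin 12,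
      (f.val ∈ trianglePieces a b c ↔ ∀ k,
        0 ≤ invDet a b c * linVal id (crossForm b c) (dozenCoord (faceVertex f k)) ∧
        0 ≤ invDet a b c * linVal id (crossForm c a) (dozenCoord (faceVertex f k)) ∧
        0 ≤ invDet a b c * linVal id (crossForm a b) (dozenCoord (faceVertex f k))) := by
    decide +kernel
  exact this ⟨a, ha⟩ ⟨b, hb⟩ ⟨c, hc⟩ hab hbc h f

theorem face_subset_triangle_iff {v : Fin 3 → Plane} (hv : Nondeg v) {a b c : ℕ} (ha : a < 6)
    (hb : b < 6) (hc : c < 6) (hd : dblDet a b c ≠ 0) (hab : a < b) (hbc : b < c) (f : Fin 12) :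
    face v f ⊆ macroTriangle ![splitPoint v (Fin.ofNat 10 a), splitPoint v (Fin.ofNat 10 b),
      splitPoint v (Fin.ofNat 10 c)] ↔ f.val ∈ trianglePieces a b c := by
  set p : Fin 3 → Plane := ![splitPoint v (Fin.ofNat 10 a), splitPoint v (Fin.ofNat 10 b),
      splitPoint v (Fin.ofNat 10 c)] with hp
  have hv' : orient (v 0) (v 1) (v 2) ≠ 0 := hv
  have hd' : (dblDet a b c : ℝ) ≠ 0 := by exact_mod_cast hd
  have hop : orient (p 0) (p 1) (p 2) = dblDet a b c / 8 * orient (v 0) (v 1) (v 2) :=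
    orient_splitPoint_ofNat ha hb hc
  have hpn : Nondeg p := by
    rw [Nondeg, hop]
    positivity
  rw [mem_trianglePieces ha hb hc hd hab hbc]
  have rot : ∀ p q r : Fin 3 → ℝ, det3 p q r = det3 q r p := by
    intro p q r
    simp only [det3]
    ring
  have hdoz : ∀ (b c : ℕ) (j : Fin 10), linVal Int.cast (crossForm b c)
      ((splitCoord j 0 : ℝ), (splitCoord j 1 : ℝ), (splitCoord j 2 : ℝ)) =
      (linVal id (crossForm b c) (dozenCoord j) : ℤ) / 12 := by
    intro b c j
    obtain ⟨h0, h1, h2⟩ := cast_splitCoord' j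
    rw [h0, h1, h2]
    simp only [linVal, id]
    push_cast
    ring
  -- The denominator 48 is 4 · 12: four from the doubled coordinates, as in `knotCoord_knotCount`,
  -- and twelve from `dozenCoord`.
  have hbary : ∀ (j : Fin 10) (b' c' : ℕ), ((dblDet a b c : ℝ) ≠ 0) →
      (linVal Int.cast (crossForm b' c')
        ((splitCoord j 0 : ℝ), (splitCoord j 1 : ℝ), (splitCoord j 2 : ℝ)) / 4 *
          orient (v 0) (v 1) (v 2)) / orient (p 0) (p 1) (p 2) =
      (invDet a b c * linVal id (crossForm b' c') (dozenCoord j) : ℤ) / 48 := by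
    intro j b' c' _
    rw [hop, hdoz]
    push_cast
    rw [invDet_cast ha hb hc hd]
    field_simp
    ring
  have key : ∀ j : Fin 10, splitPoint v j ∈ macroTriangle p ↔
      0 ≤ invDet a b c * linVal id (crossForm b c) (dozenCoord j) ∧
      0 ≤ invDet a b c * linVal id (crossForm c a) (dozenCoord j) ∧
      0 ≤ invDet a b c * linVal id (crossForm a b) (dozenCoord j) := by
    intro j
    have e0 : bary p (splitPoint v j) 0 =
        (invDet a b c * linVal id (crossForm b c) (dozenCoord j) : ℤ) / 48 := by
      rw [← hbary j b c hd', ← linVal_crossForm hb hc (fun i => (splitCoord j i : ℝ)),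
        ← orient_splitPoint]
      rfl
    have e1 : bary p (splitPoint v j) 1 =
        (invDet a b c * linVal id (crossForm c a) (dozenCoord j) : ℤ) / 48 := by
      rw [← hbary j c a hd', ← linVal_crossForm hc ha (fun i => (splitCoord j i : ℝ)), ← rot,
        ← orient_splitPoint]
      rfl
    have e2 : bary p (splitPoint v j) 2 =
        (invDet a b c * linVal id (crossForm a b) (dozenCoord j) : ℤ) / 48 := by
      rw [← hbary j a b hd', ← linVal_crossForm ha hb (fun i => (splitCoord j i : ℝ)), rot,
        ← orient_splitPoint]
      rfl
    have pos : ∀ z : ℤ, (0 : ℝ) ≤ (z : ℝ) / 48 ↔ 0 ≤ z := by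
      intro z
      rw [le_div_iff₀ (by norm_num), zero_mul]
      exact Int.cast_nonneg_iff
    rw [mem_macroTriangle hpn]
    simp only [Fin.forall_fin_succ, Fin.succ_zero_eq_one, Fin.succ_one_eq_two, IsEmpty.forall_iff,
      and_true, e0, e1, e2, pos]
  constructor
  · intro h k
    exact (key _).1 (h (subset_convexHull ℝ _ ⟨k, rfl⟩))
  · intro h
    refine convexHull_min ?_ (convex_convexHull ℝ _)
    rintro _ ⟨k, rfl⟩
    exact (key _).2 (h k)

theorem firstTriple_lt {l : List ℕ} (hl : l.Pairwise (· ≤ ·)) {a b c : ℕ}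
    (h : firstTriple l = some (a, b, c)) : a < b ∧ b < c := by
  obtain ⟨⟨ha, hb, hc⟩, hd, hma, hmb, -⟩ := firstTriple_eq_some hl h
  have hab : a ≠ b := fun e => hd (e ▸ dblDet_self_left _ _)
  have hbc : b ≠ c := fun e => hd (e ▸ dblDet_self_right _ _)
  have hac : a ≠ c := fun e => hd (e ▸ dblDet_self_outer _ _)
  have h1 := hma b hb
  have h2 := hmb c hc hac.symm
  omega

/-- With positive area the coefficients of the recursion would sum to one, but without an
independent triple they are zero by definition. -/
theorem area_knotHull_eq_zero {v : Fin 3 → Plane} (hv : Nondeg v) {l : List ℕ}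
    (hl : l.Pairwise (· ≤ ·)) (h6 : ∀ x ∈ l, x < 6) (h : firstTriple l = none) :
    area (knotHull v (knotCount l)) = 0 := by
  by_contra hne
  have h1 := (knotCoord_spec v (knotCount l) 0 hne).1
  have e := knotTriple_eq hv hl h6
  rw [h, Option.map_none] at e
  simp only [knotCoord, e] at h1
  simp at h1

theorem area_knotHull_ne_zero {v : Fin 3 → Plane} (hv : Nondeg v) {l : List ℕ}
    (hl : l.Pairwise (· ≤ ·)) (h6 : ∀ x ∈ l, x < 6) {a b c : ℕ} (h : firstTriple l = some (a, b, c)) :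
    area (knotHull v (knotCount l)) ≠ 0 := by
  obtain ⟨⟨ha, hb, hc⟩, hd, -⟩ := firstTriple_eq_some hl h
  have hval : ∀ a ∈ l, (Fin.ofNat 10 a).val = a := by
    intro a ha
    have := h6 a ha
    simp only [Fin.ofNat]
    omega
  have hmem : ∀ j : ℕ, j ∈ l → knotCount l (Fin.ofNat 10 j) ≠ 0 := by
    intro j hj
    simp only [knotCount, hval j hj]
    exact (List.count_pos_iff.2 hj).ne'
  have hd' : (dblDet a b c : ℝ) ≠ 0 := by exact_mod_cast hd
  have hv' : orient (v 0) (v 1) (v 2) ≠ 0 := hv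
  have hpn : Nondeg ![splitPoint v (Fin.ofNat 10 a), splitPoint v (Fin.ofNat 10 b),
      splitPoint v (Fin.ofNat 10 c)] := by
    rw [Nondeg]
    change orient (splitPoint v (Fin.ofNat 10 a)) (splitPoint v (Fin.ofNat 10 b))
      (splitPoint v (Fin.ofNat 10 c)) ≠ 0
    rw [orient_splitPoint_ofNat (h6 a ha) (h6 b hb) (h6 c hc)]
    positivity
  have hsub : macroTriangle ![splitPoint v (Fin.ofNat 10 a), splitPoint v (Fin.ofNat 10 b),
      splitPoint v (Fin.ofNat 10 c)] ⊆ knotHull v (knotCount l) := by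
    refine convexHull_mono ?_
    rintro _ ⟨k, rfl⟩
    fin_cases k
    exacts [⟨_, hmem a ha, rfl⟩, ⟨_, hmem b hb, rfl⟩, ⟨_, hmem c hc, rfl⟩]
  have hfin : MeasureTheory.volume (knotHull v (knotCount l)) ≠ ⊤ :=
    (((Set.toFinite _).image _).isCompact_convexHull (𝕜 := ℝ)).measure_lt_top.ne
  refine (lt_of_lt_of_le (area_macroTriangle_pos hpn) ?_).ne'
  exact ENNReal.toReal_mono hfin (MeasureTheory.measure_mono hsub)

theorem removeKnot_knotCount {l : List ℕ} {a : ℕ} (ha : a < 6) :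
    removeKnot (knotCount l) (Fin.ofNat 10 a) = knotCount (l.erase a) := by
  have hval : (Fin.ofNat 10 a).val = a := by
    simp only [Fin.ofNat]
    omega
  funext j
  by_cases hj : j = Fin.ofNat 10 a
  · subst hj
    rw [removeKnot, Function.update_self, knotCount, knotCount, hval, List.count_erase_self]
  · have : j.val ≠ a := fun e => hj (Fin.ext (by rw [hval, e]))
    rw [removeKnot, Function.update_of_ne hj, knotCount, knotCount, List.count_erase_of_ne this]

/-- On a face, simplex splines are given by the scaled recursion. -/
theorem pow_mul_simplexSplineAux {v : Fin 3 → Plane} (hv : Nondeg v) {cell : Plane → Set Plane}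
    {x : Plane} (hx : x ∈ macroTriangle v) {f : Fin 12} (hf : cell x = face v f) (n : ℕ) :
    ∀ l : List ℕ, l.Pairwise (· ≤ ·) → (∀ x ∈ l, x < 6) → l.length = n + 3 →
      4 ^ n * simplexSplineAux v cell n (knotCount l) x =
        scaledSpline Int.cast (fun a b c => (leafVal f a b c : ℝ))
          (bary v x 0, bary v x 1, bary v x 2) n l := by
  induction n with
  | zero =>
    intro l hl h6 h3
    rw [simplexSplineAux, scaledSpline]
    cases h : firstTriple l with
    | none => simp [area_knotHull_eq_zero hv hl h6 h]
    | some t =>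
      obtain ⟨a, b, c⟩ := t
      rw [if_neg (area_knotHull_ne_zero hv hl h6 h)]
      obtain ⟨⟨ha, hb, hc⟩, hd, -⟩ := firstTriple_eq_some hl h
      obtain ⟨hab, hbc⟩ := firstTriple_lt hl h
      have hH := knotHull_eq (v := v) h6 ha hb hc hd h3
      have ha := h6 a ha
      have hb := h6 b hb
      have hc := h6 c hc
      have hd' : (dblDet a b c : ℝ) ≠ 0 := by exact_mod_cast hd
      have hv' : orient (v 0) (v 1) (v 2) ≠ 0 := hv
      have hsub := face_subset_triangle_iff hv ha hb hc hd hab hbc f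
      rw [← hH, ← hf] at hsub
      have hop := orient_splitPoint_ofNat (v := v) ha hb hc
      have hpn : Nondeg ![splitPoint v (Fin.ofNat 10 a), splitPoint v (Fin.ofNat 10 b),
          splitPoint v (Fin.ofNat 10 c)] := by
        rw [Nondeg]
        change orient (splitPoint v (Fin.ofNat 10 a)) (splitPoint v (Fin.ofNat 10 b))
          (splitPoint v (Fin.ofNat 10 c)) ≠ 0
        rw [hop]
        positivity
      have hratio : area (macroTriangle v) / area (knotHull v (knotCount l)) =
          |(invDet a b c : ℝ)| := by
        rw [hH, area_div_area hpn]
        change |orient (v 0) (v 1) (v 2)| / |orient (splitPoint v (Fin.ofNat 10 a))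
          (splitPoint v (Fin.ofNat 10 b)) (splitPoint v (Fin.ofNat 10 c))| = _
        rw [hop, invDet_cast ha hb hc hd, ← abs_div]
        congr 1
        field_simp
      rw [hratio]
      -- Whether `x` belongs to the half-open hull depends only on its assigned face, so points on
      -- the lines of the split need no separate treatment.
      by_cases hin : f.val ∈ trianglePieces a b c
      · have : x ∈ halfOpenHull v cell (knotCount l) := ⟨hx, hsub.2 hin⟩
        simp [leafVal, hin, this]
      · have : x ∉ halfOpenHull v cell (knotCount l) := fun h' => hin (hsub.1 h'.2)
        simp [leafVal, hin, this]
  | succ n ih =>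
    intro l hl h6 h3
    rw [simplexSplineAux, scaledSpline]
    cases h : firstTriple l with
    | none => simp [area_knotHull_eq_zero hv hl h6 h]
    | some t =>
      obtain ⟨a, b, c⟩ := t
      rw [if_neg (area_knotHull_ne_zero hv hl h6 h), knotCoord_knotCount hv hl h6 h]
      obtain ⟨⟨ha, hb, hc⟩, hd, -⟩ := firstTriple_eq_some hl h
      have her : ∀ a ∈ l, 4 ^ n * simplexSplineAux v cell n (removeKnot (knotCount l)
          (Fin.ofNat 10 a)) x = scaledSpline Int.cast (fun a b c => (leafVal f a b c : ℝ))
          (bary v x 0, bary v x 1, bary v x 2) n (l.erase a) := by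
        intro a ha
        rw [removeKnot_knotCount (h6 a ha)]
        refine ih _ (hl.sublist List.erase_sublist) (fun x hx => h6 x (List.mem_of_mem_erase hx)) ?_
        rw [List.length_erase_of_mem ha]
        omega
      simp only [Pi.add_apply, add_mul, Finset.sum_add_distrib, Pi.single_apply, ite_mul, zero_mul,
        Finset.sum_ite_eq', Finset.mem_univ, if_true]
      rw [← her a ha, ← her b hb, ← her c hc]
      ring

/-! ### The eight formulas -/

/-- The sorted list of knots of `Q[v₁^i v₂^j v₃^k v₄^l v₅^m v₆^n]`. -/
def knots (i j k l m n : ℕ) : List ℕ :=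
  List.replicate i 0 ++ (List.replicate j 1 ++ (List.replicate k 2 ++ (List.replicate l 3 ++
    (List.replicate m 4 ++ List.replicate n 5))))

/-- A common denominator of the coefficients of a formula. -/
def formulaScale : Fin 8 → ℤ :=
  ![48, 80, 3840, 960, 138240, 34560, 720, 90]

/-- The integer coefficients and the knots of the simplex splines in the formulas for the nodal
functions dual to the derivatives `1`, `D_x`, `D_x²`, `D_x D_y`, `D_x³`, `D_x² D_y` at a corner, to a
second cross-boundary derivative, and to a first cross-boundary derivative. -/
def formulaTerms : Fin 8 → List (ℤ × List ℕ) :=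
  ![
    [
      (12, knots 6 0 0 1 0 1), (12, knots 5 0 0 2 0 1), (12, knots 5 0 0 1 0 2),
      (24, knots 4 1 0 2 0 1), (24, knots 4 0 1 1 0 2), (48, knots 4 1 1 1 0 1),
      (24, knots 3 1 1 2 0 1), (24, knots 3 1 1 1 0 2), (24, knots 3 2 0 2 0 1),
      (24, knots 3 0 2 1 0 2), (27, knots 2 1 1 2 1 1), (27, knots 2 1 1 1 1 2),
      (18, knots 2 2 0 2 1 1), (18, knots 2 0 2 1 1 2), (9, knots 1 1 2 1 1 2),
      (9, knots 1 2 1 2 1 1)],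
    [
      (2, knots 5 0 0 2 0 1), (8, knots 4 1 0 2 0 1), (16, knots 3 2 0 2 0 1),
      (8, knots 4 1 1 1 0 1), (12, knots 3 1 1 2 0 1), (13, knots 2 2 0 2 1 1),
      (4, knots 3 1 1 1 0 2), (19, knots 2 1 1 2 1 1), (8, knots 1 2 1 2 1 1),
      (-2, knots 2 1 1 1 1 2), (-2, knots 2 0 2 1 1 2), (-4, knots 1 1 2 1 1 2)],
    [
      (24, knots 4 1 0 2 0 1), (120, knots 3 2 0 2 0 1), (48, knots 3 1 1 2 0 1),
      (102, knots 2 2 0 2 1 1), (121, knots 2 1 1 2 1 1), (71, knots 1 2 1 2 1 1),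
      (-80, knots 2 1 1 1 1 2), (8, knots 1 1 2 1 1 2)],
    [
      (12, knots 4 1 1 1 0 1), (18, knots 3 1 1 2 0 1), (18, knots 3 1 1 1 0 2),
      (-6, knots 2 2 0 2 1 1), (-6, knots 2 0 2 1 1 2), (17, knots 2 1 1 1 1 2),
      (17, knots 2 1 1 2 1 1), (-14, knots 1 1 2 1 1 2), (-14, knots 1 2 1 2 1 1)],
    [
      (288, knots 3 2 0 2 0 1), (252, knots 2 2 0 2 1 1), (225, knots 2 1 1 2 1 1),
      (189, knots 1 2 1 2 1 1)],
    [
      (72, knots 3 1 1 2 0 1), (-18, knots 2 2 0 2 1 1), (-45, knots 1 2 1 2 1 1),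
      (99, knots 2 1 1 2 1 1), (-99, knots 2 1 1 1 1 2), (9, knots 1 1 2 1 1 2)],
    [
      (21, knots 2 1 1 2 1 1), (-3, knots 1 2 1 2 1 1)],
    [
      (9, knots 2 2 0 2 1 1), (18, knots 2 1 1 2 1 1), (18, knots 1 2 1 2 1 1)]]

/-- The linear factors of the truncated powers in the eight nodal functions. -/
def truncTable : Fin 8 → List (ℤ × ℤ × ℤ) :=
  ![
    [
      (116, -34, -34), (-880, 80, 80), (-256, 320, -64), (-16, 176, 560), (252, 18, 18),
      (-144, -126, 126), (-144, 126, -126), (-880, 80, 80), (-16, 560, 176), (-256, -64, 320),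
      (252, 18, 18), (-144, -126, 126), (-144, 126, -126)],
    [
      (38, 8, -32), (-160, 176, -96), (-320, -480, -160), (128, 432, 640), (114, -264, 336),
      (-318, -32, 152), (246, -64, -56), (-640, 208, -128), (-160, -240, -320), (64, 96, 800),
      (106, -176, 184), (-198, -72, 192), (78, -72, -48)],
    [
      (30, 130, -80), (1200, 1584, -2624), (656, -5440, -256), (1344, 4496, 1920),
      (306, -2346, 3384), (-2886, -834, 1464), (-186, 954, -1584), (-6720, -656, -384),
      (-1968, -3120, -4672), (2672, 1088, 1280), (-854, -866, 1024), (-990, -650, 1280),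
      (1278, -1102, 472)],
    [
      (108, -52, -52), (0, -192, 992), (-1280, 1600, -320), (0, 160, 960), (396, 84, 84),
      (636, 444, -444), (636, -444, 444), (0, 992, -192), (0, 960, 160), (-1280, -320, 1600),
      (788, -28, -28), (-252, -148, 148), (-252, 148, -148)],
    [
      (382, 262, -368), (-18800, 3568, -4928), (-848, -12800, -1472), (3328, 7312, 7360),
      (-126, -3294, 2376), (-8982, -4518, 6408), (1062, 1422, -3312), (-16640, 112, -1472),
      (-848, -6320, -1472), (5200, 2560, 7360), (-774, -2646, 3024), (-3150, -1710, 3600),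
      (414, 774, -2664)],
    [
      (32, -118, 62), (11600, -400, 1040), (-160, 4160, 320), (1136, 4784, -880),
      (792, -1602, 3258), (2772, 1998, -2538), (-1116, 954, -414), (-5680, 464, 176),
      (-2320, 2000, -6160), (-1888, -832, -1600), (576, 774, -846), (-468, -1242, 702),
      (828, -1422, 1962)],
    [
      (54, -26, -16), (-240, -80, 320), (-336, 640, -64), (384, 976, 320), (-54, -606, 264),
      (210, 90, -120), (-66, 174, -144), (-1920, 304, -64), (48, 400, -448), (-432, -128, 320),
      (258, 42, -48), (-294, -366, 336), (-138, 102, -72)],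
    [
      (28, 28, -32), (-560, 112, -272), (-32, -1280, -128), (256, 544, 640), (-144, -576, 324),
      (-576, -144, 324), (108, 108, -288), (-1280, -32, -128), (112, -560, -272), (544, 256, 640),
      (-108, -252, 288), (-252, -108, 288), (0, 0, -180)]]

/-- The line at infinity and the six lines of the 12-split with both orientations, as linear forms
in the barycentric coordinates. -/
def lineForms : List (ℤ × ℤ × ℤ) :=
  [(1, 1, 1), (0, 1, -1), (-1, 0, 1), (1, -1, 0), (1, -1, -1), (-1, 1, -1), (-1, -1, 1),
    (0, -1, 1), (1, 0, -1), (-1, 1, 0), (-1, 1, 1), (1, -1, 1), (1, 1, -1)]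

/-- The terms `(q, ℓ)` of a formula, written as a sum of truncated powers `q ℓ₊⁴`. -/
def truncTerms (F : Fin 8) : List ((ℤ × ℤ × ℤ) × (ℤ × ℤ × ℤ)) := (truncTable F).zip lineForms

/-- A linear form is positive on a face (if it does not change sign there). -/
def formActive (f : Fin 12) (c : ℤ × ℤ × ℤ) : Bool :=
  0 < linVal id c (dozenCoord (faceVertex f 0)) + linVal id c (dozenCoord (faceVertex f 1)) +
    linVal id c (dozenCoord (faceVertex f 2))

/-- The base of the positional system in which polynomials are encoded as integers. -/
def digitBase : ℤ := 2 ^ 100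

/-- The encoded barycentric coordinates. -/
def codePoint : ℤ × ℤ × ℤ := (1 - digitBase - digitBase ^ 6, digitBase, digitBase ^ 6)

/-- The values for three knots on all faces, encoded in one integer. -/
def leafCode (a b c : ℕ) : ℤ :=
  |invDet a b c| * ((trianglePieces a b c).map fun f => (digitBase ^ 36) ^ f).sum

/-- Kronecker substitution with base `B = digitBase`. The coordinates `(1 - x - y, x, y)` are taken
at `x = B`, `y = B⁶`, so the monomials of degree at most five in each variable occupy distinct
digits below `B³⁶`, and the weights `(B³⁶)^f` separate the faces. One integer equality thus encodes
the identities on all twelve faces. The factor 1024 is `4⁵`, from the five scaled steps of the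
recursion. -/
theorem formula_code (F : Fin 8) :
    ((formulaTerms F).map fun t => t.1 * scaledSpline id leafCode codePoint 5 t.2).sum =
      1024 * ((truncTerms F).map fun t => linVal id t.1 codePoint * linVal id t.2 codePoint ^ 4 *
        ∑ f : Fin 12, if formActive f t.2 then (digitBase ^ 36) ^ f.val else 0).sum := by
  revert F
  decide +kernel

/-! ### Lifting the check from encoded polynomials to all points -/

/-- Signed digits smaller than the base are unique: the lowest digit is divisible by the base, hence
zero, and the rest is divided by the base. -/
theorem digits_eq_zero {B : ℤ} (n : ℕ) : ∀ c : ℕ → ℤ, (∀ i < n, |c i| < B) →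
    ∑ i ∈ Finset.range n, c i * B ^ i = 0 → ∀ i < n, c i = 0 := by
  induction n with
  | zero => simp
  | succ n ih =>
    intro c hc hs
    have hB : 0 < B := (abs_nonneg _).trans_lt (hc 0 (Nat.succ_pos n))
    rw [Finset.sum_range_succ'] at hs
    have e : ∑ i ∈ Finset.range n, c (i + 1) * B ^ (i + 1) =
        B * ∑ i ∈ Finset.range n, c (i + 1) * B ^ i := by
      rw [Finset.mul_sum]
      exact Finset.sum_congr rfl fun i _ => by ring
    rw [e, pow_zero, mul_one] at hs
    have h0 : c 0 = 0 := by
      refine Int.eq_zero_of_abs_lt_dvd (m := B) ⟨-∑ i ∈ Finset.range n, c (i + 1) * B ^ i, ?_⟩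
        (hc 0 (Nat.succ_pos n))
      linarith
    rw [h0, add_zero] at hs
    have h1 := ih (fun i => c (i + 1)) (fun i hi => hc _ (by omega))
      ((mul_eq_zero.1 hs).resolve_left hB.ne')
    intro i hi
    cases i with
    | zero => exact h0
    | succ i => exact h1 i (by omega)

/-- A block of `n` digits is itself a digit in base `Bⁿ`, which allows nested decoding. -/
theorem abs_digits_lt {B : ℤ} (n : ℕ) (c : ℕ → ℤ) (hc : ∀ i < n, |c i| < B) :
    |∑ i ∈ Finset.range n, c i * B ^ i| < B ^ n := by
  induction n with
  | zero => simp
  | succ n ih =>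
    have hB : 0 < B := (abs_nonneg _).trans_lt (hc 0 (Nat.succ_pos n))
    have h1 := ih fun i hi => hc i (by omega)
    have h2 : |c n| ≤ B - 1 := by have := hc n (by omega); omega
    have hp : 0 < B ^ n := pow_pos hB n
    rw [Finset.sum_range_succ]
    refine (abs_add_le _ _).trans_lt ?_
    rw [abs_mul, abs_of_pos hp, pow_succ]
    nlinarith

open Polynomial in
/-- A bivariate polynomial has degree at most `n` in each variable and coefficients of absolute
value at most `M`. -/
def CoeffBound (n : ℕ) (M : ℤ) (P : ℤ[X][X]) : Prop :=
  ∀ i j, |(P.coeff j).coeff i| ≤ M ∧ (n < i ∨ n < j → (P.coeff j).coeff i = 0)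

/-! ### Coefficient bounds for bivariate integer polynomials -/

namespace CoeffBound
open Polynomial

theorem add {n : ℕ} {M M' : ℤ} {P P' : ℤ[X][X]} (h : CoeffBound n M P) (h' : CoeffBound n M' P') :
    CoeffBound n (M + M') (P + P') := by
  intro i j
  rw [coeff_add, coeff_add]
  refine ⟨(abs_add_le _ _).trans (add_le_add (h i j).1 (h' i j).1), fun hij => ?_⟩
  rw [(h i j).2 hij, (h' i j).2 hij, add_zero]

theorem zero (n : ℕ) {M : ℤ} (hM : 0 ≤ M) : CoeffBound n M 0 := by
  intro i j
  simpa using hM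

theorem mono {n : ℕ} {M M' : ℤ} {P : ℤ[X][X]} (h : CoeffBound n M P) (hM : M ≤ M') :
    CoeffBound n M' P := fun i j => ⟨(h i j).1.trans hM, (h i j).2⟩

theorem intCast_mul {n : ℕ} {M K : ℤ} {P : ℤ[X][X]} (h : CoeffBound n M P) {z : ℤ} (hz : |z| ≤ K) :
    CoeffBound n (K * M) ((z : ℤ[X][X]) * P) := by
  intro i j
  have e : (((z : ℤ[X][X]) * P).coeff j).coeff i = z * (P.coeff j).coeff i := by
    rw [← map_intCast (C : ℤ[X] →+* ℤ[X][X]), coeff_C_mul, ← map_intCast (C : ℤ →+* ℤ[X]),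
      coeff_C_mul]
    rfl
  rw [e]
  refine ⟨?_, fun hij => by rw [(h i j).2 hij, mul_zero]⟩
  rw [abs_mul]
  exact mul_le_mul hz (h i j).1 (abs_nonneg _) ((abs_nonneg _).trans hz)

theorem intCast {K : ℤ} {z : ℤ} (hz : |z| ≤ K) : CoeffBound 0 K ((z : ℤ[X][X])) := by
  have h1 : CoeffBound 0 1 (1 : ℤ[X][X]) := by
    intro i j
    rw [coeff_one]
    by_cases hj : j = 0
    · rw [if_pos hj, coeff_one]
      split_ifs with hi
      · exact ⟨by simp, fun h => by omega⟩
      · simp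
    · simp [hj]
  simpa using h1.intCast_mul hz

theorem list_sum {α : Type*} {n : ℕ} {M : ℤ} (l : List α) (P : α → ℤ[X][X])
    (h : ∀ a ∈ l, CoeffBound n M (P a)) : CoeffBound n (l.length * M) (l.map P).sum := by
  induction l with
  | nil => simpa using zero n le_rfl
  | cons a l ih =>
    rw [List.map_cons, List.sum_cons]
    refine ((h a (by simp)).add (ih fun b hb => h b (by simp [hb]))).mono (le_of_eq ?_)
    rw [List.length_cons]
    push_cast
    ring

/-- Barycentric coordinates as polynomials. -/
noncomputable def polyPoint : ℤ[X][X] × ℤ[X][X] × ℤ[X][X] := (1 - C X - X, C X, X)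

/-- In the coordinates `(1 - x - y, x, y)` the form is `c₀ + (c₁ - c₀) x + (c₂ - c₀) y`.
Multiplication by `x` or `y` only shifts coefficients, so the bound grows by at most the sum of the
absolute values of the three coefficients. -/
theorem linVal_mul {n : ℕ} {M K : ℤ} {P : ℤ[X][X]} (h : CoeffBound n M P) {c : ℤ × ℤ × ℤ}
    (hc : |c.1| + |c.2.1 - c.1| + |c.2.2 - c.1| ≤ K) :
    CoeffBound (n + 1) (K * M) (linVal Int.cast c polyPoint * P) := by
  have hM : 0 ≤ M := (abs_nonneg _).trans (h 0 0).1
  have e : linVal Int.cast c polyPoint * P = C (C c.1) * P + C (C (c.2.1 - c.1)) * (C X * P) +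
      C (C (c.2.2 - c.1)) * (X * P) := by
    have hC : ∀ z : ℤ, (z : ℤ[X][X]) = C (C z) := by
      intro z
      rw [← map_intCast (C : ℤ[X] →+* ℤ[X][X]), ← map_intCast (C : ℤ →+* ℤ[X])]
      rfl
    simp only [linVal, polyPoint, hC, map_sub]
    ring
  rw [e]
  have hx : ∀ i j, (X * P.coeff j).coeff i = if i = 0 then 0 else (P.coeff j).coeff (i - 1) := by
    intro i j
    cases i with
    | zero => simp
    | succ i => simp [coeff_X_mul]
  have hy : ∀ i j, ((X * P : ℤ[X][X]).coeff j).coeff i =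
      if j = 0 then 0 else (P.coeff (j - 1)).coeff i := by
    intro i j
    cases j with
    | zero => simp
    | succ j => simp [coeff_X_mul]
  intro i j
  simp only [coeff_add, coeff_C_mul, hx, hy]
  constructor
  · refine (abs_add_three _ _ _).trans ?_
    rw [abs_mul, abs_mul, abs_mul]
    have h1 := (h i j).1
    have h2 : |if i = 0 then 0 else (P.coeff j).coeff (i - 1)| ≤ M := by
      split_ifs
      exacts [by simpa using hM, (h _ _).1]
    have h3 : |if j = 0 then 0 else (P.coeff (j - 1)).coeff i| ≤ M := by
      split_ifs
      exacts [by simpa using hM, (h _ _).1]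
    calc _ ≤ |c.1| * M + |c.2.1 - c.1| * M + |c.2.2 - c.1| * M := by gcongr
      _ = (|c.1| + |c.2.1 - c.1| + |c.2.2 - c.1|) * M := by ring
      _ ≤ K * M := by gcongr
  · intro hij
    have h1 : (P.coeff j).coeff i = 0 := (h i j).2 (by omega)
    have h2 : (if i = 0 then 0 else (P.coeff j).coeff (i - 1)) = 0 := by
      split_ifs
      exacts [rfl, (h _ _).2 (by omega)]
    have h3 : (if j = 0 then 0 else (P.coeff (j - 1)).coeff i) = 0 := by
      split_ifs
      exacts [rfl, (h _ _).2 (by omega)]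
    rw [h1, h2, h3]
    simp

/-- Each step of the recursion multiplies the bound by `8 · 3 · 16 = 384`: the factor `invDet`,
three summands, and a linear form in each. -/
theorem scaledSpline {leaf : ℕ → ℕ → ℕ → ℤ} (hleaf : ∀ a < 6, ∀ b < 6, ∀ c < 6, |leaf a b c| ≤ 8)
    (n : ℕ) : ∀ l : List ℕ, l.Pairwise (· ≤ ·) → (∀ x ∈ l, x < 6) → CoeffBound n (384 ^ n * 8)
      (PowellSabin.scaledSpline Int.cast (fun a b c => (leaf a b c : ℤ[X][X])) polyPoint n l) := by
  have hK : ∀ b < 6, ∀ c < 6, |(crossForm b c).1| + |(crossForm b c).2.1 - (crossForm b c).1| +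
      |(crossForm b c).2.2 - (crossForm b c).1| ≤ 16 := by
    decide +kernel
  have hI : ∀ a < 6, ∀ b < 6, ∀ c < 6, |invDet a b c| ≤ 8 := by
    decide +kernel
  induction n with
  | zero =>
    intro l hl h6
    rw [PowellSabin.scaledSpline]
    cases h : firstTriple l with
    | none => exact zero _ (by norm_num)
    | some t =>
      obtain ⟨a, b, c⟩ := t
      obtain ⟨⟨ha, hb, hc⟩, -⟩ := firstTriple_eq_some hl h
      exact (intCast (hleaf a (h6 a ha) b (h6 b hb) c (h6 c hc))).mono (by norm_num)
  | succ n ih =>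
    intro l hl h6
    rw [PowellSabin.scaledSpline]
    cases h : firstTriple l with
    | none => exact zero _ (by positivity)
    | some t =>
      obtain ⟨a, b, c⟩ := t
      obtain ⟨⟨ha, hb, hc⟩, -⟩ := firstTriple_eq_some hl h
      have ih' := fun a => ih (l.erase a) (hl.sublist List.erase_sublist)
        (fun x hx => h6 x (List.mem_of_mem_erase hx))
      have ha := h6 a ha
      have hb := h6 b hb
      have hc := h6 c hc
      refine ((((ih' a).linVal_mul (hK b hb c hc)).add ((ih' b).linVal_mul (hK c hc a ha))).add
        ((ih' c).linVal_mul (hK a ha b hb))).intCast_mul (hI a ha b hb c hc) |>.mono (le_of_eq ?_)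
      ring

end CoeffBound

/-! ### Compatibility of the recursion with evaluation -/

section Naturality
open Polynomial

/-- Evaluation of a bivariate integer polynomial in a commutative ring. -/
noncomputable def evalHom {S : Type} [CommRing S] (x y : S) : ℤ[X][X] →+* S :=
  eval₂RingHom (eval₂RingHom (Int.castRingHom S) x) y

theorem evalHom_eq_sum {S : Type} [CommRing S] (x y : S) {n : ℕ} {M : ℤ} {P : ℤ[X][X]}
    (h : CoeffBound n M P) : evalHom x y P =
      ∑ j ∈ Finset.range (n + 1),
        (∑ i ∈ Finset.range (n + 1), ((P.coeff j).coeff i : S) * x ^ i) * y ^ j := by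
  have h1 : P.natDegree < n + 1 := by
    rw [Nat.lt_succ_iff, natDegree_le_iff_coeff_eq_zero]
    intro j hj
    ext i
    exact (h i j).2 (Or.inr hj)
  have h2 : ∀ j, (P.coeff j).natDegree < n + 1 := by
    intro j
    rw [Nat.lt_succ_iff, natDegree_le_iff_coeff_eq_zero]
    exact fun i hi => (h i j).2 (Or.inl hi)
  rw [evalHom, coe_eval₂RingHom, eval₂_eq_sum_range' _ h1]
  refine Finset.sum_congr rfl fun j _ => ?_
  rw [coe_eval₂RingHom, eval₂_eq_sum_range' _ (h2 j)]
  rfl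

theorem evalHom_polyPoint {S : Type} [CommRing S] (x y : S) (c : ℤ × ℤ × ℤ) :
    evalHom x y (linVal Int.cast c CoeffBound.polyPoint) =
      linVal Int.cast c (1 - x - y, x, y) := by
  have hX : evalHom x y (C X) = x := by simp [evalHom]
  have hY : evalHom x y X = y := by simp [evalHom]
  simp [linVal, CoeffBound.polyPoint, hX, hY]

/-- The branching of the recursion depends only on the list of knots; otherwise it uses ring
operations alone, which homomorphisms preserve. The same recursion can therefore be read over the
integers, over polynomials and over the reals. -/
theorem evalHom_scaledSpline {S : Type} [CommRing S] (x y : S) (leaf : ℕ → ℕ → ℕ → ℤ) (n : ℕ) :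
    ∀ l, evalHom x y (scaledSpline Int.cast (fun a b c => (leaf a b c : ℤ[X][X]))
      CoeffBound.polyPoint n l) =
      scaledSpline Int.cast (fun a b c => (leaf a b c : S)) (1 - x - y, x, y) n l := by
  induction n with
  | zero =>
    intro l
    rw [scaledSpline, scaledSpline]
    cases firstTriple l with
    | none => simp
    | some t => simp
  | succ n ih =>
    intro l
    rw [scaledSpline, scaledSpline]
    cases firstTriple l with
    | none => simp
    | some t => simp [ih, evalHom_polyPoint]

end Naturality

/-- The recursion is linear in the leaf values, so the computation with encoded leaves is the
weighted sum of the computations on the individual faces. -/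
theorem scaledSpline_sum {R : Type} [CommRing R] (ι : ℤ → R) (w : R × R × R) {α : Type*}
    (s : Finset α) (k : α → R) (leaf : α → ℕ → ℕ → ℕ → R) (n : ℕ) :
    ∀ l, scaledSpline ι (fun a b c => ∑ f ∈ s, k f * leaf f a b c) w n l =
      ∑ f ∈ s, k f * scaledSpline ι (leaf f) w n l := by
  induction n with
  | zero =>
    intro l
    simp only [scaledSpline]
    cases firstTriple l with
    | none => simp
    | some t => rfl
  | succ n ih =>
    intro l
    simp only [scaledSpline]
    cases firstTriple l with
    | none => simp
    | some t =>
      simp only [ih, Finset.mul_sum, ← Finset.sum_add_distrib]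
      exact Finset.sum_congr rfl fun f _ => by ring

theorem leafCode_eq (a b c : ℕ) :
    leafCode a b c = ∑ f : Fin 12, (digitBase ^ 36) ^ f.val * leafVal f a b c := by
  have h : ∀ n : ℤ, ((trianglePieces a b c).map fun f => n ^ f).sum =
      ∑ f : Fin 12, if f.val ∈ trianglePieces a b c then n ^ f.val else 0 := by
    intro n
    unfold trianglePieces
    split <;> simp [Fin.sum_univ_succ]
  simp only [leafCode, h, leafVal, Finset.mul_sum]
  refine Finset.sum_congr rfl fun f _ => ?_
  split_ifs <;> ring

/-- The difference of the two sides of a formula on a face. -/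
def faceDefect {R : Type} [CommRing R] (F : Fin 8) (f : Fin 12) (w : R × R × R) : R :=
  ((formulaTerms F).map fun t =>
    (t.1 : R) * scaledSpline Int.cast (fun a b c => (leafVal f a b c : R)) w 5 t.2).sum +
  ((truncTerms F).map fun t => ((if formActive f t.2 then -1024 else 0 : ℤ) : R) *
    (linVal Int.cast t.2 w * (linVal Int.cast t.2 w * (linVal Int.cast t.2 w *
      (linVal Int.cast t.2 w * (linVal Int.cast t.1 w * 1)))))).sum

theorem formulaTerms_bound (F : Fin 8) : (formulaTerms F).length ≤ 16 ∧
    ∀ t ∈ formulaTerms F, |t.1| ≤ 1000 ∧ t.2.Pairwise (· ≤ ·) ∧ (∀ x ∈ t.2, x < 6) ∧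
      t.2.length = 8 := by
  revert F
  decide +kernel

theorem truncTerms_bound (F : Fin 8) : (truncTerms F).length ≤ 16 ∧
    ∀ t ∈ truncTerms F, |t.1.1| + |t.1.2.1 - t.1.1| + |t.1.2.2 - t.1.1| ≤ 100000 ∧
      |t.2.1| + |t.2.2.1 - t.2.1| + |t.2.2.2 - t.2.1| ≤ 5 := by
  revert F
  decide +kernel

/-- Five steps of the recursion, or five linear factors, raise the degree in each variable to at
most five. The coefficients are at most `16 · 1000 · 384⁵ · 8 + 16 · 1024 · 5⁴ · 100000`, which is
far below `2¹⁰⁰`. Hence the defect is recoverable from its code. -/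
theorem coeffBound_faceDefect (F : Fin 8) (f : Fin 12) :
    CoeffBound 5 (digitBase - 1) (faceDefect F f CoeffBound.polyPoint) := by
  obtain ⟨hl, hF⟩ := formulaTerms_bound F
  obtain ⟨hl', hF'⟩ := truncTerms_bound F
  have hleaf : ∀ a < 6, ∀ b < 6, ∀ c < 6, |leafVal f a b c| ≤ 8 := by
    have : ∀ a < 6, ∀ b < 6, ∀ c < 6, |invDet a b c| ≤ 8 := by
      decide +kernel
    intro a ha b hb c hc
    rw [leafVal]
    split_ifs
    · rw [abs_abs]
      exact this a ha b hb c hc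
    · simp
  have h1 := CoeffBound.list_sum (n := 5) (formulaTerms F) _ fun t ht =>
    (CoeffBound.scaledSpline hleaf 5 t.2 (hF t ht).2.1 (hF t ht).2.2.1).intCast_mul (hF t ht).1
  have h2 := CoeffBound.list_sum (n := 5) (truncTerms F) (fun t =>
    ((if formActive f t.2 then -1024 else 0 : ℤ) : Polynomial (Polynomial ℤ)) *
    (linVal Int.cast t.2 CoeffBound.polyPoint * (linVal Int.cast t.2 CoeffBound.polyPoint *
      (linVal Int.cast t.2 CoeffBound.polyPoint * (linVal Int.cast t.2 CoeffBound.polyPoint *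
      (linVal Int.cast t.1 CoeffBound.polyPoint * 1)))))) fun t ht => by
    have h0 := (hF' t ht).2
    have h1 : CoeffBound 0 1 1 := by simpa using CoeffBound.intCast (z := 1) (K := 1) (by simp)
    refine CoeffBound.intCast_mul (K := 1024) (((((h1.linVal_mul (hF' t ht).1).linVal_mul
      h0).linVal_mul h0).linVal_mul h0).linVal_mul h0) ?_
    split_ifs <;> simp
  refine (h1.add h2).mono ?_
  have e1 : ((formulaTerms F).length : ℤ) ≤ 16 := by exact_mod_cast hl
  have e2 : ((truncTerms F).length : ℤ) ≤ 16 := by exact_mod_cast hl'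
  norm_num [digitBase]
  linarith

theorem map_faceDefect {R S : Type} [CommRing R] [CommRing S] (φ : R →+* S) (F : Fin 8) (f : Fin 12)
    {w : R × R × R} {w' : S × S × S} (hw : ∀ c, φ (linVal Int.cast c w) = linVal Int.cast c w')
    (hs : ∀ l, φ (scaledSpline Int.cast (fun a b c => (leafVal f a b c : R)) w 5 l) =
      scaledSpline Int.cast (fun a b c => (leafVal f a b c : S)) w' 5 l) :
    φ (faceDefect F f w) = faceDefect F f w' := by
  simp only [faceDefect, map_add, map_list_sum, List.map_map, Function.comp_def, map_mul,
    map_intCast, hw, hs, map_one]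

theorem sum_faceDefect (F : Fin 8) :
    ∑ f : Fin 12, (digitBase ^ 36) ^ f.val * faceDefect F f codePoint = 0 := by
  have h := formula_code F
  have e1 : ∀ l, scaledSpline id leafCode codePoint 5 l = ∑ f : Fin 12, (digitBase ^ 36) ^ f.val *
      scaledSpline Int.cast (fun a b c => leafVal f a b c) codePoint 5 l := by
    intro l
    rw [show leafCode = fun a b c => ∑ f : Fin 12, (digitBase ^ 36) ^ f.val * leafVal f a b c from
      funext fun a => funext fun b => funext fun c => leafCode_eq a b c]
    exact scaledSpline_sum id codePoint Finset.univ _ _ 5 l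
  have swap : ∀ {α : Type} (l : List α) (g : α → Fin 12 → ℤ),
      ∑ f, (l.map fun t => g t f).sum = (l.map fun t => ∑ f, g t f).sum := by
    intro α l g
    induction l with
    | nil => simp
    | cons a l ih => simp [Finset.sum_add_distrib, ih]
  simp only [faceDefect, mul_add, Finset.sum_add_distrib, ← List.sum_map_mul_left, swap]
  rw [← sub_eq_zero, sub_eq_add_neg] at h
  refine Eq.trans ?_ h
  congr 1
  · congr 1
    refine List.map_congr_left fun t _ => ?_
    rw [e1, Finset.mul_sum]
    exact Finset.sum_congr rfl fun f _ => by simp only [Int.cast_id]; ring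
  · rw [← neg_mul, ← List.sum_map_mul_left]
    congr 1
    refine List.map_congr_left fun t _ => ?_
    rw [Finset.mul_sum, Finset.mul_sum]
    refine Finset.sum_congr rfl fun f _ => ?_
    have : ∀ c w, linVal (Int.cast : ℤ → ℤ) c w = linVal id c w := fun c w => rfl
    rw [this, this]
    split_ifs
    · simp only [Int.cast_id]
      ring
    · simp

/-- The code of all defects vanishes by `sum_faceDefect`. Since all integer coefficients are smaller
than the base, each of them vanishes, and with them the polynomial at real arguments. -/
theorem faceDefect_eq_zero (F : Fin 8) (f : Fin 12) (x y : ℝ) :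
    faceDefect F f (1 - x - y, x, y) = 0 := by
  have key : ∀ {S : Type} [CommRing S] (x y : S) (f : Fin 12),
      faceDefect F f (1 - x - y, x, y) = evalHom x y (faceDefect F f CoeffBound.polyPoint) := by
    intro S _ x y f
    exact (map_faceDefect _ F f (evalHom_polyPoint x y) (evalHom_scaledSpline x y _ 5)).symm
  let d : ℕ → ℕ → ℕ → ℤ := fun f j i =>
    if h : f < 12 then ((faceDefect F ⟨f, h⟩ CoeffBound.polyPoint).coeff j).coeff i else 0
  have hd : ∀ f j i, |d f j i| < digitBase := by
    intro f j i
    have hB : (0 : ℤ) < digitBase := by norm_num [digitBase]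
    dsimp only [d]
    split_ifs with h
    · have := (coeffBound_faceDefect F ⟨f, h⟩ i j).1
      omega
    · simpa using hB
  have h1 : ∀ f : Fin 12, faceDefect F f codePoint = ∑ j ∈ Finset.range 6,
      (∑ i ∈ Finset.range 6, d f j i * digitBase ^ i) * (digitBase ^ 6) ^ j := by
    intro f
    rw [show codePoint = (1 - digitBase - digitBase ^ 6, digitBase, digitBase ^ 6) from rfl, key,
      evalHom_eq_sum _ _ (coeffBound_faceDefect F f)]
    simp [d]
  have h2 : ∀ f j, |∑ i ∈ Finset.range 6, d f j i * digitBase ^ i| < digitBase ^ 6 :=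
    fun f j => abs_digits_lt 6 _ fun i _ => hd f j i
  have h3 : ∀ f, |∑ j ∈ Finset.range 6, (∑ i ∈ Finset.range 6, d f j i * digitBase ^ i) *
      (digitBase ^ 6) ^ j| < digitBase ^ 36 := by
    intro f
    have := abs_digits_lt 6 _ fun j _ => h2 f j
    rwa [← pow_mul] at this
  have hs := sum_faceDefect F
  simp only [h1] at hs
  rw [Fin.sum_univ_eq_sum_range fun f => (digitBase ^ 36) ^ f * ∑ j ∈ Finset.range 6,
      (∑ i ∈ Finset.range 6, d f j i * digitBase ^ i) * (digitBase ^ 6) ^ j] at hs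
  simp only [mul_comm ((digitBase ^ 36) ^ _)] at hs
  -- Three layers of decoding: base `digitBase ^ 36` separates the faces, base `digitBase ^ 6` the
  -- powers of `y`, and base `digitBase` the powers of `x`.
  have h4 := digits_eq_zero 12 _ (fun f _ => h3 f) hs f f.isLt
  have h5 := digits_eq_zero 6 _ (fun j _ => h2 f j) h4
  have h6 : ∀ j < 6, ∀ i < 6, d f j i = 0 := fun j hj =>
    digits_eq_zero 6 _ (fun i _ => hd f j i) (h5 j hj)
  rw [key, evalHom_eq_sum _ _ (coeffBound_faceDefect F f)]
  refine Finset.sum_eq_zero fun j hj => ?_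
  rw [Finset.sum_eq_zero, zero_mul]
  intro i hi
  have := h6 j (Finset.mem_range.1 hj) i (Finset.mem_range.1 hi)
  simp only [d, f.isLt, dif_pos, Fin.eta] at this
  rw [this, Int.cast_zero, zero_mul]

/-! ### The nodal functions as sums of truncated powers -/

/-- Barycentric coordinates as a triple. -/
noncomputable def baryVec (v : Fin 3 → Plane) (x : Plane) : ℝ × ℝ × ℝ :=
  (bary v x 0, bary v x 1, bary v x 2)

/-- The linear combination of simplex splines in one of the eight formulas. -/
noncomputable def nodalSpline (v : Fin 3 → Plane) (cell : Plane → Set Plane) (F : Fin 8)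
    (x : Plane) : ℝ :=
  ((formulaTerms F).map fun t => (t.1 : ℝ) * simplexSpline v cell (knotCount t.2) x).sum /
    formulaScale F

/-- A sum of truncated powers `q ℓ₊⁴`. -/
noncomputable def truncSum (v : Fin 3 → Plane) (F : Fin 8) (x : Plane) : ℝ :=
  ((truncTerms F).map fun t => linVal Int.cast t.1 (baryVec v x) *
    max (linVal Int.cast t.2 (baryVec v x)) 0 ^ 4).sum

theorem formulaScale_pos (F : Fin 8) : 0 < formulaScale F := by
  revert F
  decide

theorem linVal_sum (c : ℤ × ℤ × ℤ) (t : Fin 3 → ℝ) (p : Fin 3 → ℝ × ℝ × ℝ) :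
    linVal Int.cast c (∑ k, t k * (p k).1, ∑ k, t k * (p k).2.1, ∑ k, t k * (p k).2.2) =
      ∑ k, t k * linVal Int.cast c (p k) := by
  simp only [linVal, Fin.sum_univ_three]
  ring

theorem linVal_baryVec_of_mem_face {v : Fin 3 → Plane} (hv : Nondeg v) {f : Fin 12} {x : Plane}
    (hx : x ∈ face v f) : ∃ t : Fin 3 → ℝ, (∀ k, 0 ≤ t k) ∧ ∀ c, linVal Int.cast c (baryVec v x) =
      ∑ k, t k * (linVal id c (dozenCoord (faceVertex f k)) : ℤ) / 12 := by
  obtain ⟨t, h0, -, h⟩ := (mem_face_iff hv).1 hx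
  refine ⟨t, h0, fun c => ?_⟩
  rw [baryVec, h 0, h 1, h 2, linVal_sum c t fun k => ((splitCoord (faceVertex f k) 0 : ℝ),
    (splitCoord (faceVertex f k) 1 : ℝ), (splitCoord (faceVertex f k) 2 : ℝ))]
  refine Finset.sum_congr rfl fun k _ => ?_
  obtain ⟨h0, h1, h2⟩ := cast_splitCoord' (faceVertex f k)
  rw [h0, h1, h2]
  simp only [linVal, id]
  push_cast
  ring

/-- No line of the split passes through the interior of a face, so the sign of the sum over the
three vertices is the weak sign at each of them. -/
theorem lineForms_sign (f : Fin 12) : ∀ c ∈ lineForms,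
    if formActive f c then ∀ k, 0 ≤ linVal id c (dozenCoord (faceVertex f k))
    else ∀ k, linVal id c (dozenCoord (faceVertex f k)) ≤ 0 := by
  revert f
  decide +kernel

/-- On a face, a truncated power of one of the lines is a polynomial. -/
theorem max_linVal_of_mem_face {v : Fin 3 → Plane} (hv : Nondeg v) {f : Fin 12} {x : Plane}
    (hx : x ∈ face v f) {c : ℤ × ℤ × ℤ} (hc : c ∈ lineForms) :
    max (linVal Int.cast c (baryVec v x)) 0 =
      if formActive f c then linVal Int.cast c (baryVec v x) else 0 := by
  obtain ⟨t, h0, h⟩ := linVal_baryVec_of_mem_face hv hx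
  have hs := lineForms_sign f c hc
  split_ifs at hs ⊢ with ha
  · refine max_eq_left ?_
    rw [h c]
    refine Finset.sum_nonneg fun k _ => div_nonneg (mul_nonneg (h0 k) ?_) (by norm_num)
    exact_mod_cast hs k
  · refine max_eq_right ?_
    rw [h c]
    refine Finset.sum_nonpos fun k _ => div_nonpos_of_nonpos_of_nonneg
      (mul_nonpos_of_nonneg_of_nonpos (h0 k) ?_) (by norm_num)
    exact_mod_cast hs k

theorem truncTerms_mem {F : Fin 8} {t : (ℤ × ℤ × ℤ) × (ℤ × ℤ × ℤ)} (ht : t ∈ truncTerms F) :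
    t.2 ∈ lineForms :=
  (List.of_mem_zip ht).2

theorem simplexSpline_knotCount {v : Fin 3 → Plane} {cell : Plane → Set Plane} {F : Fin 8}
    {t : ℤ × List ℕ} (ht : t ∈ formulaTerms F) :
    simplexSpline v cell (knotCount t.2) = simplexSplineAux v cell 5 (knotCount t.2) := by
  have h : ∀ F, ∀ t ∈ formulaTerms F, ∑ j, knotCount t.2 j = 8 := by
    decide +kernel
  rw [simplexSpline, h F t ht]

/-- On the face assigned to `x` both sides are polynomials, and their difference is `faceDefect` up
to a constant factor. The right-hand side does not involve `cell`: the combination of simplex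
splines is independent of the assignment. -/
theorem nodalSpline_of_mem {v : Fin 3 → Plane} (hv : Nondeg v) {cell : Plane → Set Plane}
    (hcell : IsFaceAssignment v cell) (F : Fin 8) {x : Plane} (hx : x ∈ macroTriangle v) :
    nodalSpline v cell F x = truncSum v F x / formulaScale F := by
  obtain ⟨hxc, f, hf⟩ := hcell x hx
  rw [hf] at hxc
  have h := faceDefect_eq_zero F f (bary v x 1) (bary v x 2)
  have hs := sum_bary hv x
  rw [Fin.sum_univ_three] at hs
  rw [show 1 - bary v x 1 - bary v x 2 = bary v x 0 by linarith] at h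
  have h1 : ((formulaTerms F).map fun t => (t.1 : ℝ) * scaledSpline Int.cast
      (fun a b c => (leafVal f a b c : ℝ)) (bary v x 0, bary v x 1, bary v x 2) 5 t.2).sum =
      1024 * ((formulaTerms F).map fun t =>
        (t.1 : ℝ) * simplexSpline v cell (knotCount t.2) x).sum := by
    rw [← List.sum_map_mul_left]
    congr 1
    refine List.map_congr_left fun t ht => ?_
    obtain ⟨-, hp, h6, hl⟩ := (formulaTerms_bound F).2 t ht
    rw [simplexSpline_knotCount ht, ← pow_mul_simplexSplineAux hv hx hf 5 t.2 hp h6 hl]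
    ring
  have h2 : ((truncTerms F).map fun t => ((if formActive f t.2 then -1024 else 0 : ℤ) : ℝ) *
      (linVal Int.cast t.2 (baryVec v x) * (linVal Int.cast t.2 (baryVec v x) *
        (linVal Int.cast t.2 (baryVec v x) * (linVal Int.cast t.2 (baryVec v x) *
          (linVal Int.cast t.1 (baryVec v x) * 1)))))).sum = -1024 * truncSum v F x := by
    rw [truncSum, ← List.sum_map_mul_left]
    congr 1
    refine List.map_congr_left fun t ht => ?_
    rw [max_linVal_of_mem_face hv hxc (truncTerms_mem ht)]
    split_ifs
    · push_cast
      ring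
    · simp
  have h' : 1024 * ((formulaTerms F).map fun t =>
        (t.1 : ℝ) * simplexSpline v cell (knotCount t.2) x).sum + -1024 * truncSum v F x = 0 := by
    rw [← h1, ← h2]
    exact h
  rw [nodalSpline]
  congr 1
  linarith

theorem simplexSplineAux_of_notMem (v : Fin 3 → Plane) (cell : Plane → Set Plane) {x : Plane}
    (hx : x ∉ macroTriangle v) (n : ℕ) : ∀ m, simplexSplineAux v cell n m x = 0 := by
  induction n with
  | zero =>
    intro m
    have : x ∉ halfOpenHull v cell m := fun h => hx h.1
    simp [simplexSplineAux, this]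
  | succ n ih =>
    intro m
    simp [simplexSplineAux, ih]

theorem nodalSpline_of_notMem (v : Fin 3 → Plane) (cell : Plane → Set Plane) (F : Fin 8)
    {x : Plane} (hx : x ∉ macroTriangle v) : nodalSpline v cell F x = 0 := by
  simp [nodalSpline, simplexSpline, simplexSplineAux_of_notMem v cell hx]

/-! ### Smoothness -/

theorem hasDerivAt_max_pow (n : ℕ) (x : ℝ) :
    HasDerivAt (fun y : ℝ => max y 0 ^ (n + 2)) ((n + 2 : ℕ) * max x 0 ^ (n + 1)) x := by
  have hpos : ∀ y : ℝ, 0 ≤ y → max y 0 ^ (n + 2) = y ^ (n + 2) := fun y hy => by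
    rw [max_eq_left hy]
  have hneg : ∀ y : ℝ, y ≤ 0 → max y 0 ^ (n + 2) = 0 := fun y hy => by
    rw [max_eq_right hy, zero_pow (by omega)]
  rcases lt_trichotomy x 0 with hx | rfl | hx
  · rw [max_eq_right hx.le, zero_pow (by omega), mul_zero]
    refine (hasDerivAt_const x (0 : ℝ)).congr_of_eventuallyEq ?_
    filter_upwards [Iio_mem_nhds hx] with y hy using hneg y (le_of_lt hy)
  -- At the kink both one-sided derivatives are zero, because the exponent is at least two, and they
  -- glue to a derivative.
  · have h1 : HasDerivWithinAt (fun y : ℝ => max y 0 ^ (n + 2)) 0 (Set.Iic 0) 0 :=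
      (hasDerivWithinAt_const (0 : ℝ) _ (0 : ℝ)).congr (fun y hy => hneg y hy) (hneg 0 le_rfl)
    have h2 : HasDerivWithinAt (fun y : ℝ => max y 0 ^ (n + 2)) 0 (Set.Ici 0) 0 := by
      have := ((hasDerivAt_pow (n + 2) (0 : ℝ)).hasDerivWithinAt (s := Set.Ici 0)).congr
        (fun y hy => hpos y hy) (hpos 0 le_rfl)
      simpa using this
    have h3 := h1.union h2
    rw [Set.Iic_union_Ici, hasDerivWithinAt_univ] at h3
    simpa using h3
  · rw [max_eq_left hx.le]
    have := hasDerivAt_pow (n + 2) x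
    refine HasDerivAt.congr_of_eventuallyEq this ?_
    filter_upwards [Ioi_mem_nhds hx] with y hy using hpos y (le_of_lt hy)

theorem contDiff_max_pow (n : ℕ) : ContDiff ℝ n fun y : ℝ => max y 0 ^ (n + 1) := by
  induction n with
  | zero =>
    rw [Nat.cast_zero, contDiff_zero]
    fun_prop
  | succ n ih =>
    rw [Nat.cast_succ, contDiff_succ_iff_deriv]
    refine ⟨fun x => (hasDerivAt_max_pow n x).differentiableAt, by simp, ?_⟩
    have : deriv (fun y : ℝ => max y 0 ^ (n + 1 + 1)) =
        fun y => ((n + 2 : ℕ) : ℝ) * max y 0 ^ (n + 1) :=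
      funext fun x => (hasDerivAt_max_pow n x).deriv
    rw [this]
    exact contDiff_const.mul ih

/-- The derivative of a linear form in the barycentric coordinates. -/
theorem exists_linVal_baryVec (v : Fin 3 → Plane) (c : ℤ × ℤ × ℤ) :
    ∃ L : Plane →L[ℝ] ℝ, ∀ x, linVal Int.cast c (baryVec v x) =
      L x + linVal Int.cast c (baryVec v 0) := by
  refine ⟨(linVal Int.cast c (baryVec v (EuclideanSpace.single 0 1)) -
      linVal Int.cast c (baryVec v 0)) • EuclideanSpace.proj (0 : Fin 2) +
    (linVal Int.cast c (baryVec v (EuclideanSpace.single 1 1)) -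
      linVal Int.cast c (baryVec v 0)) • EuclideanSpace.proj (1 : Fin 2), fun x => ?_⟩
  rw [add_apply, smul_apply, smul_apply]
  change _ = _ • x 0 + _ • x 1 + _
  simp [linVal, baryVec, bary, orient]
  ring

theorem contDiff_linVal_baryVec (v : Fin 3 → Plane) (c : ℤ × ℤ × ℤ) (n : WithTop ℕ∞) :
    ContDiff ℝ n fun x => linVal Int.cast c (baryVec v x) := by
  obtain ⟨L, hL⟩ := exists_linVal_baryVec v c
  rw [funext hL]
  exact L.contDiff.add contDiff_const

theorem contDiff_truncSum (v : Fin 3 → Plane) (F : Fin 8) : ContDiff ℝ 3 (truncSum v F) := by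
  have : ∀ l : List ((ℤ × ℤ × ℤ) × (ℤ × ℤ × ℤ)), ContDiff ℝ 3 fun x =>
      (l.map fun t => linVal Int.cast t.1 (baryVec v x) *
        max (linVal Int.cast t.2 (baryVec v x)) 0 ^ 4).sum := by
    intro l
    induction l with
    | nil => exact contDiff_const
    | cons t l ih =>
      simp only [List.map_cons, List.sum_cons]
      exact ((contDiff_linVal_baryVec v _ _).mul
        ((contDiff_max_pow 3).comp (contDiff_linVal_baryVec v _ _))).add ih
  exact this _

/-- Linear forms in the barycentric coordinates as polynomials. -/
theorem exists_poly_linVal (v : Fin 3 → Plane) (c : ℤ × ℤ × ℤ) :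
    ∃ p : MvPolynomial (Fin 2) ℝ, p.totalDegree ≤ 1 ∧
      ∀ x : Plane, linVal Int.cast c (baryVec v x) = MvPolynomial.eval (fun k => x k) p := by
  open MvPolynomial in
  refine ⟨C (linVal Int.cast c (baryVec v (EuclideanSpace.single 0 1)) -
      linVal Int.cast c (baryVec v 0)) * X 0 +
    C (linVal Int.cast c (baryVec v (EuclideanSpace.single 1 1)) -
      linVal Int.cast c (baryVec v 0)) * X 1 + C (linVal Int.cast c (baryVec v 0)), ?_,
    fun x => ?_⟩
  · have h : ∀ (a : ℝ) (i : Fin 2), (C a * X i : MvPolynomial (Fin 2) ℝ).totalDegree ≤ 1 := by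
      intro a i
      refine (totalDegree_mul _ _).trans ?_
      rw [totalDegree_C, totalDegree_X]
    refine (totalDegree_add _ _).trans (max_le ((totalDegree_add _ _).trans (max_le ?_ ?_)) ?_)
    · exact h _ _
    · exact h _ _
    · rw [totalDegree_C]
      exact Nat.zero_le _
  · simp [linVal, baryVec, bary, orient]
    ring

theorem exists_poly_truncSum {v : Fin 3 → Plane} (hv : Nondeg v) (F : Fin 8) (f : Fin 12) :
    ∃ p : MvPolynomial (Fin 2) ℝ, p.totalDegree ≤ 5 ∧
      ∀ x ∈ face v f, truncSum v F x = MvPolynomial.eval (fun k => x k) p := by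
  have : ∀ l : List ((ℤ × ℤ × ℤ) × (ℤ × ℤ × ℤ)), (∀ t ∈ l, t.2 ∈ lineForms) →
      ∃ p : MvPolynomial (Fin 2) ℝ, p.totalDegree ≤ 5 ∧ ∀ x ∈ face v f,
        (l.map fun t => linVal Int.cast t.1 (baryVec v x) *
          max (linVal Int.cast t.2 (baryVec v x)) 0 ^ 4).sum =
          MvPolynomial.eval (fun k => x k) p := by
    intro l
    induction l with
    | nil => exact fun _ => ⟨0, by simp, by simp⟩
    | cons t l ih =>
      intro h
      obtain ⟨p, hp, e⟩ := ih fun t ht => h t (by simp [ht])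
      obtain ⟨q, hq, eq⟩ := exists_poly_linVal v t.1
      obtain ⟨r, hr, er⟩ := exists_poly_linVal v t.2
      refine ⟨(if formActive f t.2 then q * r ^ 4 else 0) + p, ?_, fun x hx => ?_⟩
      · refine (MvPolynomial.totalDegree_add _ _).trans (max_le ?_ hp)
        split_ifs
        · refine (MvPolynomial.totalDegree_mul _ _).trans ?_
          have := MvPolynomial.totalDegree_pow r 4
          omega
        · simp
      · rw [List.map_cons, List.sum_cons, e x hx, max_linVal_of_mem_face hv hx (h t (by simp)), eq,
          er, map_add]
        split_ifs <;> simp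
  exact this _ fun t ht => truncTerms_mem ht

theorem nodalSpline_mem {v : Fin 3 → Plane} (hv : Nondeg v) {cell : Plane → Set Plane}
    (hcell : IsFaceAssignment v cell) (F : Fin 8) : nodalSpline v cell F ∈ splineSpace v 3 5 := by
  refine ⟨fun x hx => nodalSpline_of_notMem v cell F hx, ?_, fun f => ?_⟩
  · exact ((contDiff_truncSum v F).div_const _).contDiffOn.congr
      fun x hx => nodalSpline_of_mem hv hcell F hx
  · obtain ⟨p, hp, e⟩ := exists_poly_truncSum hv F f
    refine ⟨(formulaScale F : ℝ)⁻¹ • p, (MvPolynomial.totalDegree_smul_le _ _).trans hp,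
      fun x hx => ?_⟩
    rw [nodalSpline_of_mem hv hcell F (face_subset hv f hx), e x hx, MvPolynomial.smul_eval]
    ring

/-! ### Derivatives of sums of truncated powers -/

/-- The vector `s (a₀ v₀ + a₁ v₁ + a₂ v₂)`. -/
noncomputable def dirVec (v : Fin 3 → Plane) (s : ℝ) (a : ℤ × ℤ × ℤ) : Plane :=
  s • ((a.1 : ℝ) • v 0 + (a.2.1 : ℝ) • v 1 + (a.2.2 : ℝ) • v 2)

/-- A linear form in barycentric coordinates is affine on the plane. Its derivative along a vector
whose coordinates sum to zero is a difference of two values, that is, the form evaluated at those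
coordinates. -/
theorem exists_hasFDerivAt_linVal {v : Fin 3 → Plane} (hv : Nondeg v) (c : ℤ × ℤ × ℤ) :
    ∃ L : Plane →L[ℝ] ℝ,
      (∀ x, HasFDerivAt (fun x => linVal Int.cast c (baryVec v x)) L x) ∧
      ∀ s a, a.1 + a.2.1 + a.2.2 = 0 → L (dirVec v s a) = s * (linVal id c a : ℤ) := by
  obtain ⟨L, hL⟩ := exists_linVal_baryVec v c
  refine ⟨L, fun x => ?_, fun s a ha => ?_⟩
  · rw [funext hL]
    exact L.hasFDerivAt.add_const _
  · have ha' : (a.1 : ℝ) + a.2.1 + a.2.2 = 0 := by exact_mod_cast ha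
    have e1 : v 0 + dirVec v s a =
        ∑ i, (![1 + s * a.1, s * a.2.1, s * a.2.2] : Fin 3 → ℝ) i • v i := by
      simp only [dirVec, Fin.sum_univ_three, Matrix.cons_val]
      module
    have e2 : v 0 = ∑ i, (![1, 0, 0] : Fin 3 → ℝ) i • v i := by
      simp [Fin.sum_univ_three]
    have h1 := bary_sum_smul hv ![1 + s * a.1, s * a.2.1, s * a.2.2] (by
      simp only [Fin.sum_univ_three, Matrix.cons_val]
      linear_combination s * ha')
    have h2 := bary_sum_smul hv ![1, 0, 0] (by simp [Fin.sum_univ_three])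
    rw [← e1] at h1
    rw [← e2] at h2
    have h3 := hL (v 0 + dirVec v s a)
    have h4 := hL (v 0)
    rw [map_add] at h3
    have h5 : L (dirVec v s a) = linVal Int.cast c (baryVec v (v 0 + dirVec v s a)) -
        linVal Int.cast c (baryVec v (v 0)) := by linarith
    rw [h5, baryVec, baryVec, h1, h2]
    simp only [linVal, Matrix.cons_val, id]
    push_cast
    ring

/-- The derivative of `q ℓ₊⁴` in the given directions is `c₀ q ℓ₊ᵐ + c₁ ℓ₊ᵐ⁺¹` for this
`(m, c₀, c₁)`. -/
def derivState (t : (ℤ × ℤ × ℤ) × (ℤ × ℤ × ℤ)) : List (ℤ × ℤ × ℤ) → ℕ × ℤ × ℤ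
  | [] => (4, 1, 0)
  | a :: ds =>
    match derivState t ds with
    | (m, c₀, c₁) =>
      (m - 1, c₀ * m * linVal id t.2 a, c₀ * linVal id t.1 a + c₁ * (m + 1 : ℕ) * linVal id t.2 a)

theorem derivState_fst (t : (ℤ × ℤ × ℤ) × (ℤ × ℤ × ℤ)) (ds : List (ℤ × ℤ × ℤ)) :
    (derivState t ds).1 = 4 - ds.length := by
  induction ds with
  | nil => rfl
  | cons a ds ih =>
    simp only [derivState, List.length_cons, ih]
    omega

/-- The derivative of a truncated power. -/
noncomputable def derivTerm (v : Fin 3 → Plane) (ds : List (ℤ × ℤ × ℤ))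
    (t : (ℤ × ℤ × ℤ) × (ℤ × ℤ × ℤ)) (x : Plane) : ℝ :=
  (derivState t ds).2.1 * (linVal Int.cast t.1 (baryVec v x) *
    max (linVal Int.cast t.2 (baryVec v x)) 0 ^ (derivState t ds).1) +
  (derivState t ds).2.2 * max (linVal Int.cast t.2 (baryVec v x)) 0 ^ ((derivState t ds).1 + 1)

theorem exists_hasFDerivAt_derivTerm {v : Fin 3 → Plane} (hv : Nondeg v) {ds : List (ℤ × ℤ × ℤ)}
    (hds : ds.length ≤ 2) (t : (ℤ × ℤ × ℤ) × (ℤ × ℤ × ℤ)) (x : Plane) :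
    ∃ L : Plane →L[ℝ] ℝ, HasFDerivAt (derivTerm v ds t) L x ∧
      ∀ s a, a.1 + a.2.1 + a.2.2 = 0 → L (dirVec v s a) = s * derivTerm v (a :: ds) t x := by
  obtain ⟨P, hP, hP'⟩ := exists_hasFDerivAt_linVal hv t.1
  obtain ⟨L, hL, hL'⟩ := exists_hasFDerivAt_linVal hv t.2
  -- After at most two derivatives the exponent is still at least two, so the term is differentiable
  -- on the line `ℓ = 0` as well.
  obtain ⟨n, hn⟩ : ∃ n, (derivState t ds).1 = n + 2 := ⟨2 - ds.length, by
    rw [derivState_fst]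
    omega⟩
  have h1 := (hasDerivAt_max_pow n (linVal Int.cast t.2 (baryVec v x))).comp_hasFDerivAt x (hL x)
  have h2 := (hasDerivAt_max_pow (n + 1) (linVal Int.cast t.2 (baryVec v x))).comp_hasFDerivAt x
    (hL x)
  have h3 := (((hP x).mul h1).const_mul ((derivState t ds).2.1 : ℝ)).add
    (h2.const_mul ((derivState t ds).2.2 : ℝ))
  refine ⟨_, h3.congr_of_eventuallyEq (Filter.Eventually.of_forall fun y => ?_), fun s a ha => ?_⟩
  · simp only [derivTerm, hn]
    rfl
  · simp only [add_apply, smul_apply, hP' s a ha, hL' s a ha, smul_eq_mul, derivTerm, derivState, hn,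
      Function.comp_apply]
    push_cast
    ring

/-- The derivative of a sum of truncated powers. -/
noncomputable def derivSum (v : Fin 3 → Plane) (F : Fin 8) (ds : List (ℤ × ℤ × ℤ)) (x : Plane) : ℝ :=
  ((truncTerms F).map fun t => derivTerm v ds t x).sum

theorem derivSum_nil (v : Fin 3 → Plane) (F : Fin 8) : derivSum v F [] = truncSum v F := by
  funext x
  simp [derivSum, truncSum, derivTerm, derivState]

theorem exists_hasFDerivAt_derivSum {v : Fin 3 → Plane} (hv : Nondeg v) (F : Fin 8)
    {ds : List (ℤ × ℤ × ℤ)} (hds : ds.length ≤ 2) (x : Plane) :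
    ∃ L : Plane →L[ℝ] ℝ, HasFDerivAt (derivSum v F ds) L x ∧
      ∀ s a, a.1 + a.2.1 + a.2.2 = 0 → L (dirVec v s a) = s * derivSum v F (a :: ds) x := by
  have : ∀ l : List ((ℤ × ℤ × ℤ) × (ℤ × ℤ × ℤ)), ∃ L : Plane →L[ℝ] ℝ,
      HasFDerivAt (fun x => (l.map fun t => derivTerm v ds t x).sum) L x ∧
      ∀ s a, a.1 + a.2.1 + a.2.2 = 0 →
        L (dirVec v s a) = s * (l.map fun t => derivTerm v (a :: ds) t x).sum := by
    intro l
    induction l with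
    | nil => exact ⟨0, hasFDerivAt_const _ _, by simp⟩
    | cons t l ih =>
      obtain ⟨L, hL, hL'⟩ := ih
      obtain ⟨K, hK, hK'⟩ := exists_hasFDerivAt_derivTerm hv hds t x
      refine ⟨K + L, ?_, fun s a ha => ?_⟩
      · simp only [List.map_cons, List.sum_cons]
        exact hK.add hL
      rw [add_apply, hK' s a ha, hL' s a ha, List.map_cons, List.sum_cons, mul_add]
  exact this _

/-- Iterated directional derivatives. -/
noncomputable def dirDerivs (v : Fin 3 → Plane) (s : ℝ) (ds : List (ℤ × ℤ × ℤ)) (g : Plane → ℝ) :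
    Plane → ℝ :=
  ds.foldr (fun a g => dirDeriv v (dirVec v s a) g) g

theorem dirDerivs_replicate_append (v : Fin 3 → Plane) (s : ℝ) (n : ℕ) (a : ℤ × ℤ × ℤ)
    (ds : List (ℤ × ℤ × ℤ)) (g : Plane → ℝ) :
    dirDerivs v s (List.replicate n a ++ ds) g =
      (dirDeriv v (dirVec v s a))^[n] (dirDerivs v s ds g) := by
  induction n with
  | zero => rfl
  | succ n ih =>
    rw [Function.iterate_succ_apply', ← ih]
    rfl

/-- Outside the triangle `g` need not agree with the truncated powers. Derivatives within the
triangle see only values on it, and they are unique because a nondegenerate triangle is convex with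
interior. -/
theorem dirDerivs_of_eqOn {v : Fin 3 → Plane} (hv : Nondeg v) (F : Fin 8) {g : Plane → ℝ} {N : ℝ}
    (hg : ∀ x ∈ macroTriangle v, g x = truncSum v F x / N) (s : ℝ) (ds : List (ℤ × ℤ × ℤ))
    (hds : ds.length ≤ 3) (h0 : ∀ a ∈ ds, a.1 + a.2.1 + a.2.2 = 0) :
    ∀ x ∈ macroTriangle v, dirDerivs v s ds g x = s ^ ds.length * derivSum v F ds x / N := by
  induction ds with
  | nil =>
    intro x hx
    rw [derivSum_nil, List.length_nil, pow_zero, one_mul]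
    exact hg x hx
  | cons a ds ih =>
    intro x hx
    rw [List.length_cons] at hds
    obtain ⟨L, hL, hL'⟩ := exists_hasFDerivAt_derivSum hv F (ds := ds) (by omega) x
    have ih' := ih (by omega) fun a ha => h0 a (by simp [ha])
    have h1 : HasFDerivWithinAt (dirDerivs v s ds g) ((s ^ ds.length / N) • L)
        (macroTriangle v) x := by
      refine ((hL.const_mul (s ^ ds.length / N)).hasFDerivWithinAt).congr (fun y hy => ?_) ?_
      · rw [ih' y hy]
        ring
      · rw [ih' x hx]
        ring
    change fderivWithin ℝ (dirDerivs v s ds g) (macroTriangle v) x (dirVec v s a) = _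
    rw [h1.fderivWithin (uniqueDiffOn_macroTriangle hv x hx), smul_apply,
      hL' s a (h0 a (by simp)), smul_eq_mul, List.length_cons, pow_succ]
    ring

/-- The scaled value of a derivative at a point with the given homogeneous coordinates. -/
def derivValue (F : Fin 8) (ds : List (ℤ × ℤ × ℤ)) (p : ℤ × ℤ × ℤ) : ℤ :=
  ((truncTerms F).map fun t =>
    match derivState t ds with
    | (m, c₀, c₁) => c₀ * (linVal id t.1 p * max (linVal id t.2 p) 0 ^ m) +
      c₁ * max (linVal id t.2 p) 0 ^ (m + 1)).sum

/-- After `k` derivatives every term is homogeneous of degree `5 - k` in the barycentric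
coordinates, and truncation commutes with positive scaling. Denominators can therefore be cleared,
leaving integer arithmetic. -/
theorem derivSum_eq_derivValue {v : Fin 3 → Plane} (F : Fin 8) (ds : List (ℤ × ℤ × ℤ))
    (hds : ds.length ≤ 3) {x : Plane} {p : ℤ × ℤ × ℤ} {D : ℝ} (hD : 0 < D)
    (hx : baryVec v x = (p.1 / D, p.2.1 / D, p.2.2 / D)) :
    derivSum v F ds x = derivValue F ds p / D ^ (5 - ds.length) := by
  have hl : ∀ c, linVal Int.cast c (baryVec v x) = (linVal id c p : ℤ) / D := by
    intro c
    rw [hx]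
    simp only [linVal, id]
    push_cast
    ring
  have hm : ∀ c, max (linVal Int.cast c (baryVec v x)) 0 =
      max ((linVal id c p : ℤ) : ℝ) 0 / D := by
    intro c
    rw [hl, ← max_div_div_right hD.le, zero_div]
  rw [derivSum, derivValue, eq_div_iff (pow_pos hD _).ne', ← List.sum_map_mul_right]
  push_cast
  rw [List.map_map]
  congr 1
  refine List.map_congr_left fun t _ => ?_
  have hst := derivState_fst t ds
  simp only [derivTerm, hm, Function.comp_apply]
  simp only [hl]
  generalize derivState t ds = st at hst ⊢
  obtain ⟨m, c₀, c₁⟩ := st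
  dsimp only at hst ⊢
  have h5 : 5 - ds.length = m + 1 := by omega
  rw [h5]
  push_cast
  generalize max ((linVal id t.2 p : ℤ) : ℝ) 0 = e
  rw [div_pow, div_pow]
  field_simp
  ring

/-! ### Duality -/

/-- The coordinates of a corner. -/
def unitCoord (a : Fin 3) : ℤ × ℤ × ℤ :=
  (if a = 0 then 1 else 0, if a = 1 then 1 else 0, if a = 2 then 1 else 0)

/-- The order of the derivatives at a corner to which a nodal function is dual. -/
def formulaOrder : Fin 8 → ℕ × ℕ :=
  ![(0, 0), (1, 0), (2, 0), (1, 1), (3, 0), (2, 1), (0, 0), (0, 0)]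

/-- The derivative at the corner `a` of order `i` towards `b` and `j` towards the third corner is the
one to which a nodal function is dual. -/
def VertexMatch (F : Fin 8) (a b : Fin 3) (i j : ℕ) : Prop :=
  F < 6 ∧ a = 0 ∧ (b = 1 ∧ (i, j) = formulaOrder F ∨ b = 2 ∧ (j, i) = formulaOrder F)

instance (F : Fin 8) (a b : Fin 3) (i j : ℕ) : Decidable (VertexMatch F a b i j) := by
  unfold VertexMatch
  infer_instance

/-- Duality at the corners: for every formula, the ten derivatives in each of the six frames are
computed exactly. -/
theorem derivValue_vertex (F : Fin 8) (a b c : Fin 3) (hab : a ≠ b) (hac : a ≠ c) (hbc : b ≠ c)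
    (i j : ℕ) (hij : i + j ≤ 3) :
    derivValue F (List.replicate i (unitCoord b - unitCoord a) ++
      (List.replicate j (unitCoord c - unitCoord a) ++ [])) (unitCoord a) =
      if VertexMatch F a b i j then formulaScale F else 0 := by
  have : ∀ (F : Fin 8) (a b c : Fin 3), a ≠ b → a ≠ c → b ≠ c → ∀ i < 4, ∀ j < 4 - i,
      derivValue F (List.replicate i (unitCoord b - unitCoord a) ++
        (List.replicate j (unitCoord c - unitCoord a) ++ [])) (unitCoord a) =
        if VertexMatch F a b i j then formulaScale F else 0 := by
    decide +kernel
  exact this F a b c hab hac hbc i (by omega) j (by omega)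

/-- The factor 256 is `2² · 4³`. Two derivatives are taken along twice the cross-boundary direction,
and the remaining homogeneity of degree three is evaluated at four times the quarterpoint. -/
theorem derivValue_quarter (F : Fin 8) (a b c : Fin 3) (hab : a ≠ b) (hac : a ≠ c) (hbc : b ≠ c) :
    derivValue F (List.replicate 2 (unitCoord c + unitCoord c - unitCoord a - unitCoord b) ++ [])
      (unitCoord a + unitCoord a + unitCoord a + unitCoord b) =
      if F = 6 ∧ a = 0 ∧ b = 1 then 256 * formulaScale F else 0 := by
  revert F a b c
  decide +kernel

/-- The factor 32 is `2 · 2⁴`, by the same count with one derivative and twice the midpoint. The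
edge enters only through its opposite corner, as the functional is symmetric in the endpoints. -/
theorem derivValue_mid (F : Fin 8) (a b c : Fin 3) (hab : a ≠ b) (hac : a ≠ c) (hbc : b ≠ c) :
    derivValue F (List.replicate 1 (unitCoord c + unitCoord c - unitCoord a - unitCoord b) ++ [])
      (unitCoord a + unitCoord b) = if F = 7 ∧ c = 2 then 32 * formulaScale F else 0 := by
  revert F a b c
  decide +kernel

/-- The functional to which a nodal function is dual, in the frame given by `σ`. -/
def nodalIndex (σ : Equiv.Perm (Fin 3)) : Fin 8 → NodalIndex :=
  ![vertexIndex σ 0 0, vertexIndex σ 1 0, vertexIndex σ 2 0, vertexIndex σ 1 1, vertexIndex σ 3 0,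
    vertexIndex σ 2 1, quarterIndex σ, midIndex σ]

/-- A faithful encoding of the labels of the functionals. -/
def NodalIndex.code : NodalIndex → ℕ × Fin 3 × ℕ × ℕ
  | .vertex k i j _ => (0, k, i, j)
  | .quarter₁ k => (1, k, 0, 0)
  | .mid k => (2, k, 0, 0)
  | .quarter₂ k => (3, k, 0, 0)

theorem NodalIndex.code_injective : Function.Injective NodalIndex.code := by
  intro l l' h
  cases l <;> cases l' <;> simp_all [NodalIndex.code]

/-- Two frames share the corner `σ 0`; exchanging the other two corners exchanges the orders `i` and
`j`, which accounts for the two alternatives in `VertexMatch`. Passing to codes makes this a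
decidable finite statement. -/
theorem vertex_eq_nodalIndex (σ : Equiv.Perm (Fin 3)) (F : Fin 8) (k : Fin 3) (i j : ℕ)
    (h : i + j ≤ 3) : NodalIndex.vertex k i j h = nodalIndex σ F ↔
      VertexMatch F (σ.symm k) (σ.symm (k + 1)) i j := by
  have : ∀ (σ : Equiv.Perm (Fin 3)) (F : Fin 8) (k : Fin 3), ∀ i < 4, ∀ j < 4,
      ((0, k, i, j) = (nodalIndex σ F).code ↔ VertexMatch F (σ.symm k) (σ.symm (k + 1)) i j) := by
    decide +kernel
  rw [← NodalIndex.code_injective.eq_iff]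
  exact this σ F k i (by omega) j (by omega)

theorem quarter₁_eq_nodalIndex (σ : Equiv.Perm (Fin 3)) (F : Fin 8) (k : Fin 3) :
    NodalIndex.quarter₁ k = nodalIndex σ F ↔ F = 6 ∧ σ.symm k = 0 ∧ σ.symm (k + 1) = 1 := by
  have : ∀ (σ : Equiv.Perm (Fin 3)) (F : Fin 8) (k : Fin 3),
      ((1, k, 0, 0) = (nodalIndex σ F).code ↔ F = 6 ∧ σ.symm k = 0 ∧ σ.symm (k + 1) = 1) := by
    decide +kernel
  rw [← NodalIndex.code_injective.eq_iff]
  exact this σ F k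

theorem quarter₂_eq_nodalIndex (σ : Equiv.Perm (Fin 3)) (F : Fin 8) (k : Fin 3) :
    NodalIndex.quarter₂ k = nodalIndex σ F ↔ F = 6 ∧ σ.symm (k + 1) = 0 ∧ σ.symm k = 1 := by
  have : ∀ (σ : Equiv.Perm (Fin 3)) (F : Fin 8) (k : Fin 3),
      ((3, k, 0, 0) = (nodalIndex σ F).code ↔ F = 6 ∧ σ.symm (k + 1) = 0 ∧ σ.symm k = 1) := by
    decide +kernel
  rw [← NodalIndex.code_injective.eq_iff]
  exact this σ F k

theorem mid_eq_nodalIndex (σ : Equiv.Perm (Fin 3)) (F : Fin 8) (k : Fin 3) :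
    NodalIndex.mid k = nodalIndex σ F ↔ F = 7 ∧ σ.symm (k + 2) = 2 := by
  have : ∀ (σ : Equiv.Perm (Fin 3)) (F : Fin 8) (k : Fin 3),
      ((2, k, 0, 0) = (nodalIndex σ F).code ↔ F = 7 ∧ σ.symm (k + 2) = 2) := by
    decide +kernel
  rw [← NodalIndex.code_injective.eq_iff]
  exact this σ F k

theorem dirVec_unitCoord_sub (v : Fin 3 → Plane) (a b : Fin 3) :
    dirVec v 1 (unitCoord b - unitCoord a) = v b - v a := by
  fin_cases a <;> fin_cases b <;> simp [dirVec, unitCoord] <;> abel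

theorem dirVec_cross (v : Fin 3 → Plane) (a b c : Fin 3) :
    dirVec v (1 / 2) (unitCoord c + unitCoord c - unitCoord a - unitCoord b) =
      v c - (1 / 2 : ℝ) • (v a + v b) := by
  have h : ∀ a : Fin 3, v a = ((unitCoord a).1 : ℝ) • v 0 + ((unitCoord a).2.1 : ℝ) • v 1 +
      ((unitCoord a).2.2 : ℝ) • v 2 := by
    intro a
    fin_cases a <;> simp [unitCoord]
  rw [h a, h b, h c, dirVec]
  simp only [Prod.fst_sub, Prod.fst_add, Prod.snd_sub, Prod.snd_add]
  push_cast
  module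

theorem unitCoord_sum (a : Fin 3) :
    (unitCoord a).1 + (unitCoord a).2.1 + (unitCoord a).2.2 = 1 := by
  revert a
  decide

theorem baryVec_combination {v : Fin 3 → Plane} (hv : Nondeg v) (p : ℤ × ℤ × ℤ) {D : ℝ}
    (hD : D ≠ 0) (hp : (p.1 : ℝ) + p.2.1 + p.2.2 = D) :
    baryVec v (D⁻¹ • ((p.1 : ℝ) • v 0 + (p.2.1 : ℝ) • v 1 + (p.2.2 : ℝ) • v 2)) =
      (p.1 / D, p.2.1 / D, p.2.2 / D) := by
  have h := bary_sum_smul hv ![p.1 / D, p.2.1 / D, p.2.2 / D] (by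
    simp only [Fin.sum_univ_three, Matrix.cons_val]
    rw [← hp] at hD ⊢
    field_simp)
  have e : D⁻¹ • ((p.1 : ℝ) • v 0 + (p.2.1 : ℝ) • v 1 + (p.2.2 : ℝ) • v 2) =
      ∑ i, (![p.1 / D, p.2.1 / D, p.2.2 / D] : Fin 3 → ℝ) i • v i := by
    simp only [Fin.sum_univ_three, Matrix.cons_val, div_eq_inv_mul]
    module
  rw [e, baryVec, h]
  rfl

theorem vertex_combination (v : Fin 3 → Plane) (a : Fin 3) :
    v a = ((unitCoord a).1 : ℝ) • v 0 + ((unitCoord a).2.1 : ℝ) • v 1 +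
      ((unitCoord a).2.2 : ℝ) • v 2 := by
  fin_cases a <;> simp [unitCoord]

/-- A derivative of a nodal function at a point of the triangle with the given coordinates. -/
theorem dirDerivs_nodalSpline {v : Fin 3 → Plane} (hv : Nondeg v) {cell : Plane → Set Plane}
    (hcell : IsFaceAssignment v cell) (F : Fin 8) (s : ℝ) (ds : List (ℤ × ℤ × ℤ))
    (hds : ds.length ≤ 3) (h0 : ∀ a ∈ ds, a.1 + a.2.1 + a.2.2 = 0) (p : ℤ × ℤ × ℤ) {D : ℝ}
    (hD : 0 < D) (hp : (p.1 : ℝ) + p.2.1 + p.2.2 = D) (hp0 : 0 ≤ p.1 ∧ 0 ≤ p.2.1 ∧ 0 ≤ p.2.2) :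
    dirDerivs v s ds (nodalSpline v cell F)
      (D⁻¹ • ((p.1 : ℝ) • v 0 + (p.2.1 : ℝ) • v 1 + (p.2.2 : ℝ) • v 2)) =
      s ^ ds.length * (derivValue F ds p / D ^ (5 - ds.length)) / formulaScale F := by
  have hb := baryVec_combination hv p hD.ne' hp
  rw [dirDerivs_of_eqOn hv F (fun x hx => nodalSpline_of_mem hv hcell F hx) s ds hds h0,
    derivSum_eq_derivValue F ds hds hD hb]
  rw [mem_macroTriangle hv]
  simp only [baryVec, Prod.mk.injEq] at hb
  have h1 : (0 : ℝ) ≤ p.1 := by exact_mod_cast hp0.1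
  have h2 : (0 : ℝ) ≤ p.2.1 := by exact_mod_cast hp0.2.1
  have h3 : (0 : ℝ) ≤ p.2.2 := by exact_mod_cast hp0.2.2
  simp only [Fin.forall_fin_succ, Fin.succ_zero_eq_one, Fin.succ_one_eq_two, IsEmpty.forall_iff,
    and_true, hb.1, hb.2.1, hb.2.2]
  refine ⟨?_, ?_, ?_⟩ <;> positivity

/-- All functionals are treated in a frame `(a, b, c)` of corner positions, so that a relabelling of
the triangle only permutes `a`, `b`, `c`. -/
theorem nodalFunctional_nodalSpline_aux {v : Fin 3 → Plane} (hv : Nondeg v)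
    {cell : Plane → Set Plane} (hcell : IsFaceAssignment v cell) (F : Fin 8) (a b c : Fin 3)
    (hab : a ≠ b) (hac : a ≠ c) (hbc : b ≠ c) :
    (∀ i j, i + j ≤ 3 → ((dirDeriv v (v b - v a))^[i] ((dirDeriv v (v c - v a))^[j]
      (nodalSpline v cell F))) (v a) = if VertexMatch F a b i j then 1 else 0) ∧
    ((dirDeriv v (v c - (1 / 2 : ℝ) • (v a + v b)))^[2] (nodalSpline v cell F))
      ((1 / 4 : ℝ) • ((3 : ℝ) • v a + v b)) = (if F = 6 ∧ a = 0 ∧ b = 1 then 1 else 0) ∧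
    dirDeriv v (v c - (1 / 2 : ℝ) • (v a + v b)) (nodalSpline v cell F)
      ((1 / 2 : ℝ) • (v a + v b)) = if F = 7 ∧ c = 2 then 1 else 0 := by
  have hN : (formulaScale F : ℝ) ≠ 0 := by exact_mod_cast (formulaScale_pos F).ne'
  have hu := unitCoord_sum
  have hu' : ∀ a, ((unitCoord a).1 : ℝ) + (unitCoord a).2.1 + (unitCoord a).2.2 = 1 := by
    intro a
    exact_mod_cast hu a
  have hnn : ∀ a, 0 ≤ (unitCoord a).1 ∧ 0 ≤ (unitCoord a).2.1 ∧ 0 ≤ (unitCoord a).2.2 := by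
    decide
  have hcr : (unitCoord c + unitCoord c - unitCoord a - unitCoord b).1 +
      (unitCoord c + unitCoord c - unitCoord a - unitCoord b).2.1 +
      (unitCoord c + unitCoord c - unitCoord a - unitCoord b).2.2 = 0 := by
    simp only [Prod.fst_sub, Prod.fst_add, Prod.snd_sub, Prod.snd_add]
    linarith [hu a, hu b, hu c]
  refine ⟨fun i j hij => ?_, ?_, ?_⟩
  · have h := dirDerivs_nodalSpline hv hcell F 1 (List.replicate i (unitCoord b - unitCoord a) ++
      (List.replicate j (unitCoord c - unitCoord a) ++ [])) (by simpa using hij) (by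
        intro d hd
        have : d = unitCoord b - unitCoord a ∨ d = unitCoord c - unitCoord a := by
          rcases List.mem_append.1 hd with hd | hd
          · exact Or.inl (List.eq_of_mem_replicate hd)
          · exact Or.inr (List.eq_of_mem_replicate (by simpa using hd))
        rcases this with rfl | rfl <;> simp only [Prod.fst_sub, Prod.snd_sub] <;>
          linarith [hu a, hu b, hu c]) (unitCoord a) one_pos (hu' a) (hnn a)
    rw [derivValue_vertex F a b c hab hac hbc i j hij, dirDerivs_replicate_append,
      dirDerivs_replicate_append, dirVec_unitCoord_sub, dirVec_unitCoord_sub, inv_one, one_smul,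
      ← vertex_combination] at h
    refine Eq.trans h ?_
    split_ifs <;> simp [hN]
  · have h := dirDerivs_nodalSpline hv hcell F (1 / 2)
      (List.replicate 2 (unitCoord c + unitCoord c - unitCoord a - unitCoord b) ++ []) (by simp)
      (fun d hd => by
        rw [List.append_nil] at hd
        rw [List.eq_of_mem_replicate hd]
        exact hcr) (unitCoord a + unitCoord a + unitCoord a + unitCoord b) (D := 4) (by norm_num)
      (by
        simp only [Prod.fst_add, Prod.snd_add]
        push_cast
        linarith [hu' a, hu' b])
      (by
        simp only [Prod.fst_add, Prod.snd_add]
        have := hnn a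
        have := hnn b
        omega)
    rw [derivValue_quarter F a b c hab hac hbc, dirDerivs_replicate_append, dirVec_cross] at h
    have e : (4 : ℝ)⁻¹ • (((unitCoord a + unitCoord a + unitCoord a + unitCoord b).1 : ℝ) • v 0 +
        ((unitCoord a + unitCoord a + unitCoord a + unitCoord b).2.1 : ℝ) • v 1 +
        ((unitCoord a + unitCoord a + unitCoord a + unitCoord b).2.2 : ℝ) • v 2) =
        (1 / 4 : ℝ) • ((3 : ℝ) • v a + v b) := by
      rw [vertex_combination v a, vertex_combination v b]
      simp only [Prod.fst_add, Prod.snd_add]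
      push_cast
      module
    rw [e] at h
    refine Eq.trans h ?_
    split_ifs
    · simp
      field_simp
      norm_num
    · simp
  · have h := dirDerivs_nodalSpline hv hcell F (1 / 2)
      (List.replicate 1 (unitCoord c + unitCoord c - unitCoord a - unitCoord b) ++ []) (by simp)
      (fun d hd => by
        rw [List.append_nil] at hd
        rw [List.eq_of_mem_replicate hd]
        exact hcr) (unitCoord a + unitCoord b) (D := 2) (by norm_num)
      (by
        simp only [Prod.fst_add, Prod.snd_add]
        push_cast
        linarith [hu' a, hu' b])
      (by
        simp only [Prod.fst_add, Prod.snd_add]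
        have := hnn a
        have := hnn b
        omega)
    rw [derivValue_mid F a b c hab hac hbc, dirDerivs_replicate_append, dirVec_cross] at h
    have e : (2 : ℝ)⁻¹ • (((unitCoord a + unitCoord b).1 : ℝ) • v 0 +
        ((unitCoord a + unitCoord b).2.1 : ℝ) • v 1 +
        ((unitCoord a + unitCoord b).2.2 : ℝ) • v 2) = (1 / 2 : ℝ) • (v a + v b) := by
      rw [vertex_combination v a, vertex_combination v b]
      simp only [Prod.fst_add, Prod.snd_add]
      push_cast
      module
    rw [e] at h
    refine Eq.trans h ?_
    split_ifs
    · simp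
      field_simp
      norm_num
    · simp

/-! ### Relabelling the corners -/

theorem macroTriangle_perm (v : Fin 3 → Plane) (σ : Equiv.Perm (Fin 3)) :
    macroTriangle (fun k => v (σ k)) = macroTriangle v := by
  rw [macroTriangle, macroTriangle]
  congr 1
  exact σ.surjective.range_comp v

theorem dirDeriv_perm (v : Fin 3 → Plane) (σ : Equiv.Perm (Fin 3)) :
    dirDeriv (fun k => v (σ k)) = dirDeriv v := by
  funext u g x
  rw [dirDeriv, dirDeriv, macroTriangle_perm]

theorem nondeg_perm {v : Fin 3 → Plane} (hv : AffineIndependent ℝ v) (σ : Equiv.Perm (Fin 3)) :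
    Nondeg fun k => v (σ k) :=
  nondeg_of_affineIndependent (hv.comp_embedding σ.toEmbedding)

theorem splitPoint_perm (v : Fin 3 → Plane) (σ : Equiv.Perm (Fin 3)) (j : Fin 10) :
    splitPoint (fun k => v (σ k)) j = ∑ k, (splitCoord j (σ.symm k) : ℝ) • v k := by
  refine Eq.trans ?_ (Equiv.sum_comp σ fun k => (splitCoord j (σ.symm k) : ℝ) • v k)
  simp [splitPoint]

/-- The split has the full symmetry of the triangle. Within each face the vertices are listed by
type, so a relabelling matches them in the given order. -/
theorem exists_face_perm (v : Fin 3 → Plane) (σ : Equiv.Perm (Fin 3)) (f : Fin 12) :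
    ∃ f', face v f = face (fun k => v (σ k)) f' := by
  have h : ∀ (σ : Equiv.Perm (Fin 3)) (f : Fin 12), ∃ f' : Fin 12, ∀ k,
      (∀ i, splitCoord (faceVertex f' k) (σ.symm i) = splitCoord (faceVertex f k) i) := by
    decide +kernel
  obtain ⟨f', h⟩ := h σ f
  refine ⟨f', ?_⟩
  rw [face, face]
  congr 2
  funext k
  rw [splitPoint_perm, splitPoint]
  simp only [h k]

theorem isFaceAssignment_perm {v : Fin 3 → Plane} {cell : Plane → Set Plane}
    (hcell : IsFaceAssignment v cell) (σ : Equiv.Perm (Fin 3)) :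
    IsFaceAssignment (fun k => v (σ k)) cell := by
  intro x hx
  rw [macroTriangle_perm] at hx
  obtain ⟨h, f, hf⟩ := hcell x hx
  obtain ⟨f', hf'⟩ := exists_face_perm v σ f
  exact ⟨h, f', hf.trans hf'⟩

theorem splineSpace_perm (v : Fin 3 → Plane) (σ : Equiv.Perm (Fin 3)) {g : Plane → ℝ}
    (hg : g ∈ splineSpace (fun k => v (σ k)) 3 5) : g ∈ splineSpace v 3 5 := by
  obtain ⟨h1, h2, h3⟩ := hg
  rw [macroTriangle_perm] at h1 h2
  refine ⟨h1, h2, fun f => ?_⟩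
  obtain ⟨f', hf'⟩ := exists_face_perm v σ f
  rw [hf']
  exact h3 f'

open Classical in
/-- The nodal functions are dual to the functionals. -/
theorem nodalFunctional_nodalSpline {v : Fin 3 → Plane} (hv : AffineIndependent ℝ v)
    {cell : Plane → Set Plane} (hcell : IsFaceAssignment v cell) (σ : Equiv.Perm (Fin 3))
    (F : Fin 8) (l : NodalIndex) :
    nodalFunctional v l (nodalSpline (fun k => v (σ k)) cell F) =
      if l = nodalIndex σ F then 1 else 0 := by
  have hne : ∀ k : Fin 3, k ≠ k + 1 ∧ k ≠ k + 2 ∧ k + 1 ≠ k + 2 := by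
    decide
  have inj := σ.symm.injective
  have aux := nodalFunctional_nodalSpline_aux (nondeg_perm hv σ) (isFaceAssignment_perm hcell σ) F
  simp only [dirDeriv_perm] at aux
  cases l with
  | vertex k i j h =>
    obtain ⟨h1, h2, h3⟩ := hne k
    have := (aux (σ.symm k) (σ.symm (k + 1)) (σ.symm (k + 2)) (inj.ne h1) (inj.ne h2)
      (inj.ne h3)).1 i j h
    simp only [Equiv.apply_symm_apply] at this
    simp only [nodalFunctional, vertex_eq_nodalIndex]
    exact this
  | quarter₁ k =>
    obtain ⟨h1, h2, h3⟩ := hne k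
    have := (aux (σ.symm k) (σ.symm (k + 1)) (σ.symm (k + 2)) (inj.ne h1) (inj.ne h2)
      (inj.ne h3)).2.1
    simp only [Equiv.apply_symm_apply] at this
    simp only [nodalFunctional, quarter₁_eq_nodalIndex]
    exact this
  | mid k =>
    obtain ⟨h1, h2, h3⟩ := hne k
    have := (aux (σ.symm k) (σ.symm (k + 1)) (σ.symm (k + 2)) (inj.ne h1) (inj.ne h2)
      (inj.ne h3)).2.2
    simp only [Equiv.apply_symm_apply] at this
    simp only [nodalFunctional, mid_eq_nodalIndex]
    exact this
  | quarter₂ k =>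
    obtain ⟨h1, h2, h3⟩ := hne k
    -- The second quarterpoint is the first one after exchanging the endpoints of the edge.
    have := (aux (σ.symm (k + 1)) (σ.symm k) (σ.symm (k + 2)) (inj.ne h1.symm) (inj.ne h3)
      (inj.ne h2)).2.1
    simp only [Equiv.apply_symm_apply] at this
    simp only [nodalFunctional, quarter₂_eq_nodalIndex, crossDir]
    rw [add_comm (v (k + 1)) (v k), add_comm ((3 : ℝ) • v (k + 1)) (v k)] at this
    exact this

/-! ### Derivatives of splines on the faces -/

section Lines
open Polynomial

/-- The derivative of a bivariate polynomial in direction `u`. -/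
noncomputable def polyDeriv (u : Plane) :
    Derivation ℝ (MvPolynomial (Fin 2) ℝ) (MvPolynomial (Fin 2) ℝ) :=
  MvPolynomial.mkDerivation ℝ fun k => MvPolynomial.C (u k)

theorem exists_hasFDerivAt_eval (p : MvPolynomial (Fin 2) ℝ) (x : Plane) :
    ∃ L : Plane →L[ℝ] ℝ, HasFDerivAt (fun y : Plane => MvPolynomial.eval (fun k => y k) p) L x ∧
      ∀ u, L u = MvPolynomial.eval (fun k => x k) (polyDeriv u p) := by
  induction p using MvPolynomial.induction_on with
  | C a =>
    refine ⟨0, ?_, fun u => ?_⟩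
    · simp only [MvPolynomial.eval_C]
      exact hasFDerivAt_const _ _
    · simp [polyDeriv]
  | add p q hp hq =>
    obtain ⟨L, h, e⟩ := hp
    obtain ⟨K, h', e'⟩ := hq
    refine ⟨L + K, ?_, fun u => ?_⟩
    · simp only [map_add]
      exact h.add h'
    · rw [add_apply, e, e', map_add, map_add]
  | mul_X p k hp =>
    obtain ⟨L, h, e⟩ := hp
    have h3 := h.mul (EuclideanSpace.proj (𝕜 := ℝ) k).hasFDerivAt
    refine ⟨_, h3.congr_of_eventuallyEq (Filter.Eventually.of_forall fun y => ?_), fun u => ?_⟩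
    · simp
    · rw [add_apply, smul_apply, smul_apply, e, Derivation.leibniz]
      simp [polyDeriv]

/-- A closed face has unique derivatives at all of its points, edges included. There the derivative
within the triangle must be that of the polynomial piece, so pieces sharing an edge have equal
derivatives along it. -/
theorem dirDeriv_eq_on_face {v : Fin 3 → Plane} (hv : Nondeg v) {g : Plane → ℝ} {n : ℕ}
    (hg : ContDiffOn ℝ (n + 1 : ℕ) g (macroTriangle v)) (u : Plane) :
    ContDiffOn ℝ n (dirDeriv v u g) (macroTriangle v) ∧
    ∀ (f : Fin 12) (p : MvPolynomial (Fin 2) ℝ),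
      (∀ x ∈ face v f, g x = MvPolynomial.eval (fun k => x k) p) →
      ∀ x ∈ face v f, dirDeriv v u g x = MvPolynomial.eval (fun k => x k) (polyDeriv u p) := by
  have hu := uniqueDiffOn_macroTriangle hv
  refine ⟨?_, fun f p hp x hx => ?_⟩
  · have h := hg.fderivWithin (m := n) hu (by norm_cast)
    exact h.clm_apply contDiffOn_const
  · have hx' := face_subset hv f hx
    have h1 := ((hg.differentiableOn (by simp)) x hx').hasFDerivWithinAt.mono (face_subset hv f)
    obtain ⟨L, hL, e⟩ := exists_hasFDerivAt_eval p x
    have h2 := hL.hasFDerivWithinAt.congr (s := face v f) hp (hp x hx)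
    rw [dirDeriv, (uniqueDiffOn_face hv f x hx).eq h1 h2, e]

theorem iterate_dirDeriv_eq_on_face {v : Fin 3 → Plane} (hv : Nondeg v) {g : Plane → ℝ} {m : ℕ}
    (hg : ContDiffOn ℝ m g (macroTriangle v)) (u : Plane) (j n : ℕ) (hj : n + j = m) :
    ContDiffOn ℝ n ((dirDeriv v u)^[j] g) (macroTriangle v) ∧
    ∀ (f : Fin 12) (p : MvPolynomial (Fin 2) ℝ),
      (∀ x ∈ face v f, g x = MvPolynomial.eval (fun k => x k) p) →
      ∀ x ∈ face v f, (dirDeriv v u)^[j] g x =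
        MvPolynomial.eval (fun k => x k) ((polyDeriv u)^[j] p) := by
  induction j generalizing n with
  | zero =>
    subst hj
    exact ⟨hg, fun f p hp => hp⟩
  | succ j ih =>
    obtain ⟨h1, h2⟩ := ih (n + 1) (by omega)
    obtain ⟨h3, h4⟩ := dirDeriv_eq_on_face hv h1 u
    simp only [Function.iterate_succ_apply']
    exact ⟨h3, fun f p hp => h4 f _ (h2 f p hp)⟩

/-! ### Bivariate polynomials vanishing to high order on a line -/

/-- The substitution of `A + α u + β d` into a bivariate polynomial, as a polynomial in `α` with
coefficients in `ℝ[β]`. -/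
noncomputable def lineSubst (A d u : Plane) : MvPolynomial (Fin 2) ℝ →ₐ[ℝ] ℝ[X][X] :=
  MvPolynomial.aeval fun k => C (C (A k) + C (d k) * X) + C (C (u k)) * X

theorem eval_lineSubst (A d u : Plane) (p : MvPolynomial (Fin 2) ℝ) (α β : ℝ) :
    ((lineSubst A d u p).eval (C α)).eval β =
      MvPolynomial.eval (fun k => A k + α * u k + β * d k) p := by
  induction p using MvPolynomial.induction_on with
  | C a =>
    simp [lineSubst, MvPolynomial.algHom_C, Polynomial.algebraMap_apply]
  | add p q hp hq => simp [hp, hq]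
  | mul_X p k hp =>
    rw [map_mul, eval_mul, eval_mul, hp, map_mul, MvPolynomial.eval_X]
    congr 1
    simp [lineSubst]
    ring

/-- Differentiation in `α` is differentiation in the transversal direction `u`, so the coefficients
in `α` are the transversal Taylor coefficients along the line. -/
theorem derivative_lineSubst (A d u : Plane) (p : MvPolynomial (Fin 2) ℝ) :
    derivative (lineSubst A d u p) = lineSubst A d u (polyDeriv u p) := by
  induction p using MvPolynomial.induction_on with
  | C a => simp [lineSubst, MvPolynomial.algHom_C, Polynomial.algebraMap_apply, polyDeriv]
  | add p q hp hq => simp [hp, hq]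
  | mul_X p k hp =>
    rw [map_mul, derivative_mul, hp, Derivation.leibniz]
    simp [lineSubst, polyDeriv, MvPolynomial.algHom_C, Polynomial.algebraMap_apply]
    ring

/-- A polynomial in two variables has total degree at most `n`. -/
def TotalDegreeLE (n : ℕ) (r : ℝ[X][X]) : Prop := ∀ i j, n < i + j → (r.coeff i).coeff j = 0

theorem TotalDegreeLE.mul {m n : ℕ} {r s : ℝ[X][X]} (hr : TotalDegreeLE m r)
    (hs : TotalDegreeLE n s) : TotalDegreeLE (m + n) (r * s) := by
  intro i j hij
  rw [coeff_mul, finsetSum_coeff]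
  refine Finset.sum_eq_zero fun a ha => ?_
  rw [coeff_mul]
  refine Finset.sum_eq_zero fun b hb => ?_
  have ha := Finset.HasAntidiagonal.mem_antidiagonal.1 ha
  have hb := Finset.HasAntidiagonal.mem_antidiagonal.1 hb
  by_cases h : m < a.1 + b.1
  · rw [hr _ _ h, zero_mul]
  · rw [hs a.2 b.2 (by omega), mul_zero]

theorem totalDegreeLE_C (a : ℝ) : TotalDegreeLE 0 (C (C a)) := by
  intro i j hij
  rw [coeff_C]
  split_ifs with h
  · rw [coeff_C, if_neg (by omega)]
  · simp

theorem totalDegreeLE_lineSubst (A d u : Plane) {n : ℕ} {p : MvPolynomial (Fin 2) ℝ}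
    (hp : p.totalDegree ≤ n) : TotalDegreeLE n (lineSubst A d u p) := by
  have hX : ∀ k, TotalDegreeLE 1 (lineSubst A d u (MvPolynomial.X k)) := by
    intro k i j hij
    simp only [lineSubst, MvPolynomial.aeval_X, coeff_add, coeff_C, coeff_C_mul, coeff_X]
    rcases Nat.lt_trichotomy i 1 with h | h | h
    · have hi : i = 0 := by omega
      subst hi
      have : j ≠ 0 := by omega
      have : 1 ≠ j := by omega
      simp [coeff_C, coeff_X, *]
    · subst h
      have : j ≠ 0 := by omega
      simp [coeff_one, this]
    · have h0 : i ≠ 0 := by omega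
      have h1 : 1 ≠ i := by omega
      simp [h0, h1]
  have hpow : ∀ k m, TotalDegreeLE m (lineSubst A d u (MvPolynomial.X k) ^ m) := by
    intro k m
    induction m with
    | zero => simpa using totalDegreeLE_C 1
    | succ m ih =>
      rw [pow_succ]
      exact ih.mul (hX k)
  rw [MvPolynomial.as_sum p, map_sum]
  intro i j hij
  rw [finsetSum_coeff, finsetSum_coeff]
  refine Finset.sum_eq_zero fun s hs => ?_
  have hs' : s 0 + s 1 ≤ n := by
    have := (MvPolynomial.le_totalDegree hs).trans hp
    rwa [Finsupp.sum_fintype _ _ (fun _ => rfl), Fin.sum_univ_two] at this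
  have e : lineSubst A d u (MvPolynomial.monomial s (MvPolynomial.coeff s p)) =
      C (C (MvPolynomial.coeff s p)) * (lineSubst A d u (MvPolynomial.X 0) ^ s 0 *
        lineSubst A d u (MvPolynomial.X 1) ^ s 1) := by
    rw [MvPolynomial.monomial_eq, map_mul, Finsupp.prod_fintype _ _ (fun _ => pow_zero _),
      Fin.prod_univ_two, map_mul, map_pow, map_pow, MvPolynomial.algHom_C]
    rfl
  rw [e]
  exact ((totalDegreeLE_C _).mul ((hpow 0 _).mul (hpow 1 _))) i j (by omega)

/-- A polynomial of degree five that vanishes to third order on a line is a multiple of the fourth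
power of its equation. -/
theorem exists_eval_eq_pow_mul (A d u : Plane) {q : MvPolynomial (Fin 2) ℝ} (hq : q.totalDegree ≤ 5)
    {S : Set ℝ} (hS : S.Infinite) (h : ∀ j < 4, ∀ β ∈ S,
      MvPolynomial.eval (fun k => A k + β * d k) ((polyDeriv u)^[j] q) = 0) :
    ∃ c₀ c₁ c₂ : ℝ, ∀ α β : ℝ, MvPolynomial.eval (fun k => A k + α * u k + β * d k) q =
      α ^ 4 * (c₀ + c₁ * α + c₂ * β) := by
  set r := lineSubst A d u q with hr
  have hdeg : TotalDegreeLE 5 r := totalDegreeLE_lineSubst A d u hq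
  have hder : ∀ j, derivative^[j] r = lineSubst A d u ((polyDeriv u)^[j] q) := by
    intro j
    induction j with
    | zero => rfl
    | succ j ih => rw [Function.iterate_succ_apply', ih, derivative_lineSubst,
        Function.iterate_succ_apply']
  -- Up to the factor `j!`, the coefficient of `α ^ j` is the `j`-th transversal derivative along
  -- the line. As a polynomial in `β` it has infinitely many zeros.
  have hz : ∀ j < 4, r.coeff j = 0 := by
    intro j hj
    refine eq_zero_of_infinite_isRoot _ (hS.mono fun β hβ => ?_)
    have h1 := h j hj β hβ
    have h2 := eval_lineSubst A d u ((polyDeriv u)^[j] q) 0 β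
    simp only [zero_mul, add_zero] at h2
    rw [h1, ← hder, C_0, ← coeff_zero_eq_eval_zero, coeff_iterate_derivative, zero_add,
      Nat.descFactorial_self, nsmul_eq_mul, eval_mul, eval_natCast] at h2
    exact (mul_eq_zero.1 h2).resolve_left (by exact_mod_cast j.factorial_ne_zero)
  have hnat : r.natDegree < 6 := by
    rw [Nat.lt_succ_iff, natDegree_le_iff_coeff_eq_zero]
    intro i hi
    ext j
    rw [hdeg i j (by omega), coeff_zero]
  -- Total degree at most five leaves a linear polynomial in `β` at `α⁴` and a constant at `α⁵`.
  have h4 : (r.coeff 4).natDegree < 2 := by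
    rw [Nat.lt_succ_iff, natDegree_le_iff_coeff_eq_zero]
    exact fun j hj => hdeg 4 j (by omega)
  have h5 : (r.coeff 5).natDegree < 1 := by
    rw [Nat.lt_succ_iff, natDegree_le_iff_coeff_eq_zero]
    exact fun j hj => hdeg 5 j (by omega)
  refine ⟨(r.coeff 4).coeff 0, (r.coeff 5).coeff 0, (r.coeff 4).coeff 1, fun α β => ?_⟩
  rw [← eval_lineSubst, ← hr, eval_eq_sum_range' hnat]
  simp only [Finset.sum_range_succ, Finset.sum_range_zero, hz 0 (by norm_num), hz 1 (by norm_num),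
    hz 2 (by norm_num), hz 3 (by norm_num), zero_mul, add_zero, zero_add, eval_add, eval_mul,
    eval_pow, eval_C]
  rw [eval_eq_sum_range' h4, eval_eq_sum_range' h5]
  simp only [Finset.sum_range_succ, Finset.sum_range_zero]
  ring

end Lines

/-! ### The difference of two neighbouring pieces of a spline -/

theorem orient_sum_smul_left (v : Fin 3 → Plane) (w : Fin 3 → ℝ) (hw : ∑ i, w i = 1)
    (B C : Plane) : orient (∑ i, w i • v i) B C = ∑ i, w i * orient (v i) B C := by
  rw [Fin.sum_univ_three] at hw
  have h0 : w 0 = 1 - w 1 - w 2 := by linarith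
  simp only [orient, Fin.sum_univ_three, PiLp.add_apply, PiLp.smul_apply, smul_eq_mul, h0]
  ring

/-- Barycentric coordinates with respect to one triangle are affine functions of those with
respect to another. -/
theorem bary_eq_sum {v : Fin 3 → Plane} (hv : Nondeg v) (p : Fin 3 → Plane) (x : Plane)
    (j : Fin 3) : bary p x j = ∑ i, bary v x i * bary p (v i) j := by
  have hs := sum_bary hv x
  have rot : ∀ a b c : Plane, orient a b c = orient b c a := by
    intro a b c
    simp only [orient]
    ring
  have h := orient_sum_smul_left v (bary v x) hs
  rw [sum_bary_smul hv x] at h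
  generalize bary v x = w at h
  fin_cases j
  · simp only [bary, Matrix.cons_val, Fin.zero_eta, h, ← mul_div_assoc, Finset.sum_div]
  · simp only [Fin.mk_one, bary, Matrix.cons_val]
    simp only [rot (p 0) _ (p 2), h, ← mul_div_assoc, Finset.sum_div]
  · simp only [Fin.reduceFinMk, bary, Matrix.cons_val]
    simp only [← rot _ (p 0) (p 1), h, ← mul_div_assoc, Finset.sum_div]

theorem linVal_baryVec_sum (v : Fin 3 → Plane) {p : Fin 3 → Plane} (hp : Nondeg p)
    (c : ℤ × ℤ × ℤ) (x : Plane) :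
    linVal Int.cast c (baryVec v x) = ∑ k, bary p x k * linVal Int.cast c (baryVec v (p k)) := by
  rw [← linVal_sum]
  rw [baryVec, bary_eq_sum hp, bary_eq_sum hp, bary_eq_sum hp]
  rfl

theorem linVal_baryVec_splitPoint {v : Fin 3 → Plane} (hv : Nondeg v) (c : ℤ × ℤ × ℤ) (j : Fin 10) :
    linVal Int.cast c (baryVec v (splitPoint v j)) = (linVal id c (dozenCoord j) : ℤ) / (12 : ℝ) := by
  obtain ⟨h0, h1, h2⟩ := cast_splitCoord' j
  rw [baryVec, bary_splitPoint hv]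
  simp only [h0, h1, h2, linVal, id]
  push_cast
  ring

/-- `P` and `Q` span a common edge of the faces `f` and `g` on the line with equation `c`. -/
def IsCommonEdge (f g : Fin 12) (P Q : Fin 10) (c : ℤ × ℤ × ℤ) : Prop :=
  (∃ k, faceVertex f k = P) ∧ (∃ k, faceVertex f k = Q) ∧ (∃ k, faceVertex g k = P) ∧
    (∃ k, faceVertex g k = Q) ∧ linVal id c (dozenCoord P) = 0 ∧ linVal id c (dozenCoord Q) = 0 ∧
    ∃ R : Fin 10, linVal id c (dozenCoord R) ≠ 0 ∧
      det3 (splitCoord P) (splitCoord Q) (splitCoord R) ≠ 0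

instance (f g : Fin 12) (P Q : Fin 10) (c : ℤ × ℤ × ℤ) : Decidable (IsCommonEdge f g P Q c) := by
  unfold IsCommonEdge
  infer_instance

/-- The derivatives of order at most three of both pieces agree along the common edge, so the
difference is divisible by `ℓ⁴`, and degree five leaves an affine cofactor. The factorization is
carried out in the coordinates of the triangle `P, Q, R`, where `R` is any vertex of the split off
the line. -/
theorem exists_eval_sub_eq {v : Fin 3 → Plane} (hv : Nondeg v) {s : Plane → ℝ}
    (hs : ContDiffOn ℝ 3 s (macroTriangle v)) {p : Fin 12 → MvPolynomial (Fin 2) ℝ}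
    (hdeg : ∀ f, (p f).totalDegree ≤ 5)
    (hp : ∀ f, ∀ x ∈ face v f, s x = MvPolynomial.eval (fun k => x k) (p f))
    (f g : Fin 12) (P Q : Fin 10) {c : ℤ × ℤ × ℤ} (h : IsCommonEdge f g P Q c) :
    ∃ a : Fin 3 → ℝ, ∀ x : Plane, MvPolynomial.eval (fun k => x k) (p f) =
      MvPolynomial.eval (fun k => x k) (p g) +
        (∑ i, a i * bary v x i) * linVal Int.cast c (baryVec v x) ^ 4 := by
  obtain ⟨⟨i₁, hi₁⟩, ⟨i₂, hi₂⟩, ⟨i₃, hi₃⟩, ⟨i₄, hi₄⟩, hcP, hcQ, R, hcR, hdet⟩ := h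
  set τ : Fin 3 → Plane := ![splitPoint v P, splitPoint v Q, splitPoint v R]
  have hτ0 : τ 0 = splitPoint v P := rfl
  have hτ1 : τ 1 = splitPoint v Q := rfl
  have hτ2 : τ 2 = splitPoint v R := rfl
  have hτ' : Nondeg τ := by
    change orient (splitPoint v P) (splitPoint v Q) (splitPoint v R) ≠ 0
    rw [orient_splitPoint]
    refine mul_ne_zero (fun h0 => hdet ?_) hv
    have : ((det3 (splitCoord P) (splitCoord Q) (splitCoord R) : ℚ) : ℝ) = 0 := by
      rw [← h0]
      simp [det3]
    exact_mod_cast this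
  set d := splitPoint v Q - splitPoint v P with hd
  set u := splitPoint v R - splitPoint v P with hu
  have hedge : ∀ β ∈ Set.Icc (0 : ℝ) 1, ∀ (f' : Fin 12) (i j : Fin 3), faceVertex f' i = P →
      faceVertex f' j = Q → splitPoint v P + β • d ∈ face v f' := by
    intro β hβ f' i j hi hj
    have hP : splitPoint v P ∈ face v f' := subset_convexHull ℝ _ ⟨i, by simp only [hi]⟩
    have hQ : splitPoint v Q ∈ face v f' := subset_convexHull ℝ _ ⟨j, by simp only [hj]⟩
    have := (convex_convexHull ℝ _).add_smul_sub_mem hP hQ hβ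
    exact this
  obtain ⟨c₀, c₁, c₂, hc⟩ := exists_eval_eq_pow_mul (splitPoint v P) d u (q := p f - p g)
    ((MvPolynomial.totalDegree_sub _ _).trans (max_le (hdeg f) (hdeg g)))
    (S := Set.Icc 0 1) (Set.Icc_infinite one_pos) (by
      intro j hj β hβ
      obtain ⟨-, hj'⟩ := iterate_dirDeriv_eq_on_face (m := 3) hv hs u j (3 - j) (by omega)
      have e₁ := hj' f (p f) (hp f) _ (hedge β hβ f i₁ i₂ hi₁ hi₂)
      have e₂ := hj' g (p g) (hp g) _ (hedge β hβ g i₃ i₄ hi₃ hi₄)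
      rw [e₁] at e₂
      simp only [PiLp.add_apply, PiLp.smul_apply, smul_eq_mul] at e₂
      rw [iterate_map_sub, map_sub, e₂, sub_self])
  set r := linVal Int.cast c (baryVec v (splitPoint v R)) with hr
  have hr0 : r ≠ 0 := by
    rw [hr, linVal_baryVec_splitPoint hv]
    exact div_ne_zero (by exact_mod_cast hcR) (by norm_num)
  -- The form `c` equals `r` times the third coordinate, hence the division by `r ^ 4`. An affine
  -- function is the combination of its values at the corners, which supplies the coefficients.
  refine ⟨fun i => (c₀ + c₁ * bary τ (v i) 2 + c₂ * bary τ (v i) 1) / r ^ 4, fun x => ?_⟩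
  have hx : ∀ k, splitPoint v P k + bary τ x 2 * u k + bary τ x 1 * d k = x k := by
    intro k
    have h1 := sum_bary hτ' x
    have h2 := congrArg (fun y : Plane => y k) (sum_bary_smul hτ' x)
    simp only [Fin.sum_univ_three, PiLp.add_apply, PiLp.smul_apply, smul_eq_mul] at h1 h2
    rw [← h2]
    have : bary τ x 0 = 1 - bary τ x 1 - bary τ x 2 := by linarith
    simp only [this, hu, hd, hτ0, hτ1, hτ2, PiLp.sub_apply]
    ring
  have h3 := hc (bary τ x 2) (bary τ x 1)
  simp only [hx, map_sub] at h3
  have h4 : linVal Int.cast c (baryVec v x) = bary τ x 2 * r := by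
    rw [linVal_baryVec_sum v hτ', Fin.sum_univ_three]
    rw [hτ0, hτ1, hτ2]
    rw [linVal_baryVec_splitPoint hv, linVal_baryVec_splitPoint hv, hcP, hcQ]
    simp [hr]
  have h5 : ∑ i, (c₀ + c₁ * bary τ (v i) 2 + c₂ * bary τ (v i) 1) / r ^ 4 * bary v x i =
      (c₀ + c₁ * bary τ x 2 + c₂ * bary τ x 1) / r ^ 4 := by
    rw [bary_eq_sum hv τ x 2, bary_eq_sum hv τ x 1]
    have h1 := sum_bary hv x
    simp only [Fin.sum_univ_three] at h1 ⊢
    have : bary v x 0 = 1 - bary v x 1 - bary v x 2 := by linarith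
    rw [this]
    ring
  rw [h5, h4, ← sub_eq_iff_eq_add', h3]
  field_simp

/-- The equations of the six interior lines of the 12-split. -/
def interiorForm : Fin 6 → ℤ × ℤ × ℤ :=
  ![(0, -1, 1), (-1, 0, 1), (-1, 1, 0), (-1, 1, 1), (-1, 1, -1), (-1, -1, 1)]

/-- Which of the interior lines separate a face from the first one. -/
def separates : Fin 12 → Fin 6 → Bool :=
  ![![false, false, false, false, false, false], ![true, false, false, false, false, false],
    ![false, false, true, true, true, false], ![false, true, true, true, true, false],
    ![true, true, true, true, false, true], ![true, true, false, true, false, true],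
    ![false, false, false, true, false, false], ![false, false, true, true, false, false],
    ![false, true, true, true, false, false], ![true, true, true, true, false, false],
    ![true, true, false, true, false, false], ![true, false, false, true, false, false]]

theorem formActive_interiorForm (f : Fin 12) (k : Fin 6) :
    interiorForm k ∈ lineForms ∧ formActive f (interiorForm k) = separates f k := by
  revert f k
  decide +kernel

/-- Products of linear forms with fourth powers of two lines are independent. -/
theorem eq_of_two_lines {v : Fin 3 → Plane} (hv : Nondeg v) (k : Fin 3) {a b a' b' : Fin 3 → ℝ}
    (h : ∀ x,
      (∑ i, a i * bary v x i) * linVal Int.cast (interiorForm (k.castAdd 3)) (baryVec v x) ^ 4 +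
      (∑ i, b i * bary v x i) * linVal Int.cast (interiorForm (k.natAdd 3)) (baryVec v x) ^ 4 =
      (∑ i, a' i * bary v x i) * linVal Int.cast (interiorForm (k.castAdd 3)) (baryVec v x) ^ 4 +
      (∑ i, b' i * bary v x i) * linVal Int.cast (interiorForm (k.natAdd 3)) (baryVec v x) ^ 4) :
    a = a' ∧ b = b' := by
  have key : ∀ X Y : ℝ, _ := fun X Y => h (∑ i, ![1 - X - Y, X, Y] i • v i)
  have hb : ∀ X Y : ℝ, bary v (∑ i, ![1 - X - Y, X, Y] i • v i) = ![1 - X - Y, X, Y] :=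
    fun X Y => bary_sum_smul hv _ (by
      simp only [Fin.sum_univ_three, Matrix.cons_val]
      ring)
  simp only [baryVec, hb, Fin.sum_univ_three (f := fun i => _ * _), Matrix.cons_val] at key
  -- The hypothesis is linear in the coefficients; these nine sample points determine them for each
  -- of the three pairs of lines.
  have h1 := key 0 0
  have h2 := key 1 0
  have h3 := key 0 1
  have h4 := key 1 1
  have h5 := key (-1) 1
  have h6 := key 1 (-1)
  have h7 := key 2 0
  have h8 := key 0 2
  have h9 := key 2 1
  suffices ∀ i, a i = a' i ∧ b i = b' i from ⟨funext fun i => (this i).1, funext fun i => (this i).2⟩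
  have e : (0 : Fin 3).castAdd 3 = (0 : Fin 6) ∧ (1 : Fin 3).castAdd 3 = (1 : Fin 6) ∧
    (2 : Fin 3).castAdd 3 = (2 : Fin 6) ∧ (0 : Fin 3).natAdd 3 = (3 : Fin 6) ∧
    (1 : Fin 3).natAdd 3 = (4 : Fin 6) ∧ (2 : Fin 3).natAdd 3 = (5 : Fin 6) := by decide
  obtain ⟨e0, e1, e2, e3, e4, e5⟩ := e
  fin_cases k <;>
  · simp only [Fin.zero_eta, Fin.mk_one, Fin.reduceFinMk, e0, e1, e2, e3, e4, e5, interiorForm,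
      Matrix.cons_val, linVal] at h1 h2 h3 h4 h5 h6 h7 h8 h9
    norm_num at h1 h2 h3 h4 h5 h6 h7 h8 h9
    intro i
    fin_cases i <;> simp only [Fin.zero_eta, Fin.mk_one, Fin.reduceFinMk] <;> constructor <;> linarith

/-- Products of linear forms with fourth powers of the three medians are independent. -/
theorem eq_of_three_lines {v : Fin 3 → Plane} (hv : Nondeg v) {a b c a' b' c' : Fin 3 → ℝ}
    (h : ∀ x,
      (∑ i, a i * bary v x i) * linVal Int.cast (interiorForm 0) (baryVec v x) ^ 4 +
      (∑ i, b i * bary v x i) * linVal Int.cast (interiorForm 1) (baryVec v x) ^ 4 +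
      (∑ i, c i * bary v x i) * linVal Int.cast (interiorForm 2) (baryVec v x) ^ 4 =
      (∑ i, a' i * bary v x i) * linVal Int.cast (interiorForm 0) (baryVec v x) ^ 4 +
      (∑ i, b' i * bary v x i) * linVal Int.cast (interiorForm 1) (baryVec v x) ^ 4 +
      (∑ i, c' i * bary v x i) * linVal Int.cast (interiorForm 2) (baryVec v x) ^ 4) :
    a = a' ∧ b = b' ∧ c = c' := by
  have key : ∀ X Y : ℝ, _ := fun X Y => h (∑ i, ![1 - X - Y, X, Y] i • v i)
  have hb : ∀ X Y : ℝ, bary v (∑ i, ![1 - X - Y, X, Y] i • v i) = ![1 - X - Y, X, Y] :=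
    fun X Y => bary_sum_smul hv _ (by
      simp only [Fin.sum_univ_three, Matrix.cons_val]
      ring)
  simp only [baryVec, hb, Fin.sum_univ_three (f := fun i => _ * _), Matrix.cons_val] at key
  have h1 := key 0 0
  have h2 := key 1 0
  have h3 := key 0 1
  have h4 := key 1 1
  have h5 := key (-1) 1
  have h6 := key 1 (-1)
  have h7 := key 2 0
  have h8 := key 0 2
  have h9 := key 2 1
  have h10 := key 1 2
  have h11 := key (-1) (-1)
  have h12 := key 2 (-1)
  have h13 := key (-1) 2
  simp only [interiorForm, Matrix.cons_val, linVal] at h1 h2 h3 h4 h5 h6 h7 h8 h9 h10 h11 h12 h13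
  norm_num at h1 h2 h3 h4 h5 h6 h7 h8 h9 h10 h11 h12 h13
  suffices ∀ i, a i = a' i ∧ b i = b' i ∧ c i = c' i from
    ⟨funext fun i => (this i).1, funext fun i => (this i).2.1, funext fun i => (this i).2.2⟩
  intro i
  fin_cases i <;> simp only [Fin.zero_eta, Fin.mk_one, Fin.reduceFinMk] <;>
    refine ⟨?_, ?_, ?_⟩ <;> linarith

/-- A spline is the sum of a polynomial and of truncated powers along the interior lines. -/
theorem exists_eq_add_trunc {v : Fin 3 → Plane} (hv : Nondeg v) {s : Plane → ℝ}
    (hs : s ∈ splineSpace v 3 5) :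
    ∃ (p : MvPolynomial (Fin 2) ℝ) (a : Fin 6 → Fin 3 → ℝ), p.totalDegree ≤ 5 ∧
      ∀ x ∈ macroTriangle v, s x = MvPolynomial.eval (fun k => x k) p +
        ∑ k, (∑ i, a k i * bary v x i) *
          max (linVal Int.cast (interiorForm k) (baryVec v x)) 0 ^ 4 := by
  obtain ⟨-, hC, hpoly⟩ := hs
  choose p hdeg hp using hpoly
  have edge := fun f g P Q k (h : IsCommonEdge f g P Q (interiorForm k)) =>
    exists_eval_sub_eq hv hC hdeg hp f g P Q h
  -- The fifteen interior edges: nine on the medians and six on the lines joining midpoints. The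
  -- first face of each pair lies on the positive side of the line, so the cofactors have the sign
  -- needed for truncated powers.
  obtain ⟨a₁, h₁⟩ := edge 1 0 0 6 0 (by decide +kernel)
  obtain ⟨a₂, h₂⟩ := edge 6 0 3 6 3 (by decide +kernel)
  obtain ⟨a₃, h₃⟩ := edge 11 1 5 6 3 (by decide +kernel)
  obtain ⟨a₄, h₄⟩ := edge 11 6 6 9 0 (by decide +kernel)
  obtain ⟨a₅, h₅⟩ := edge 7 6 3 9 2 (by decide +kernel)
  obtain ⟨a₆, h₆⟩ := edge 8 7 7 9 1 (by decide +kernel)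
  obtain ⟨a₇, h₇⟩ := edge 9 8 4 9 0 (by decide +kernel)
  obtain ⟨a₈, h₈⟩ := edge 9 10 8 9 2 (by decide +kernel)
  obtain ⟨a₉, h₉⟩ := edge 10 11 5 9 1 (by decide +kernel)
  obtain ⟨b₁, g₁⟩ := edge 2 7 3 7 4 (by decide +kernel)
  obtain ⟨b₂, g₂⟩ := edge 3 2 1 7 1 (by decide +kernel)
  obtain ⟨b₃, g₃⟩ := edge 3 8 4 7 4 (by decide +kernel)
  obtain ⟨b₄, g₄⟩ := edge 4 5 2 8 2 (by decide +kernel)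
  obtain ⟨b₅, g₅⟩ := edge 4 9 4 8 5 (by decide +kernel)
  obtain ⟨b₆, g₆⟩ := edge 5 10 5 8 5 (by decide +kernel)
  -- At `v₇` the two ways from face 0 to face 11 give the same difference of pieces, so each of the
  -- two crossing lines keeps its cofactor. The same argument applies at `v₈` and `v₉`.
  obtain ⟨rfl, rfl⟩ := eq_of_two_lines hv 0 (a := a₁) (b := a₃) (a' := a₄) (b' := a₂) fun x => by
    change _ * linVal Int.cast (interiorForm 0) _ ^ 4 + _ * linVal Int.cast (interiorForm 3) _ ^ 4 =
      _ * linVal Int.cast (interiorForm 0) _ ^ 4 + _ * linVal Int.cast (interiorForm 3) _ ^ 4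
    linarith [h₁ x, h₂ x, h₃ x, h₄ x]
  obtain ⟨rfl, rfl⟩ := eq_of_two_lines hv 1 (a := b₂) (b := b₁) (a' := a₆) (b' := b₃) fun x => by
    change _ * linVal Int.cast (interiorForm 1) _ ^ 4 + _ * linVal Int.cast (interiorForm 4) _ ^ 4 =
      _ * linVal Int.cast (interiorForm 1) _ ^ 4 + _ * linVal Int.cast (interiorForm 4) _ ^ 4
    linarith [g₁ x, g₂ x, g₃ x, h₆ x]
  obtain ⟨rfl, rfl⟩ := eq_of_two_lines hv 2 (a := b₄) (b := b₆) (a' := a₈) (b' := b₅) fun x => by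
    change _ * linVal Int.cast (interiorForm 2) _ ^ 4 + _ * linVal Int.cast (interiorForm 5) _ ^ 4 =
      _ * linVal Int.cast (interiorForm 2) _ ^ 4 + _ * linVal Int.cast (interiorForm 5) _ ^ 4
    linarith [g₄ x, g₅ x, g₆ x, h₈ x]
  -- At the centroid the two ways from face 6 to face 9 each cross all three medians, so each median
  -- keeps its cofactor there too.
  obtain ⟨rfl, rfl, rfl⟩ := eq_of_three_lines hv (a := a₁) (b := a₉) (c := b₄) (a' := a₇) (b' := b₂)
    (c' := a₅) fun x => by
    linarith [h₄ x, h₅ x, h₆ x, h₇ x, h₈ x, h₉ x]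
  -- Each line now has one cofactor along its whole length, and every piece is `p 0` plus the
  -- contributions of the lines separating its face from face 0.
  refine ⟨p 0, ![a₁, a₉, b₄, a₃, b₁, b₆], hdeg 0, fun x hx => ?_⟩
  obtain ⟨f, hf⟩ : ∃ f, x ∈ face v f := by
    obtain ⟨cell, hcell⟩ := exists_isFaceAssignment v
    obtain ⟨h, f, e⟩ := hcell x hx
    exact ⟨f, e ▸ h⟩
  have hmax : ∀ k, max (linVal Int.cast (interiorForm k) (baryVec v x)) 0 =
      if separates f k then linVal Int.cast (interiorForm k) (baryVec v x) else 0 := by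
    intro k
    rw [max_linVal_of_mem_face hv hf (formActive_interiorForm f k).1,
      (formActive_interiorForm f k).2]
  rw [hp f x hf]
  simp only [hmax, Fin.sum_univ_succ (n := 5), Fin.sum_univ_succ (n := 4), Fin.sum_univ_four,
    Fin.succ_zero_eq_one, Fin.succ_one_eq_two, Fin.reduceSucc, Matrix.cons_val]
  have k₁ := h₁ x
  have k₂ := h₂ x
  have k₃ := h₃ x
  have k₄ := h₄ x
  have k₅ := h₅ x
  have k₆ := h₆ x
  have k₇ := h₇ x
  have k₈ := h₈ x
  have k₉ := h₉ x
  have l₁ := g₁ x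
  have l₂ := g₂ x
  have l₃ := g₃ x
  have l₄ := g₄ x
  have l₅ := g₅ x
  have l₆ := g₆ x
  fin_cases f <;> simp [separates] <;> linarith

/-! ### The dimension of the spline space -/

/-- Functions that span a space containing the splines. -/
noncomputable def spanningSpline (v : Fin 3 → Plane) :
    {p : Fin 6 × Fin 6 // (p.1 : ℕ) + p.2 ≤ 5} ⊕ Fin 6 × Fin 3 → Plane → ℝ
  | .inl p => (macroTriangle v).indicator fun x => x 0 ^ (p.1.1 : ℕ) * x 1 ^ (p.1.2 : ℕ)
  | .inr q => (macroTriangle v).indicator fun x =>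
      bary v x q.2 * max (linVal Int.cast (interiorForm q.1) (baryVec v x)) 0 ^ 4

theorem splineSpace_le_span {v : Fin 3 → Plane} (hv : Nondeg v) :
    splineSpace v 3 5 ≤ Submodule.span ℝ (Set.range (spanningSpline v)) := by
  intro s hs
  obtain ⟨p, a, hp, h⟩ := exists_eq_add_trunc hv hs
  have e : s = (macroTriangle v).indicator (fun x => MvPolynomial.eval (fun k => x k) p) +
      ∑ k, ∑ i, a k i • spanningSpline v (.inr (k, i)) := by
    funext x
    simp only [Pi.add_apply, Finset.sum_apply, Pi.smul_apply, spanningSpline]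
    by_cases hx : x ∈ macroTriangle v
    · simp only [Set.indicator_of_mem hx, smul_eq_mul]
      rw [h x hx]
      congr 1
      refine Finset.sum_congr rfl fun k _ => ?_
      rw [Finset.sum_mul]
      exact Finset.sum_congr rfl fun i _ => mul_assoc _ _ _
    · simp only [Set.indicator_of_notMem hx, smul_zero, Finset.sum_const_zero, add_zero]
      exact hs.1 x hx
  have hmon : ∀ t ∈ p.support, t 0 + t 1 ≤ 5 := by
    intro t ht
    have := (MvPolynomial.le_totalDegree ht).trans hp
    rwa [Finsupp.sum_fintype _ _ (fun _ => rfl), Fin.sum_univ_two] at this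
  have e' : (macroTriangle v).indicator (fun x => MvPolynomial.eval (fun k => x k) p) =
      ∑ t ∈ p.support.attach, MvPolynomial.coeff t.1 p • spanningSpline v (.inl
        ⟨(⟨t.1 0, by have := hmon _ t.2; omega⟩, ⟨t.1 1, by have := hmon _ t.2; omega⟩),
          hmon _ t.2⟩) := by
    funext x
    simp only [Finset.sum_apply, Pi.smul_apply, spanningSpline]
    by_cases hx : x ∈ macroTriangle v
    · simp only [Set.indicator_of_mem hx, smul_eq_mul]
      rw [MvPolynomial.eval_eq', ← Finset.sum_attach]
      exact Finset.sum_congr rfl fun t _ => by rw [Fin.prod_univ_two]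
    · simp [Set.indicator_of_notMem hx]
  rw [e, e']
  refine add_mem (sum_mem fun t _ => ?_) (sum_mem fun k _ => sum_mem fun i _ => ?_) <;>
    exact Submodule.smul_mem _ _ (Submodule.subset_span ⟨_, rfl⟩)

/-- There are 21 monomials of degree at most five in two variables, and six lines with
three-dimensional cofactors. -/
theorem finrank_splineSpace_le {v : Fin 3 → Plane} (hv : Nondeg v) :
    FiniteDimensional ℝ (splineSpace v 3 5) ∧ Module.finrank ℝ (splineSpace v 3 5) ≤ 39 := by
  have hle := splineSpace_le_span hv
  have : FiniteDimensional ℝ (Submodule.span ℝ (Set.range (spanningSpline v))) :=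
    FiniteDimensional.span_of_finite ℝ (Set.finite_range _)
  refine ⟨Submodule.finiteDimensional_of_le hle, (Submodule.finrank_mono hle).trans
    ((finrank_range_le_card _).trans ?_)⟩
  have : Fintype.card {p : Fin 6 × Fin 6 // (p.1 : ℕ) + p.2 ≤ 5} = 21 := by decide +kernel
  simp [this]

/-! ### The nodal basis -/

/-- The derivative of a linear combination of smooth functions. -/
theorem iterate_dirDeriv_sum {v : Fin 3 → Plane} (hv : Nondeg v) {ι : Type*} (t : Finset ι)
    (c : ι → ℝ) (g : ι → Plane → ℝ) (u : Plane) (n j : ℕ) {G : Plane → ℝ}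
    (hg : ∀ i ∈ t, ContDiffOn ℝ (n + j : ℕ) (g i) (macroTriangle v))
    (hG : Set.EqOn G (fun x => ∑ i ∈ t, c i * g i x) (macroTriangle v)) :
    (∀ i ∈ t, ContDiffOn ℝ n ((dirDeriv v u)^[j] (g i)) (macroTriangle v)) ∧
    Set.EqOn ((dirDeriv v u)^[j] G) (fun x => ∑ i ∈ t, c i * (dirDeriv v u)^[j] (g i) x)
      (macroTriangle v) := by
  induction j generalizing n with
  | zero => exact ⟨hg, hG⟩
  | succ j ih =>
    obtain ⟨h1, h2⟩ := ih (n + 1) fun i hi => by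
      have := hg i hi
      rwa [Nat.add_right_comm n 1 j]
    have hu := uniqueDiffOn_macroTriangle hv
    refine ⟨fun i hi => ?_, fun x hx => ?_⟩
    · rw [Function.iterate_succ_apply']
      exact (dirDeriv_eq_on_face hv (h1 i hi) u).1
    · simp only [Function.iterate_succ_apply']
      have hd := fun i hi => ((h1 i hi).differentiableOn (by simp)) x hx
      rw [dirDeriv, fderivWithin_congr' h2 hx,
        fderivWithin_fun_sum (hu x hx) fun i hi => (hd i hi).const_mul _, sum_apply]
      refine Finset.sum_congr rfl fun i hi => ?_
      rw [fderivWithin_const_mul (hu x hx) (hd i hi)]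
      rfl

/-- Linearity is claimed only on the spline space: for functions that are not differentiable,
`fderivWithin` takes a default value and is not additive. -/
theorem nodalFunctional_sum {v : Fin 3 → Plane} (hv : Nondeg v) {ι : Type*} (t : Finset ι)
    (c : ι → ℝ) (g : ι → Plane → ℝ) (hg : ∀ i ∈ t, g i ∈ splineSpace v 3 5) (l : NodalIndex) :
    nodalFunctional v l (∑ i ∈ t, c i • g i) = ∑ i ∈ t, c i * nodalFunctional v l (g i) := by
  have hg' : ∀ n j, n + j ≤ 3 → ∀ i ∈ t, ContDiffOn ℝ (n + j : ℕ) (g i) (macroTriangle v) :=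
    fun n j h i hi => (hg i hi).2.1.of_le (by exact_mod_cast h)
  have hG : Set.EqOn (∑ i ∈ t, c i • g i) (fun x => ∑ i ∈ t, c i * g i x) (macroTriangle v) :=
    fun x _ => by simp
  have hmem : ∀ (a b : Fin 3) (r s : ℝ), 0 ≤ r → 0 ≤ s → r + s = 1 →
      r • v a + s • v b ∈ macroTriangle v := fun a b r s hr hs h =>
    (convex_convexHull ℝ (Set.range v)) (subset_convexHull ℝ _ ⟨a, rfl⟩)
      (subset_convexHull ℝ _ ⟨b, rfl⟩) hr hs h
  cases l with
  | vertex k i j h =>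
    obtain ⟨h1, h2⟩ := iterate_dirDeriv_sum hv t c g (v (k + 2) - v k) i j (hg' i j h) hG
    obtain ⟨-, h3⟩ := iterate_dirDeriv_sum hv t c _ (v (k + 1) - v k) 0 i
      (by simpa using h1) h2
    exact h3 (subset_convexHull ℝ _ ⟨k, rfl⟩)
  | quarter₁ k =>
    refine (iterate_dirDeriv_sum hv t c g (crossDir v k) 0 2 (hg' 0 2 (by norm_num)) hG).2 ?_
    convert hmem k (k + 1) (3 / 4) (1 / 4) (by norm_num) (by norm_num) (by norm_num) using 1
    module
  | mid k =>
    refine (iterate_dirDeriv_sum hv t c g (crossDir v k) 0 1 (hg' 0 1 (by norm_num)) hG).2 ?_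
    convert hmem k (k + 1) (1 / 2) (1 / 2) (by norm_num) (by norm_num) (by norm_num) using 1
    module
  | quarter₂ k =>
    refine (iterate_dirDeriv_sum hv t c g (crossDir v k) 0 2 (hg' 0 2 (by norm_num)) hG).2 ?_
    convert hmem k (k + 1) (1 / 4) (3 / 4) (by norm_num) (by norm_num) (by norm_num) using 1
    module

/-- The labels of the functionals, as a type that is visibly finite. -/
def NodalIndex.ofSum :
    (Fin 3 × {p : Fin 4 × Fin 4 // (p.1 : ℕ) + p.2 ≤ 3}) ⊕ (Fin 3 × Fin 3) → NodalIndex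
  | .inl (k, p) => .vertex k p.1.1 p.1.2 p.2
  | .inr (k, 0) => .quarter₁ k
  | .inr (k, 1) => .mid k
  | .inr (k, 2) => .quarter₂ k

theorem NodalIndex.ofSum_bijective : Function.Bijective NodalIndex.ofSum := by
  constructor
  · rintro (⟨k, ⟨i, j⟩, h⟩ | ⟨k, m⟩) (⟨k', ⟨i', j'⟩, h'⟩ | ⟨k', m'⟩) e
    · simpa [NodalIndex.ofSum, Fin.ext_iff] using e
    · fin_cases m' <;> simp [NodalIndex.ofSum] at e
    · fin_cases m <;> simp [NodalIndex.ofSum] at e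
    · fin_cases m <;> fin_cases m' <;> simp_all [NodalIndex.ofSum]
  · rintro (⟨k, i, j, h⟩ | k | k | k)
    · exact ⟨.inl (k, ⟨(⟨i, by omega⟩, ⟨j, by omega⟩), h⟩), rfl⟩
    · exact ⟨.inr (k, 0), rfl⟩
    · exact ⟨.inr (k, 1), rfl⟩
    · exact ⟨.inr (k, 2), rfl⟩

noncomputable instance : Fintype NodalIndex :=
  Fintype.ofBijective _ NodalIndex.ofSum_bijective

theorem card_nodalIndex : Fintype.card NodalIndex = 39 := by
  rw [← Fintype.card_of_bijective NodalIndex.ofSum_bijective]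
  decide +kernel

/-- The eight formulas cover the derivatives up to exchanging the two directions and permuting the
corners, and both are effected by a choice of frame. -/
theorem exists_eq_nodalIndex (l : NodalIndex) : ∃ σ F, l = nodalIndex σ F := by
  obtain ⟨a, rfl⟩ := NodalIndex.ofSum_bijective.2 l
  have : ∀ a, ∃ σ F, (NodalIndex.ofSum a).code = (nodalIndex σ F).code := by decide +kernel
  obtain ⟨σ, F, h⟩ := this a
  exact ⟨σ, F, NodalIndex.code_injective h⟩

/-- One frame and formula is chosen for each functional. The basis does not depend on this choice,
because a spline is determined by its nodal values. -/
theorem exists_nodalBasis {v : Fin 3 → Plane} (hv : AffineIndependent ℝ v)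
    {cell : Plane → Set Plane} (hcell : IsFaceAssignment v cell) :
    ∃ b : Module.Basis NodalIndex ℝ (splineSpace v 3 5),
      (∀ l, nodalFunctional v l (b l) = 1) ∧
      (∀ l l', l ≠ l' → nodalFunctional v l' (b l) = 0) ∧
      ∀ (σ : Equiv.Perm (Fin 3)) F, (b (nodalIndex σ F) : Plane → ℝ) = nodalSpline (fun k => v (σ k)) cell F := by
  classical
  have hn := nondeg_of_affineIndependent hv
  choose σ F hσ using exists_eq_nodalIndex
  have hmem : ∀ (σ : Equiv.Perm (Fin 3)) F, nodalSpline (fun k => v (σ k)) cell F ∈ splineSpace v 3 5 := fun σ F =>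
    splineSpace_perm v σ
      (nodalSpline_mem (nondeg_perm hv σ) (isFaceAssignment_perm hcell σ) F)
  let B : NodalIndex → splineSpace v 3 5 := fun l => ⟨_, hmem (σ l) (F l)⟩
  have hB : ∀ l l', nodalFunctional v l' (B l) = if l' = l then 1 else 0 := by
    intro l l'
    conv_rhs => rw [hσ l]
    convert nodalFunctional_nodalSpline hv hcell (σ l) (F l) l'
  have hsum : ∀ (c : NodalIndex → ℝ) l, nodalFunctional v l ((∑ i, c i • B i : splineSpace v 3 5) :
      Plane → ℝ) = c l := by
    intro c l
    have e : ((∑ i, c i • B i : splineSpace v 3 5) : Plane → ℝ) =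
        ∑ i, c i • (B i : Plane → ℝ) := by simp
    rw [e, nodalFunctional_sum hn _ _ _ fun i _ => (B i).2]
    simp [hB]
  have h0 : ∀ l, nodalFunctional v l 0 = 0 := by
    intro l
    simpa using nodalFunctional_sum hn (∅ : Finset ℕ) 0 0 (by simp) l
  have hli : LinearIndependent ℝ B := by
    rw [Fintype.linearIndependent_iff]
    intro c hc l
    rw [← hsum c l, hc]
    exact h0 l
  obtain ⟨hfin, hrank⟩ := finrank_splineSpace_le hn
  -- Duality gives 39 independent splines and the truncated powers give dimension at most 39, so
  -- independence alone makes them a basis.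
  have hcard : Fintype.card NodalIndex = Module.finrank ℝ (splineSpace v 3 5) :=
    le_antisymm hli.fintype_card_le_finrank (hrank.trans card_nodalIndex.ge)
  have : Nonempty NodalIndex := ⟨.mid 0⟩
  let b := basisOfLinearIndependentOfCardEqFinrank hli hcard
  have hb : ∀ l, b l = B l := fun l => by
    simp [b]
  have hcoe : ∀ g : splineSpace v 3 5, g = ∑ l, nodalFunctional v l g • B l := by
    intro g
    have h1 := b.sum_repr g
    simp only [hb] at h1
    have h2 := hsum (b.repr g)
    rw [h1] at h2
    simp only [h2]
    exact h1.symm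
  refine ⟨b, fun l => ?_, fun l l' h => ?_, fun τ G => ?_⟩
  · rw [hb, hB, if_pos rfl]
  · rw [hb, hB, if_neg h.symm]
  · rw [hb]
    -- The function of an arbitrary frame is expanded in the basis by its nodal values; only the
    -- coefficient at its own label survives.
    have h1 := hcoe ⟨_, hmem τ G⟩
    have h2 : ∀ l, nodalFunctional v l (nodalSpline (fun k => v (τ k)) cell G) =
        if l = nodalIndex τ G then 1 else 0 := fun l => by
      convert nodalFunctional_nodalSpline hv hcell τ G l
    simp only [h2, ite_smul, one_smul, zero_smul, Finset.sum_ite_eq', Finset.mem_univ, if_true] at h1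
    exact congrArg Subtype.val h1.symm

/-! ### The formulas in terms of knot multiplicities -/

theorem knotCount_knots (i j k l m n : ℕ) :
    knotCount (knots i j k l m n) = ![i, j, k, l, m, n, 0, 0, 0, 0] := by
  funext j
  fin_cases j <;> simp [knotCount, knots, List.count_append, List.count_replicate]

theorem simplexSpline_knotCount_knots (v : Fin 3 → Plane) (cell : Plane → Set Plane)
    (i j k l m n : ℕ) :
    simplexSpline v cell (knotCount (knots i j k l m n)) = simplexSpline₆ v cell i j k l m n := by
  rw [knotCount_knots, simplexSpline₆]

end PowellSabin

theorem mainTheorem6 (v : Fin 3 → Plane) (hv : AffineIndependent ℝ v)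
    (cell : Plane → Set Plane) (hcell : IsFaceAssignment v cell) :
    ∃ b : Module.Basis NodalIndex ℝ (splineSpace v 3 5),
      (∀ l, nodalFunctional v l (b l) = 1) ∧
      (∀ l l', l ≠ l' → nodalFunctional v l' (b l) = 0) ∧
      ∀ σ : Equiv.Perm (Fin 3),
        let Q := simplexSpline₆ (fun k => v (σ k)) cell
        (b (vertexIndex σ 0 0) : Plane → ℝ) =
          (1 / 4 : ℝ) • Q 6 0 0 1 0 1
          + (1 / 4 : ℝ) • (Q 5 0 0 2 0 1 + Q 5 0 0 1 0 2)
          + (1 / 2 : ℝ) • (Q 4 1 0 2 0 1 + Q 4 0 1 1 0 2)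
          + Q 4 1 1 1 0 1
          + (1 / 2 : ℝ) • (Q 3 1 1 2 0 1 + Q 3 1 1 1 0 2)
          + (1 / 2 : ℝ) • (Q 3 2 0 2 0 1 + Q 3 0 2 1 0 2)
          + (9 / 16 : ℝ) • (Q 2 1 1 2 1 1 + Q 2 1 1 1 1 2)
          + (3 / 8 : ℝ) • (Q 2 2 0 2 1 1 + Q 2 0 2 1 1 2)
          + (3 / 16 : ℝ) • (Q 1 1 2 1 1 2 + Q 1 2 1 2 1 1) ∧
        (b (vertexIndex σ 1 0) : Plane → ℝ) =
          (1 / 40 : ℝ) • Q 5 0 0 2 0 1 + (1 / 10 : ℝ) • Q 4 1 0 2 0 1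
          + (1 / 5 : ℝ) • Q 3 2 0 2 0 1 + (1 / 10 : ℝ) • Q 4 1 1 1 0 1
          + (3 / 20 : ℝ) • Q 3 1 1 2 0 1 + (13 / 80 : ℝ) • Q 2 2 0 2 1 1
          + (1 / 20 : ℝ) • Q 3 1 1 1 0 2 + (19 / 80 : ℝ) • Q 2 1 1 2 1 1
          + (1 / 10 : ℝ) • Q 1 2 1 2 1 1 - (1 / 40 : ℝ) • Q 2 1 1 1 1 2
          - (1 / 40 : ℝ) • Q 2 0 2 1 1 2 - (1 / 20 : ℝ) • Q 1 1 2 1 1 2 ∧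
        (b (vertexIndex σ 2 0) : Plane → ℝ) =
          (1 / 160 : ℝ) • Q 4 1 0 2 0 1 + (1 / 32 : ℝ) • Q 3 2 0 2 0 1
          + (1 / 80 : ℝ) • Q 3 1 1 2 0 1 + (17 / 640 : ℝ) • Q 2 2 0 2 1 1
          + (121 / 3840 : ℝ) • Q 2 1 1 2 1 1 + (71 / 3840 : ℝ) • Q 1 2 1 2 1 1
          - (1 / 48 : ℝ) • Q 2 1 1 1 1 2 + (1 / 480 : ℝ) • Q 1 1 2 1 1 2 ∧
        (b (vertexIndex σ 1 1) : Plane → ℝ) =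
          (1 / 80 : ℝ) • Q 4 1 1 1 0 1
          + (3 / 160 : ℝ) • (Q 3 1 1 2 0 1 + Q 3 1 1 1 0 2)
          - (1 / 160 : ℝ) • (Q 2 2 0 2 1 1 + Q 2 0 2 1 1 2)
          + (17 / 960 : ℝ) • (Q 2 1 1 1 1 2 + Q 2 1 1 2 1 1)
          - (7 / 480 : ℝ) • (Q 1 1 2 1 1 2 + Q 1 2 1 2 1 1) ∧
        (b (vertexIndex σ 3 0) : Plane → ℝ) =
          (1 / 480 : ℝ) • Q 3 2 0 2 0 1 + (7 / 3840 : ℝ) • Q 2 2 0 2 1 1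
          + (5 / 3072 : ℝ) • Q 2 1 1 2 1 1 + (7 / 5120 : ℝ) • Q 1 2 1 2 1 1 ∧
        (b (vertexIndex σ 2 1) : Plane → ℝ) =
          (1 / 480 : ℝ) • Q 3 1 1 2 0 1 - (1 / 1920 : ℝ) • Q 2 2 0 2 1 1
          - (1 / 768 : ℝ) • Q 1 2 1 2 1 1 + (11 / 3840 : ℝ) • Q 2 1 1 2 1 1
          - (11 / 3840 : ℝ) • Q 2 1 1 1 1 2 + (1 / 3840 : ℝ) • Q 1 1 2 1 1 2 ∧
        (b (quarterIndex σ) : Plane → ℝ) =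
          (7 / 240 : ℝ) • Q 2 1 1 2 1 1 - (1 / 240 : ℝ) • Q 1 2 1 2 1 1 ∧
        (b (midIndex σ) : Plane → ℝ) =
          (1 / 10 : ℝ) • Q 2 2 0 2 1 1
          + (1 / 5 : ℝ) • (Q 2 1 1 2 1 1 + Q 1 2 1 2 1 1) := by
  obtain ⟨b, h1, h2, h3⟩ := exists_nodalBasis hv hcell
  refine ⟨b, h1, h2, fun σ => ?_⟩
  intro Q
  have h := h3 σ
  refine ⟨(h 0).trans ?_, (h 1).trans ?_, (h 2).trans ?_, (h 3).trans ?_, (h 4).trans ?_,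
    (h 5).trans ?_, (h 6).trans ?_, (h 7).trans ?_⟩ <;>
  · funext x
    simp only [nodalSpline, formulaTerms, formulaScale, Matrix.cons_val, List.map_cons,
      List.map_nil, List.sum_cons, List.sum_nil, simplexSpline_knotCount_knots, Pi.add_apply,
      Pi.sub_apply, Pi.smul_apply, smul_eq_mul, Q]
    push_cast
    ring
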